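/- Let $f\colon\widehat{\mathbb C}\to\widehat{\mathbb C}$ be a rational map of degree at least $2$ whose postcritical set $\operatorname{post}(f)=\{f^n(c): c \text{ a critical point of } f,\ n\ge 1\}$ is finite. Let $\mathcal C\subset\widehat{\mathbb C}$ be an oriented Jordan curve with $\operatorname{post}(f)\subset\mathcal C$, and put $\mathcal C^1:=f^{-1}(\mathcal C)$ and $V^1:=f^{-1}(\operatorname{post}(f))$. The closures of the components of $\mathcal C^1\setminus V^1$ are called $1$-edges; each $1$-edge $E^1$ is mapped by $f$ homeomorphically onto an arc $E^0\subset\mathcal C$. The closures of the two components of $\widehat{\mathbb C}\setminus\mathcal C$ are the $0$-tiles; one of them is colored white, the other black. The closures of the components of $\widehat{\mathbb C}\setminus\mathcal C^1$ are the $1$-tiles; each is mapped by $f$ homeomorphically onto a $0$-tile, and it gets the color of that $0$-tile. Let $H\colon\widehat{\mathbb C}\times[0,1]\to\widehat{\mathbb C}$, $H_t=H(\cdot,t)$, be an elementary pseudo-isotopic deformation of $\mathcal C$ to $\mathcal C^1$ rel. $\operatorname{post}(f)$. That is, $H$ is continuous, $H_0=\mathrm{id}$, $H_t$ is a homeomorphism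 of $\widehat{\mathbb C}$ for every $t\in[0,1)$, $H_t(p)=p$ for all $p\in\operatorname{post}(f)$ and $t\in[0,1]$, and moreover $H_1(\mathcal C)=\mathcal C^1$, the set $W:=H_1^{-1}(V^1)\cap\mathcal C$ is finite, and $H_1\colon\mathcal C\setminus W\to\mathcal C^1\setminus V^1$ is a homeomorphism. Thus for each $1$-edge $E^1$ there is exactly one arc $A\subset\mathcal C$ that is the closure of a component of $\mathcal C\setminus W$ and is mapped by $H_1$ homeomorphically onto $E^1$. Call $H$ orientation-preserving (respectively orientation-reversing) if for every $1$-edge $E^1$ the two orientations on $E^1$ induced from the orientation of $\mathcal C$ by $H_1\colon A\to E^1$ and by $f\colon E^1\to E^0$ agree (respectively are opposite). Then the following hold. 1. $H$ is either orientation-preserving or orientation-reversing (and not both). 2. Let $x,y\in\widehat{\mathbb C}\setminus H_1^{-1}(\mathcal C^1)$. Let $X^0\ni x$ and $Y^0\ni y$ be the $0$-tiles containing $x$ and $y$, and let $X^1\ni H_1(x)$ and $Y^1\ni H_1(y)$ be the $1$-tiles containing $H_1(x)$ and $H_1(y)$. Then $X^0$ and $Y^0$ have the same color if and only if $X^1$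 and $Y^1$ have the same color. 3. For $x$, $X^0$, $X^1$ as in 2, the tiles $X^0$ and $X^1$ have the same color if and only if $H$ is orientation-preserving. -/

import Mathlib

open Set Topology Polynomial unitInterval

/-- The Riemann sphere `ℂ ∪ {∞}`. -/
abbrev RSphere : Type := OnePoint ℂ

/-- `f` is a rational map of degree `d`: `f = p / q` with `p`, `q` coprime polynomials and
`d = max (deg p) (deg q)`; its value at `∞` is the limit, read off from the coefficients of
degree `d`. -/
def IsRationalMapOfDegree (f : RSphere → RSphere) (d : ℕ) : Prop :=
  ∃ p q : ℂ[X], IsCoprime p q ∧ d = max p.natDegree q.natDegree ∧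
    (∀ z : ℂ, (q.eval z ≠ 0 → f (z : RSphere) = ((p.eval z / q.eval z : ℂ) : RSphere)) ∧
      (q.eval z = 0 → f (z : RSphere) = OnePoint.infty)) ∧
    (q.coeff d ≠ 0 → f OnePoint.infty = ((p.coeff d / q.coeff d : ℂ) : RSphere)) ∧
    (q.coeff d = 0 → f OnePoint.infty = OnePoint.infty)

/-- A critical point: a point at which `f` is not locally injective (local degree at least 2). -/
def IsCriticalPoint (f : RSphere → RSphere) (c : RSphere) : Prop :=
  ¬ ∃ U ∈ 𝓝 c, InjOn f U

/-- The postcritical set: all `f^n(c)` with `c` critical and `n ≥ 1`. -/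
def postcriticalSet (f : RSphere → RSphere) : Set RSphere :=
  {x | ∃ c, IsCriticalPoint f c ∧ ∃ n : ℕ, 1 ≤ n ∧ f^[n] c = x}

/-- `γ` parametrizes the Jordan curve `C`. It also fixes an orientation of `C`, namely the one in
which the parameter increases. -/
structure IsOrientedJordanCurve (C : Set RSphere) (γ : UnitAddCircle → RSphere) : Prop where
  continuous : Continuous γ
  injective : Function.Injective γ
  range_eq : range γ = C

/-- `U` is a connected component of the subset `F` of the sphere. -/
def IsComponentOf (F U : Set RSphere) : Prop :=
  ∃ x ∈ F, U = connectedComponentIn F x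

/-- `X` is the closure of a component of the complement of `K`. The `0`-tiles are obtained for
`K = C`, the `1`-tiles for `K = f⁻¹(C)`. -/
def IsTile (K X : Set RSphere) : Prop :=
  ∃ U, IsComponentOf Kᶜ U ∧ X = closure U

inductive TileColor : Type
  | white : TileColor
  | black : TileColor

open Classical in
/-- The color of a `0`-tile, where `Xw` is the `0`-tile chosen to be white. -/
noncomputable def zeroTileColor (Xw X : Set RSphere) : TileColor :=
  if X = Xw then TileColor.white else TileColor.black

/-- The color of a `1`-tile is the color of the `0`-tile onto which `f` maps it. -/
noncomputable def oneTileColor (f : RSphere → RSphere) (Xw X : Set RSphere) : TileColor :=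
  zeroTileColor Xw (f '' X)

/-- The `1`-vertices: the preimages of the postcritical points. -/
def oneVertices (f : RSphere → RSphere) : Set RSphere := f ⁻¹' postcriticalSet f

/-- The `1`-edges: closures of the components of `f⁻¹(C)` minus the `1`-vertices. -/
def IsOneEdge (f : RSphere → RSphere) (C E : Set RSphere) : Prop :=
  ∃ U, IsComponentOf (f ⁻¹' C \ oneVertices f) U ∧ E = closure U

/-- `H` is a pseudo-isotopy rel. `P` of the sphere, starting at the identity. -/
structure IsPseudoIsotopyRel (P : Set RSphere) (H : RSphere × I → RSphere) : Prop where
  continuous : Continuous H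
  homeo : ∀ t : I, t < 1 → IsHomeomorph fun x => H (x, t)
  start : ∀ x, H (x, 0) = x
  rel : ∀ x ∈ P, ∀ t : I, H (x, t) = x

/-- The end `H₁` of a pseudo-isotopy. -/
def endMap (H : RSphere × I → RSphere) : RSphere → RSphere := fun x => H (x, 1)

/-- The points of `C` that are deformed to `1`-vertices. -/
def vertexPreimages (f : RSphere → RSphere) (C : Set RSphere) (H : RSphere × I → RSphere) :
    Set RSphere :=
  endMap H ⁻¹' oneVertices f ∩ C

/-- `H` is an elementary pseudo-isotopic deformation of `C` to `f⁻¹(C)` rel. `post(f)`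
(with no condition on orientations). -/
structure IsElementaryDeformation (f : RSphere → RSphere) (C : Set RSphere)
    (H : RSphere × I → RSphere) : Prop where
  pseudoIsotopy : IsPseudoIsotopyRel (postcriticalSet f) H
  image_eq : endMap H '' C = f ⁻¹' C
  finite : (vertexPreimages f C H).Finite
  homeo : ∃ e : ↥(C \ vertexPreimages f C H) ≃ₜ ↥(f ⁻¹' C \ oneVertices f),
    ∀ x, (e x : RSphere) = endMap H x

/-- The arcs into which `C` is divided by the points that are deformed to `1`-vertices. -/
def IsDeformedArc (f : RSphere → RSphere) (C : Set RSphere) (H : RSphere × I → RSphere)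
    (A : Set RSphere) : Prop :=
  ∃ U, IsComponentOf (C \ vertexPreimages f C H) U ∧ A = closure U

/-- `β` is a parametrization of the arc `A` by the unit interval. -/
structure ParametrizesArc (A : Set RSphere) (β : I → RSphere) : Prop where
  continuous : Continuous β
  injective : Function.Injective β
  range_eq : range β = A

/-- The orientation of an arc `A` contained in the Jordan curve parametrized by `γ`. An orientation
of an arc is represented by the set of its positively oriented parametrizations, here those that
run through `A` in the direction of `γ`. -/
def curveOrientation (γ : UnitAddCircle → RSphere) (A : Set RSphere) : Set (I → RSphere) :=
  {α | ParametrizesArc A α ∧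
    ∃ τ : I → ℝ, Continuous τ ∧ StrictMono τ ∧ ∀ s, α s = γ (τ s : UnitAddCircle)}

/-- The orientation on `h(A)` induced by `h : A → h(A)` and the orientation of `A`. -/
def pushOrientation (γ : UnitAddCircle → RSphere) (h : RSphere → RSphere) (A : Set RSphere) :
    Set (I → RSphere) :=
  {β | ∃ α ∈ curveOrientation γ A, β = h ∘ α}

/-- The orientation on `E` induced by `f : E → f(E)` and the orientation of `f(E)`. -/
def pullOrientation (γ : UnitAddCircle → RSphere) (f : RSphere → RSphere) (E : Set RSphere) :
    Set (I → RSphere) :=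
  {β | ParametrizesArc E β ∧ f ∘ β ∈ curveOrientation γ (f '' E)}

/-- The opposite orientation of an arc. -/
def oppositeOrientation (o : Set (I → RSphere)) : Set (I → RSphere) :=
  {β | β ∘ unitInterval.symm ∈ o}

/-- For every `1`-edge `E`, with corresponding arc `A` in `C`, the orientations on `E` induced by
`H₁ : A → E` and by `f : E → f(E)` agree. -/
def IsOrientationPreservingDeformation (f : RSphere → RSphere) (C : Set RSphere)
    (γ : UnitAddCircle → RSphere) (H : RSphere × I → RSphere) : Prop :=
  ∀ E A, IsOneEdge f C E → IsDeformedArc f C H A → endMap H '' A = E →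
    pushOrientation γ (endMap H) A = pullOrientation γ f E

/-- For every `1`-edge `E`, with corresponding arc `A` in `C`, the orientations on `E` induced by
`H₁ : A → E` and by `f : E → f(E)` are opposite. -/
def IsOrientationReversingDeformation (f : RSphere → RSphere) (C : Set RSphere)
    (γ : UnitAddCircle → RSphere) (H : RSphere × I → RSphere) : Prop :=
  ∀ E A, IsOneEdge f C E → IsDeformedArc f C H A → endMap H '' A = E →
    pushOrientation γ (endMap H) A = oppositeOrientation (pullOrientation γ f E)

/-! Fix a postcritical point `q` and a Möbius coordinate sending it to `∞`. For a loop `c` through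
`q`, the function `(z - x) / (z - y)` of this coordinate has the value `1` at `q`. Its logarithm
therefore has a well-defined variation along `c` whenever `x` and `y` lie off `c`: this is `relVar q
c x y`, which is `2πi` times a difference of winding numbers. Since `H` fixes `q` at all times, this
number is a homotopy invariant: for `H₁ ∘ γ` relative to `H₁(x)`, `H₁(y)` it equals the number for
`γ` relative to `x`, `y` (`relVar_endMap`).

Fix a base point `y`. The function `k₀ = relVar q γ · y` is `0` on one side of `C` and a constant `e
≠ 0` on the other. By invariance and surjectivity of `H₁`, the function `k = relVar q (H₁ ∘ γ) ·
H₁(y)` also takes only the values `0` and `e` off `f⁻¹(C)`, although `H₁ ∘ γ` need not be simple.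
Compare `k` with `k₀ ∘ f`. Both are locally constant off `f⁻¹(C)`. An interior point of a `1`-edge
is passed only once by `H₁ ∘ γ`, and `f` is locally biholomorphic there because the image is not
postcritical. Hence the jumps of `k` and `k₀ ∘ f` across the edge agree up to a sign, which is `+`
when `f ∘ H₁` runs along the edge in the direction of `γ` (`eventually_relVar_eq`).

With only two values available, a jump determines the values: near the point either `k = k₀ ∘ f` or
`k = e - k₀ ∘ f`. These conditions are open, exclude each other, and cover the complement of the
finite set of `1`-vertices, which is connected; so one of them holds everywhere (`dichotomy`). Thus
all edges have the same sign, and `f ∘ H₁` preserves or exchanges the sides of `C` accordingly. All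
three claims follow.

The facts needed about Jordan curves come from the same logarithms. Their main source is
`eq_zero_of_ratio_zpow_mul_eq_exp`: a function with a zero in one complementary component of `K` and
a pole in another has no logarithm on `K`. That a Jordan curve separates at all is
`exists_loopVar_ne_zero`. A count of zeros of a Wronskian gives two postcritical points
(`nontrivial_postcriticalSet`), so the arcs between consecutive marked points are proper. -/

/-! ### Variation of the logarithm along a path -/

/-- A lift through the covering `exp` of the punctured plane. It is used on the line, for logarithms
along paths, and on the plane, for the sphere minus one point. -/
theorem exists_continuous_log {X : Type*} [TopologicalSpace X] [SimplyConnectedSpace X]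
    [LocallyPathConnectedSpace X] {F : X → ℂ} (hF : Continuous F) (h0 : ∀ x, F x ≠ 0) :
    ∃ G : X → ℂ, Continuous G ∧ ∀ x, Complex.exp (G x) = F x := by
  obtain ⟨x₀⟩ : Nonempty X := inferInstance
  obtain ⟨G, ⟨-, hG⟩, -⟩ := Complex.isCoveringMapOn_exp.existsUnique_continuousMap_lifts
    (⟨F, hF⟩ : C(X, ℂ)) (a₀ := x₀) (e₀ := Complex.log (F x₀))
    (by simp [Complex.exp_log (h0 x₀)]) (by simpa using h0)
  exact ⟨G, G.continuous, fun x => congrFun hG x⟩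

/-- `L` is the total variation of a continuous logarithm of `φ` from `a` to `b`. -/
def IsLogVar (φ : ℝ → ℂ) (a b : ℝ) (L : ℂ) : Prop :=
  ∃ g : ℝ → ℂ, ContinuousOn g (uIcc a b) ∧ (∀ t ∈ uIcc a b, Complex.exp (g t) = φ t) ∧
    g b - g a = L

theorem exists_global_isLogVar {φ : ℝ → ℂ} (hφ : Continuous φ) (h0 : ∀ t, φ t ≠ 0) :
    ∃ g : ℝ → ℂ, Continuous g ∧ (∀ t, Complex.exp (g t) = φ t) ∧
      ∀ a b, IsLogVar φ a b (g b - g a) := by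
  obtain ⟨g, hg, he⟩ := exists_continuous_log hφ h0
  exact ⟨g, hg, he, fun a b => ⟨g, hg.continuousOn, fun t _ => he t, rfl⟩⟩

theorem IsLogVar.congr {φ ψ : ℝ → ℂ} {a b : ℝ} {L : ℂ} (h : IsLogVar φ a b L)
    (he : ∀ t ∈ uIcc a b, φ t = ψ t) : IsLogVar ψ a b L := by
  obtain ⟨g, hg, hx, hL⟩ := h
  exact ⟨g, hg, fun t ht => (hx t ht).trans (he t ht), hL⟩

theorem exists_isLogVar {φ : ℝ → ℂ} {a b : ℝ} (hφ : ContinuousOn φ (uIcc a b))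
    (h0 : ∀ t ∈ uIcc a b, φ t ≠ 0) : ∃ L, IsLogVar φ a b L := by
  have hab : min a b ≤ max a b := min_le_max
  -- The path is extended by constants beyond its endpoints, so that the result for paths on the
  -- whole line applies.
  let pr : ℝ → Icc (min a b) (max a b) := projIcc _ _ hab
  obtain ⟨g, hg, he, hv⟩ := exists_global_isLogVar (φ := fun t => φ (pr t))
    (hφ.comp_continuous (continuous_subtype_val.comp continuous_projIcc) fun t => (pr t).2)
    (fun t => h0 _ (pr t).2)
  exact ⟨_, (hv a b).congr fun t ht => by simp only [pr]; rw [projIcc_of_mem hab ht]⟩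

theorem IsLogVar.mul {φ ψ : ℝ → ℂ} {a b : ℝ} {L M : ℂ} (h : IsLogVar φ a b L)
    (h' : IsLogVar ψ a b M) : IsLogVar (fun t => φ t * ψ t) a b (L + M) := by
  obtain ⟨g, hg, hx, rfl⟩ := h
  obtain ⟨g', hg', hx', rfl⟩ := h'
  refine ⟨fun t => g t + g' t, hg.add hg', fun t ht => ?_, by ring⟩
  rw [Complex.exp_add, hx t ht, hx' t ht]

theorem IsLogVar.inv {φ : ℝ → ℂ} {a b : ℝ} {L : ℂ} (h : IsLogVar φ a b L) :
    IsLogVar (fun t => (φ t)⁻¹) a b (-L) := by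
  obtain ⟨g, hg, hx, rfl⟩ := h
  refine ⟨fun t => - g t, hg.neg, fun t ht => ?_, by ring⟩
  rw [Complex.exp_neg, hx t ht]

theorem IsLogVar.zpow {φ : ℝ → ℂ} {a b : ℝ} {L : ℂ} (h : IsLogVar φ a b L) (n : ℤ) :
    IsLogVar (fun t => (φ t) ^ n) a b (n * L) := by
  obtain ⟨g, hg, hx, rfl⟩ := h
  refine ⟨fun t => n * g t, continuousOn_const.mul hg, fun t ht => ?_, by ring⟩
  rw [Complex.exp_int_mul, hx t ht]

theorem IsLogVar.const {c : ℂ} (hc : c ≠ 0) (a b : ℝ) : IsLogVar (fun _ => c) a b 0 :=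
  ⟨fun _ => Complex.log c, continuousOn_const, fun _ _ => Complex.exp_log hc, by simp⟩

theorem IsLogVar.comp {φ : ℝ → ℂ} {θ : ℝ → ℝ} {a b : ℝ} {L : ℂ} (h : IsLogVar φ (θ a) (θ b) L)
    (hθ : ContinuousOn θ (uIcc a b)) (hm : MapsTo θ (uIcc a b) (uIcc (θ a) (θ b))) :
    IsLogVar (fun t => φ (θ t)) a b L := by
  obtain ⟨g, hg, hx, rfl⟩ := h
  exact ⟨fun t => g (θ t), hg.comp hθ hm, fun t ht => hx _ (hm ht), rfl⟩

theorem IsLogVar.exp_mul {φ : ℝ → ℂ} {a b : ℝ} {L : ℂ} (h : IsLogVar φ a b L) :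
    Complex.exp L * φ a = φ b := by
  obtain ⟨g, hg, hx, rfl⟩ := h
  rw [← hx a left_mem_uIcc, ← hx b right_mem_uIcc, ← Complex.exp_add]
  congr 1
  ring

theorem IsLogVar.ne_zero {φ : ℝ → ℂ} {a b : ℝ} {L : ℂ} (h : IsLogVar φ a b L) {t : ℝ}
    (ht : t ∈ uIcc a b) : φ t ≠ 0 := by
  obtain ⟨g, hg, hx, rfl⟩ := h
  rw [← hx t ht]
  exact Complex.exp_ne_zero _

/-- The periods of `exp` are spaced by `2π`. This gap turns rough estimates of variations along
loops into exact equalities. -/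
theorem eq_zero_of_exp_eq_one {L : ℂ} (h : Complex.exp L = 1) (hL : ‖L‖ < 2 * Real.pi) :
    L = 0 := by
  obtain ⟨n, rfl⟩ := Complex.exp_eq_one_iff.1 h
  rcases eq_or_ne n 0 with rfl | hn
  · simp
  · exfalso
    have h1 : (1 : ℝ) ≤ |(n : ℝ)| := by exact_mod_cast Int.one_le_abs hn
    have : ‖(n : ℂ) * (2 * Real.pi * Complex.I)‖ = |(n : ℝ)| * (2 * Real.pi) := by
      simp [abs_of_pos Real.pi_pos]
    rw [this] at hL
    nlinarith [Real.pi_pos]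

/-- Locally constant functions on preconnected sets are constant. -/
theorem IsPreconnected.eq_of_eventually_eq {Z α : Type*} [TopologicalSpace Z] {s : Set Z}
    (hs : IsPreconnected s) {h : Z → α} (hloc : ∀ z ∈ s, ∀ᶠ w in 𝓝[s] z, h w = h z) {x y : Z}
    (hx : x ∈ s) (hy : y ∈ s) : h x = h y := by
  have : PreconnectedSpace s := isPreconnected_iff_preconnectedSpace.1 hs
  have hl : IsLocallyConstant (fun z : s => h z) := by
    rw [IsLocallyConstant.iff_eventually_eq]
    rintro ⟨z, hz⟩
    have := hloc z hz
    rw [nhdsWithin_eq_map_subtype_coe hz] at this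
    exact this
  exact hl.apply_eq_of_preconnectedSpace ⟨x, hx⟩ ⟨y, hy⟩

/-- Logarithms of one number form a discrete set. Uniqueness of variations, independence of the
starting point and homotopy invariance all come from this. -/
theorem eq_of_continuousOn_of_exp_eq {Z : Type*} [TopologicalSpace Z] {s : Set Z}
    (hs : IsPreconnected s) {L : Z → ℂ} (hL : ContinuousOn L s) {c : ℂ}
    (he : ∀ z ∈ s, Complex.exp (L z) = c) {x y : Z} (hx : x ∈ s) (hy : y ∈ s) : L x = L y := by
  refine hs.eq_of_eventually_eq (fun z hz => ?_) hx hy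
  have h1 := (hL z hz)
  have h2 := Metric.tendsto_nhds.1 h1 (2 * Real.pi) (by positivity)
  filter_upwards [h2, self_mem_nhdsWithin] with w hw hws
  rw [dist_eq_norm] at hw
  refine sub_eq_zero.1 (eq_zero_of_exp_eq_one ?_ hw)
  rw [Complex.exp_sub, he w hws, he z hz, div_self]
  rw [← he z hz]
  exact Complex.exp_ne_zero _

theorem IsLogVar.unique {φ : ℝ → ℂ} {a b : ℝ} {L M : ℂ} (h : IsLogVar φ a b L)
    (h' : IsLogVar φ a b M) : L = M := by
  obtain ⟨g, hg, hx, rfl⟩ := h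
  obtain ⟨g', hg', hx', rfl⟩ := h'
  have := eq_of_continuousOn_of_exp_eq (s := uIcc a b) isPreconnected_uIcc (hg.sub hg') (c := 1)
    (fun t ht => by
      rw [Pi.sub_apply, Complex.exp_sub, hx t ht, hx' t ht, div_self]
      rw [← hx t ht]
      exact Complex.exp_ne_zero _) right_mem_uIcc left_mem_uIcc
  simp only [Pi.sub_apply] at this
  linear_combination this

theorem IsLogVar.trans {φ : ℝ → ℂ} (hφ : Continuous φ) (h0 : ∀ t, φ t ≠ 0) {a b c : ℝ} {L M : ℂ}
    (h : IsLogVar φ a b L) (h' : IsLogVar φ b c M) : IsLogVar φ a c (L + M) := by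
  obtain ⟨g, -, -, hv⟩ := exists_global_isLogVar hφ h0
  rw [h.unique (hv a b), h'.unique (hv b c)]
  convert! hv a c using 1
  ring

/-- Near `1` the principal branch is a continuous logarithm of size at most `3 / 2 * ε`; by
uniqueness `L` is the difference of its values at the two ends. -/
theorem IsLogVar.norm_le {φ : ℝ → ℂ} {a b : ℝ} {L : ℂ} (h : IsLogVar φ a b L) {ε : ℝ}
    (hε : ε ≤ 1 / 2) (hs : ∀ t ∈ uIcc a b, ‖φ t - 1‖ ≤ ε) : ‖L‖ ≤ 3 * ε := by
  obtain ⟨g, hg, hx, rfl⟩ := h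
  have hslit : ∀ t ∈ uIcc a b, φ t ∈ Complex.slitPlane := fun t ht => by
    have : ‖φ t - 1‖ < 1 := by linarith [hs t ht]
    simpa using Complex.mem_slitPlane_of_norm_lt_one this
  have hc : ContinuousOn (fun t => Complex.log (φ t)) (uIcc a b) :=
    ContinuousOn.clog ((Complex.continuous_exp.comp_continuousOn hg).congr
      fun t ht => (hx t ht).symm) hslit
  have hl : IsLogVar φ a b (Complex.log (φ b) - Complex.log (φ a)) :=
    ⟨_, hc, fun t ht => Complex.exp_log (Complex.slitPlane_ne_zero (hslit t ht)), rfl⟩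
  have hb : ∀ t ∈ uIcc a b, ‖Complex.log (φ t)‖ ≤ 3 / 2 * ε := fun t ht => by
    have := Complex.norm_log_one_add_half_le_self ((hs t ht).trans hε)
    rw [add_sub_cancel] at this
    linarith [hs t ht]
  rw [IsLogVar.unique ⟨g, hg, hx, rfl⟩ hl]
  calc _ ≤ _ := norm_sub_le _ _
    _ ≤ 3 / 2 * ε + 3 / 2 * ε := add_le_add (hb b right_mem_uIcc) (hb a left_mem_uIcc)
    _ = 3 * ε := by ring

/-- By compactness of the interval, `Φ z / Φ z₀` is uniformly close to `1` for `z` near `z₀`, and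
its variation is `L z - L z₀`. -/
theorem continuousAt_of_isLogVar {Z : Type*} [TopologicalSpace Z] {Φ : Z → ℝ → ℂ} {a b : ℝ}
    {L : Z → ℂ} {z₀ : Z} (hc : ∀ s ∈ uIcc a b, ContinuousAt (fun p : Z × ℝ => Φ p.1 p.2) (z₀, s))
    (hL : ∀ᶠ z in 𝓝 z₀, IsLogVar (Φ z) a b (L z)) : ContinuousAt L z₀ := by
  have hL0 := hL.self_of_nhds
  rw [ContinuousAt, Metric.tendsto_nhds]
  intro ε hε
  obtain ⟨δ, hδ, hδ1, hδ2⟩ : ∃ δ : ℝ, 0 < δ ∧ δ ≤ 1 / 2 ∧ 3 * δ < ε :=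
    ⟨min (1 / 2) (ε / 6), by positivity, min_le_left _ _, by
      have := min_le_right (1 / 2 : ℝ) (ε / 6); linarith⟩
  have key : ∀ᶠ z in 𝓝 z₀, ∀ s ∈ uIcc a b, ‖Φ z s * (Φ z₀ s)⁻¹ - 1‖ < δ := by
    refine isCompact_uIcc.eventually_forall_of_forall_eventually fun s hs => ?_
    have h0 : Φ z₀ s ≠ 0 := hL0.ne_zero hs
    have h1 : ContinuousAt (fun p : Z × ℝ => Φ z₀ p.2) (z₀, s) :=
      ContinuousAt.comp (f := fun p : Z × ℝ => (z₀, p.2)) (g := fun p : Z × ℝ => Φ p.1 p.2)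
        (hc s hs) (by fun_prop)
    have h2 : ContinuousAt (fun p : Z × ℝ => ‖Φ p.1 p.2 * (Φ z₀ p.2)⁻¹ - 1‖) (z₀, s) :=
      (((hc s hs).mul (h1.inv₀ h0)).sub continuousAt_const).norm
    exact h2.eventually_lt_const (by simpa [h0] using hδ)
  filter_upwards [key, hL] with z hz hLz
  have := (hLz.mul hL0.inv).norm_le hδ1 fun t ht => (hz t ht).le
  rw [dist_eq_norm, sub_eq_add_neg]
  exact this.trans_lt hδ2

/-! ### Coordinates on the Riemann sphere -/

/-- The finite part of a point of the sphere (`0` at `∞`). -/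
noncomputable def finitePart (z : RSphere) : ℂ := OnePoint.elim z 0 id

@[simp] theorem finitePart_coe (z : ℂ) : finitePart (z : RSphere) = z := rfl

theorem coe_finitePart {z : RSphere} (hz : z ≠ OnePoint.infty) : (finitePart z : RSphere) = z := by
  induction z using OnePoint.rec with
  | infty => exact absurd rfl hz
  | coe z => rfl

theorem continuousAt_finitePart {z : RSphere} (hz : z ≠ OnePoint.infty) :
    ContinuousAt finitePart z := by
  induction z using OnePoint.rec with
  | infty => exact absurd rfl hz
  | coe z =>
    rw [OnePoint.continuousAt_coe]
    exact continuousAt_id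

/-- The inversion `z ↦ 1 / z` of the sphere. -/
noncomputable def sphereInvFun (z : RSphere) : RSphere :=
  OnePoint.elim z ((0 : ℂ) : RSphere)
    (fun w : ℂ => if w = 0 then OnePoint.infty else ((w⁻¹ : ℂ) : RSphere))

@[simp] theorem sphereInvFun_infty : sphereInvFun OnePoint.infty = ((0 : ℂ) : RSphere) := rfl

@[simp] theorem sphereInvFun_zero : sphereInvFun ((0 : ℂ) : RSphere) = OnePoint.infty := by
  simp [sphereInvFun]

theorem sphereInvFun_coe {z : ℂ} (hz : z ≠ 0) :
    sphereInvFun (z : RSphere) = ((z⁻¹ : ℂ) : RSphere) := by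
  simp [sphereInvFun, hz]

theorem sphereInvFun_involutive : Function.Involutive sphereInvFun := by
  intro z
  induction z using OnePoint.rec with
  | infty => simp
  | coe z =>
    rcases eq_or_ne z 0 with rfl | hz
    · simp
    · rw [sphereInvFun_coe hz, sphereInvFun_coe (inv_ne_zero hz), inv_inv]

theorem tendsto_coe_cobounded :
    Filter.Tendsto ((↑) : ℂ → RSphere) (Bornology.cobounded ℂ) (𝓝 OnePoint.infty) := by
  have := OnePoint.tendsto_coe_infty (X := ℂ)
  rwa [Filter.coclosedCompact_eq_cocompact, ← Metric.cobounded_eq_cocompact] at this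

theorem continuousAt_infty_of_cobounded {Y : Type*} [TopologicalSpace Y] {h : RSphere → Y}
    (hh : Filter.Tendsto (fun z : ℂ => h z) (Bornology.cobounded ℂ) (𝓝 (h OnePoint.infty))) :
    ContinuousAt h OnePoint.infty := by
  rw [OnePoint.continuousAt_infty', Filter.coclosedCompact_eq_cocompact,
    ← Metric.cobounded_eq_cocompact]
  exact hh

theorem continuous_sphereInvFun : Continuous sphereInvFun := by
  rw [continuous_iff_continuousAt]
  intro z
  induction z using OnePoint.rec with
  | infty =>
    apply continuousAt_infty_of_cobounded
    have h1 : Filter.Tendsto (fun z : ℂ => ((z⁻¹ : ℂ) : RSphere)) (Bornology.cobounded ℂ)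
        (𝓝 ((0 : ℂ) : RSphere)) :=
      (OnePoint.continuous_coe.tendsto _).comp Filter.tendsto_inv₀_cobounded
    refine h1.congr' ?_
    filter_upwards [Bornology.eventually_ne_cobounded (0 : ℂ)] with z hz
    rw [sphereInvFun_coe hz]
  | coe z =>
    rw [OnePoint.continuousAt_coe]
    rcases eq_or_ne z 0 with rfl | hz
    · rw [continuousAt_iff_punctured_nhds]
      simp only [Function.comp_apply, sphereInvFun_zero]
      refine (tendsto_coe_cobounded.comp Filter.tendsto_inv₀_nhdsNE_zero).congr' ?_
      filter_upwards [self_mem_nhdsWithin] with z hz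
      exact (sphereInvFun_coe hz).symm
    · have h1 : ContinuousAt (fun z : ℂ => ((z⁻¹ : ℂ) : RSphere)) z :=
        OnePoint.continuous_coe.continuousAt.comp (continuousAt_inv₀ hz)
      refine h1.congr ?_
      filter_upwards [isOpen_ne.mem_nhds hz] with w hw
      exact (sphereInvFun_coe hw).symm

/-- The inversion `z ↦ 1 / z` as a homeomorphism of the sphere. -/
noncomputable def sphereInv : RSphere ≃ₜ RSphere where
  toEquiv := sphereInvFun_involutive.toPerm
  continuous_toFun := continuous_sphereInvFun
  continuous_invFun := continuous_sphereInvFun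

@[simp] theorem sphereInv_symm : sphereInv.symm = sphereInv := by
  ext z; rfl

@[simp] theorem sphereInv_infty : sphereInv OnePoint.infty = ((0 : ℂ) : RSphere) := rfl

@[simp] theorem sphereInv_zero : sphereInv ((0 : ℂ) : RSphere) = OnePoint.infty :=
  sphereInvFun_zero

theorem sphereInv_coe {z : ℂ} (hz : z ≠ 0) : sphereInv (z : RSphere) = ((z⁻¹ : ℂ) : RSphere) :=
  sphereInvFun_coe hz

@[simp] theorem sphereInv_sphereInv (z : RSphere) : sphereInv (sphereInv z) = z :=
  sphereInvFun_involutive z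

/-- The translation `z ↦ z + a` of the sphere. -/
noncomputable def sphereTranslate (a : ℂ) : RSphere ≃ₜ RSphere :=
  (Homeomorph.addRight a).onePointCongr

@[simp] theorem sphereTranslate_infty (a : ℂ) :
    sphereTranslate a OnePoint.infty = OnePoint.infty := rfl

@[simp] theorem sphereTranslate_coe (a z : ℂ) :
    sphereTranslate a (z : RSphere) = ((z + a : ℂ) : RSphere) := rfl

theorem sphereTranslate_symm (a : ℂ) : (sphereTranslate a).symm = sphereTranslate (-a) := by
  ext z
  rw [Homeomorph.symm_apply_eq]
  induction z using OnePoint.rec with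
  | infty => simp
  | coe z => simp

open Classical in
/-- A Möbius transformation that maps `q` to `∞`. -/
noncomputable def coordAt (q : RSphere) : RSphere ≃ₜ RSphere :=
  if q = OnePoint.infty then Homeomorph.refl _
  else (sphereTranslate (-finitePart q)).trans sphereInv

@[simp] theorem coordAt_self (q : RSphere) : coordAt q q = OnePoint.infty := by
  by_cases hq : q = OnePoint.infty
  · simp [coordAt, hq]
  · obtain ⟨z, rfl⟩ : ∃ z : ℂ, (z : RSphere) = q := ⟨_, coe_finitePart hq⟩
    simp [coordAt]

theorem coordAt_ne_infty {q z : RSphere} (h : z ≠ q) : coordAt q z ≠ OnePoint.infty := by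
  rw [← coordAt_self q]
  exact (coordAt q).injective.ne h

theorem coordAt_coe_symm_coe (y : ℂ) {ζ : ℂ} (hζ : ζ ≠ 0) :
    (coordAt (y : RSphere)).symm (ζ : RSphere) = ((ζ⁻¹ + y : ℂ) : RSphere) := by
  simp [coordAt, Homeomorph.symm_apply_eq, hζ, sphereInv_coe]

instance : LocallyConnectedSpace RSphere := by
  rw [locallyConnectedSpace_iff_connected_subsets]
  have hfin : ∀ (z : ℂ), ∀ U ∈ 𝓝 (z : RSphere), ∃ V ∈ 𝓝 (z : RSphere), IsPreconnected V ∧ V ⊆ U := by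
    intro z U hU
    rw [OnePoint.nhds_coe_eq, Filter.mem_map] at hU
    obtain ⟨V, hV, hc, hVU⟩ := locallyConnectedSpace_iff_connected_subsets.1
      (inferInstance : LocallyConnectedSpace ℂ) z _ hU
    refine ⟨(↑) '' V, ?_, hc.image _ OnePoint.continuous_coe.continuousOn, image_subset_iff.2 hVU⟩
    rw [OnePoint.nhds_coe_eq]
    exact Filter.image_mem_map hV
  intro z
  induction z using OnePoint.rec with
  | coe z => exact hfin z
  | infty =>
    intro U hU
    have : sphereInv ⁻¹' U ∈ 𝓝 ((0 : ℂ) : RSphere) :=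
      sphereInv.continuous.continuousAt.preimage_mem_nhds (by simpa using hU)
    obtain ⟨V, hV, hc, hVU⟩ := hfin 0 _ this
    refine ⟨sphereInv '' V, ?_, hc.image _ sphereInv.continuous.continuousOn,
      image_subset_iff.2 hVU⟩
    have := sphereInv.isOpenMap.image_mem_nhds hV
    simpa using this

/-! ### The function with zero `x` and pole `y` -/

/-- The function `z ↦ (z - x) / (z - y)` on the sphere, with value `1` at `∞`. -/
noncomputable def ratio (z : RSphere) (x y : ℂ) : ℂ :=
  OnePoint.elim z 1 (fun w : ℂ => (w - x) / (w - y))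

@[simp] theorem ratio_infty (x y : ℂ) : ratio OnePoint.infty x y = 1 := rfl

@[simp] theorem ratio_coe (z x y : ℂ) : ratio (z : RSphere) x y = (z - x) / (z - y) := rfl

theorem ratio_ne_zero {z : RSphere} {x y : ℂ} (hx : z ≠ x) (hy : z ≠ y) : ratio z x y ≠ 0 := by
  induction z using OnePoint.rec with
  | infty => simp
  | coe z =>
    exact div_ne_zero (sub_ne_zero.2 fun h => hx (h ▸ rfl)) (sub_ne_zero.2 fun h => hy (h ▸ rfl))

theorem ratio_mul_ratio {z : RSphere} {x y v : ℂ} (hy : z ≠ y) :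
    ratio z x y * ratio z y v = ratio z x v := by
  induction z using OnePoint.rec with
  | infty => simp
  | coe z =>
    have : z - y ≠ 0 := sub_ne_zero.2 fun h => hy (h ▸ rfl)
    simp only [ratio_coe]
    field_simp

/-- The expression in the coordinate `1 / z`, which is regular at `∞` and gives the joint continuity
there. -/
theorem ratio_eq_of_ne_zero {z : RSphere} (hz : z ≠ (0 : ℂ)) (x y : ℂ) :
    ratio z x y = (1 - x * finitePart (sphereInv z)) / (1 - y * finitePart (sphereInv z)) := by
  induction z using OnePoint.rec with
  | infty => simp
  | coe z =>
    have hz' : z ≠ 0 := fun h => hz (h ▸ rfl)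
    rw [sphereInv_coe hz', finitePart_coe, ratio_coe, ← mul_div_mul_left _ _ (inv_ne_zero hz')]
    congr 1 <;> field_simp

theorem continuousAt_ratio {z : RSphere} {x y : ℂ} (hy : z ≠ y) :
    ContinuousAt (fun p : RSphere × ℂ × ℂ => ratio p.1 p.2.1 p.2.2) (z, x, y) := by
  induction z using OnePoint.rec with
  | infty =>
    have h0 : (OnePoint.infty : RSphere) ≠ ((0 : ℂ) : RSphere) := OnePoint.infty_ne_coe 0
    have hc : ContinuousAt (fun p : RSphere × ℂ × ℂ => finitePart (sphereInv p.1))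
        ((OnePoint.infty : RSphere), x, y) := by
      refine ContinuousAt.comp (g := finitePart) (continuousAt_finitePart (by simp)) ?_
      exact (sphereInv.continuous.comp continuous_fst).continuousAt
    have h1 : ContinuousAt (fun p : RSphere × ℂ × ℂ => (1 - p.2.1 * finitePart (sphereInv p.1)) /
        (1 - p.2.2 * finitePart (sphereInv p.1))) ((OnePoint.infty : RSphere), x, y) := by
      refine ContinuousAt.div ?_ ?_ (by simp)
      · exact continuousAt_const.sub (ContinuousAt.mul (by fun_prop) hc)
      · exact continuousAt_const.sub (ContinuousAt.mul (by fun_prop) hc)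
    refine h1.congr ?_
    have : ∀ᶠ p : RSphere × ℂ × ℂ in 𝓝 ((OnePoint.infty : RSphere), x, y), p.1 ≠ (0 : ℂ) :=
      continuous_fst.continuousAt.eventually_ne h0
    filter_upwards [this] with p hp
    rw [ratio_eq_of_ne_zero hp]
  | coe z =>
    have hc : ContinuousAt (fun p : RSphere × ℂ × ℂ => finitePart p.1) ((z : RSphere), x, y) :=
      ContinuousAt.comp (g := finitePart) (continuousAt_finitePart (by simp))
        continuous_fst.continuousAt
    have hzy : z - y ≠ 0 := sub_ne_zero.2 fun h => hy (h ▸ rfl)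
    have h1 : ContinuousAt (fun p : RSphere × ℂ × ℂ => (finitePart p.1 - p.2.1) /
        (finitePart p.1 - p.2.2)) ((z : RSphere), x, y) :=
      ContinuousAt.div (hc.sub (by fun_prop)) (hc.sub (by fun_prop)) (by simpa using hzy)
    refine h1.congr ?_
    have : ∀ᶠ p : RSphere × ℂ × ℂ in 𝓝 ((z : RSphere), x, y), p.1 ≠ OnePoint.infty :=
      continuous_fst.continuousAt.eventually_ne (by simp)
    filter_upwards [this] with p hp
    rw [← ratio_coe, coe_finitePart hp]

/-! ### Components of the complement of a closed set -/

/-- Adding limit points keeps a connected set connected. For `F = Kᶜ` with `K` closed this puts the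
frontier of a component into `K`. -/
theorem closure_connectedComponentIn_inter_subset {α : Type*} [TopologicalSpace α] {F : Set α}
    {x : α} (hx : x ∈ F) :
    closure (connectedComponentIn F x) ∩ F ⊆ connectedComponentIn F x := by
  refine IsPreconnected.subset_connectedComponentIn (isPreconnected_connectedComponentIn.subset_closure
    (subset_inter subset_closure (connectedComponentIn_subset F x)) inter_subset_left)
    ⟨subset_closure (mem_connectedComponentIn hx), hx⟩ inter_subset_right

/-! ### Model loops, and the obstruction to logarithms on a closed set. -/

theorem isLogVar_circle {c : ℂ} (hc : c ≠ 0) :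
    IsLogVar (fun t => c * Complex.exp (2 * Real.pi * Complex.I * t)) 0 1
      (2 * Real.pi * Complex.I) := by
  refine ⟨fun t => Complex.log c + 2 * Real.pi * Complex.I * t, by fun_prop, fun t _ => ?_, ?_⟩
  · rw [Complex.exp_add, Complex.exp_log hc]
  · simp

/-- A closed path in the disc of radius `1 / 2` about `1` has variation of size at most `3 / 2 <
2π`, and its exponential is `1`. -/
theorem isLogVar_one_add_of_norm_le {u : ℝ → ℂ} (hu : Continuous u) (h01 : u 0 = u 1)
    (hn : ∀ t, ‖u t‖ ≤ 1 / 2) : IsLogVar (fun t => 1 + u t) 0 1 0 := by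
  have h0 : ∀ t, 1 + u t ≠ 0 := fun t h => by
    have : u t = -1 := by linear_combination h
    have h2 := hn t
    rw [this] at h2
    norm_num at h2
  obtain ⟨L, hL⟩ := exists_isLogVar (φ := fun t => 1 + u t) (a := 0) (b := 1) (by fun_prop)
    fun t _ => h0 t
  have h1 := hL.norm_le (ε := 1 / 2) le_rfl (fun t _ => by simpa using hn t)
  have h2 := hL.exp_mul
  rw [h01] at h2
  have h3 : L = 0 := eq_zero_of_exp_eq_one (mul_right_cancel₀ (h0 1) (h2.trans (one_mul _).symm))
    (by linarith [Real.pi_gt_three])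
  rwa [h3] at hL

theorem norm_exp_two_pi_I_mul (t : ℝ) : ‖Complex.exp (2 * Real.pi * Complex.I * t)‖ = 1 := by
  have : (2 * Real.pi * Complex.I * t : ℂ) = (2 * Real.pi * t : ℝ) * Complex.I := by
    push_cast; ring
  rw [this, Complex.norm_exp_ofReal_mul_I]

/-- The functions with a zero in a component of the complement of `K` and a pole in another one
have no logarithm on `K`; the factor `h` has neither zeros nor poles in the first component. -/
theorem eq_zero_of_ratio_zpow_mul_eq_exp {K : Set RSphere} (hK : IsClosed K) {x y : ℂ}
    (hx : (x : RSphere) ∉ K) (hy : (y : RSphere) ∉ K)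
    (hyU : (y : RSphere) ∉ connectedComponentIn Kᶜ x) {h : RSphere → ℂ}
    (hh : ContinuousOn h (closure (connectedComponentIn Kᶜ (x : RSphere))))
    (h0 : ∀ z ∈ closure (connectedComponentIn Kᶜ (x : RSphere)), h z ≠ 0)
    {g : RSphere → ℂ} (hg : Continuous g) {k : ℤ}
    (he : ∀ z ∈ K, ratio z x y ^ k * h z = Complex.exp (g z)) : k = 0 := by
  classical
  set U := connectedComponentIn Kᶜ (x : RSphere) with hU
  have hxU : (x : RSphere) ∈ U := mem_connectedComponentIn hx
  have hUo : IsOpen U := hK.isOpen_compl.connectedComponentIn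
  have hyU' : (y : RSphere) ∉ closure U := fun hc =>
    hyU (closure_connectedComponentIn_inter_subset hx ⟨hc, hy⟩)
  have hfr : frontier U ⊆ K := fun z hz => by
    by_contra hzK
    rw [hUo.frontier_eq] at hz
    exact hz.2 (closure_connectedComponentIn_inter_subset hx ⟨hz.1, hzK⟩)
  have hxy : y - x ≠ 0 := sub_ne_zero.2 fun e => hyU (e ▸ hxU)
  have hrc : ∀ z : RSphere, z ≠ y → ContinuousAt (fun z => ratio z x y) z := fun z hz =>
    ContinuousAt.comp (f := fun z : RSphere => (z, x, y))
      (g := fun p : RSphere × ℂ × ℂ => ratio p.1 p.2.1 p.2.2) (continuousAt_ratio hz) (by fun_prop)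
  -- The zero at `x` is cut out: inside `U` the power of the ratio is replaced by `exp g / h`, which
  -- agrees with it on the frontier of `U`. The result has neither zeros nor poles off `y`, hence a
  -- logarithm on the sphere minus `y`, while near `y` it is still the original power.
  let F : RSphere → ℂ := U.piecewise (fun z => Complex.exp (g z) / h z) (fun z => ratio z x y ^ k)
  have hFc : ContinuousOn F {(y : RSphere)}ᶜ := by
    refine ContinuousOn.piecewise (fun z hz => ?_) ?_ ?_
    · rw [← he z (hfr hz.2), mul_div_cancel_right₀ _ (h0 z hz.2.1)]
    · exact (Complex.continuous_exp.comp hg).continuousOn.div (hh.mono inter_subset_right)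
        fun z hz => h0 z hz.2
    · intro z hz
      rw [hUo.isClosed_compl.closure_eq] at hz
      exact ((hrc z hz.1).zpow₀ k (Or.inl (ratio_ne_zero (fun e => hz.2 (e ▸ hxU))
        hz.1))).continuousWithinAt
  have hF0 : ∀ z ≠ (y : RSphere), F z ≠ 0 := fun z hz => by
    by_cases hzU : z ∈ U
    · simp only [F, piecewise_eq_of_mem _ _ _ hzU]
      exact div_ne_zero (Complex.exp_ne_zero _) (h0 z (subset_closure hzU))
    · simp only [F, piecewise_eq_of_notMem _ _ _ hzU]
      exact zpow_ne_zero _ (ratio_ne_zero (fun e => hzU (e ▸ hxU)) hz)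
  let ψ : ℂ → RSphere := fun ζ => (coordAt (y : RSphere)).symm ζ
  have hψc : Continuous ψ := (coordAt (y : RSphere)).symm.continuous.comp OnePoint.continuous_coe
  have hψ : ∀ ζ, ψ ζ ≠ y := fun ζ e => by
    have := (Homeomorph.symm_apply_eq _).1 e
    simp at this
  obtain ⟨G, hGc, hG⟩ := exists_continuous_log (hFc.comp_continuous hψc hψ) fun ζ => hF0 _ (hψ ζ)
  have hψt : Filter.Tendsto ψ (Bornology.cobounded ℂ) (𝓝 (y : RSphere)) := by
    have := ((coordAt (y : RSphere)).symm.continuous.tendsto OnePoint.infty).comp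
      tendsto_coe_cobounded
    rwa [(Homeomorph.symm_apply_eq _).2 (coordAt_self (y : RSphere)).symm] at this
  obtain ⟨R, -, hR⟩ := Filter.hasBasis_cobounded_norm.eventually_iff.1
    (hψt.eventually (isClosed_closure.isOpen_compl.mem_nhds hyU'))
  have hR' : ∀ ζ : ℂ, R ≤ ‖ζ‖ → ζ ≠ 0 → F (ψ ζ) = (1 + (y - x) * ζ) ^ k := fun ζ hζ hζ0 => by
    have : ψ ζ ∉ U := fun hc => hR hζ (subset_closure hc)
    simp only [F, piecewise_eq_of_notMem _ _ _ this]
    simp only [ψ, coordAt_coe_symm_coe y hζ0, ratio_coe]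
    congr 1
    field_simp
    ring
  -- On a large circle in the coordinate `ζ = 1 / (z - y)` the function is `(1 + (y - x) * ζ) ^ k`.
  -- The bound `2` makes the linear term dominate, so the variation is `k` times `2πi`; the global
  -- logarithm forces it to be `0`.
  obtain ⟨r, hr0, hrR, hr2⟩ : ∃ r : ℝ, 0 < r ∧ R ≤ r ∧ 2 ≤ ‖y - x‖ * r := by
    have hn : 0 < ‖y - x‖ := norm_pos_iff.2 hxy
    refine ⟨max 1 (max R (2 / ‖y - x‖)), by positivity, by simp, ?_⟩
    calc (2 : ℝ) = ‖y - x‖ * (2 / ‖y - x‖) := by field_simp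
      _ ≤ _ := by gcongr; simp
  have hc0 : (y - x) * r ≠ 0 := mul_ne_zero hxy (by exact_mod_cast hr0.ne')
  let E : ℝ → ℂ := fun t => Complex.exp (2 * Real.pi * Complex.I * t)
  have hE0 : ∀ t, E t ≠ 0 := fun t => Complex.exp_ne_zero _
  have hE1 : ∀ t, ‖E t‖ = 1 := norm_exp_two_pi_I_mul
  have hEc : Continuous E := by simp only [E]; fun_prop
  have hE01 : E 0 = E 1 := by simp [E, Complex.exp_two_pi_mul_I]
  have h1 : IsLogVar (fun t => F (ψ (r * E t))) 0 1 0 :=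
    ⟨fun t => G (r * E t), by fun_prop, fun t _ => hG _, by simp only [hE01, sub_self]⟩
  have h2 := ((isLogVar_circle hc0).mul (isLogVar_one_add_of_norm_le
    (u := fun t => ((y - x) * r * E t)⁻¹) ((continuous_const.mul hEc).inv₀
      fun t => mul_ne_zero hc0 (hE0 t)) (by simp only [hE01]) (fun t => by
        rw [norm_inv, norm_mul, norm_mul, hE1, mul_one, Complex.norm_real, Real.norm_of_nonneg hr0.le]
        rw [one_div]
        gcongr))).zpow k
  have h3 := h1.unique (h2.congr fun t _ => by
    rw [hR' (r * E t) (by simp [hE1, abs_of_pos hr0, hrR])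
      (mul_ne_zero (by exact_mod_cast hr0.ne') (hE0 t))]
    congr 1
    have := hc0
    have := hE0 t
    change (y - x) * r * E t * (1 + _) = _
    rw [mul_add, mul_inv_cancel₀ (mul_ne_zero hc0 (hE0 t))]
    ring)
  simpa [Real.pi_ne_zero] using h3.symm

/-! ### Winding of a loop relative to two points -/

open Classical in
/-- The variation of the logarithm of `(z - x) / (z - y)` along the loop `c`: this is `2πi` times
the difference of the winding numbers around `x` and `y`. -/
noncomputable def loopVar (c : UnitAddCircle → RSphere) (x y : ℂ) : ℂ :=
  if h : ∃ L, IsLogVar (fun t => ratio (c t) x y) 0 1 L then h.choose else 0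

section LoopVar

variable {c : UnitAddCircle → RSphere} {x y v : ℂ}

theorem continuous_loop_lift (hc : Continuous c) : Continuous fun t : ℝ => c t :=
  hc.comp (AddCircle.continuous_mk' 1)

theorem continuous_ratio_loop (hc : Continuous c) (hy : (y : RSphere) ∉ range c) :
    Continuous fun t : ℝ => ratio (c t) x y := by
  rw [continuous_iff_continuousAt]
  intro t
  exact ContinuousAt.comp (f := fun t : ℝ => (c t, x, y))
      (g := fun p : RSphere × ℂ × ℂ => ratio p.1 p.2.1 p.2.2)
      (continuousAt_ratio fun h => hy ⟨_, h⟩)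
      ((continuous_loop_lift hc).continuousAt.prodMk continuousAt_const)

theorem ratio_loop_ne_zero (hx : (x : RSphere) ∉ range c) (hy : (y : RSphere) ∉ range c) (t : ℝ) :
    ratio (c t) x y ≠ 0 :=
  ratio_ne_zero (fun h => hx ⟨_, h⟩) (fun h => hy ⟨_, h⟩)

theorem isLogVar_loopVar (hc : Continuous c) (hx : (x : RSphere) ∉ range c)
    (hy : (y : RSphere) ∉ range c) :
    IsLogVar (fun t => ratio (c t) x y) 0 1 (loopVar c x y) := by
  have h := exists_isLogVar (a := 0) (b := 1) (continuous_ratio_loop (x := x) hc hy).continuousOn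
    fun t _ => ratio_loop_ne_zero hx hy t
  rw [loopVar, dif_pos h]
  exact h.choose_spec

theorem coe_add_one (t : ℝ) : ((t + 1 : ℝ) : UnitAddCircle) = t := by
  rw [AddCircle.coe_add, AddCircle.coe_period, add_zero]

theorem exp_loopVar (hc : Continuous c) (hx : (x : RSphere) ∉ range c)
    (hy : (y : RSphere) ∉ range c) : Complex.exp (loopVar c x y) = 1 := by
  have h := (isLogVar_loopVar hc hx hy).exp_mul
  have h1 : ((1 : ℝ) : UnitAddCircle) = ((0 : ℝ) : UnitAddCircle) := by
    simp
  rw [h1] at h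
  exact mul_right_cancel₀ (ratio_loop_ne_zero hx hy 0) (h.trans (one_mul _).symm)

/-- For a logarithm `g` along the lifted loop, `g (t + 1) - g t` is a continuous period of `exp`,
hence constant: the starting point is irrelevant. -/
theorem isLogVar_loopVar_period (hc : Continuous c) (hx : (x : RSphere) ∉ range c)
    (hy : (y : RSphere) ∉ range c) (a : ℝ) :
    IsLogVar (fun t => ratio (c t) x y) a (a + 1) (loopVar c x y) := by
  obtain ⟨g, hgc, hg, hv⟩ := exists_global_isLogVar (continuous_ratio_loop (x := x) hc hy)
    (ratio_loop_ne_zero hx hy)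
  have h := eq_of_continuousOn_of_exp_eq (s := univ) isPreconnected_univ
    (L := fun t => g (t + 1) - g t) (by fun_prop) (c := 1) (fun t _ => by
      rw [Complex.exp_sub, hg, hg, coe_add_one, div_self (ratio_loop_ne_zero hx hy t)])
    (mem_univ 0) (mem_univ a)
  rw [(isLogVar_loopVar hc hx hy).unique (hv 0 1)]
  rw [zero_add] at h
  rw [h]
  exact hv a (a + 1)

theorem loopVar_add (hc : Continuous c) (hx : (x : RSphere) ∉ range c)
    (hy : (y : RSphere) ∉ range c) (hv : (v : RSphere) ∉ range c) :
    loopVar c x y + loopVar c y v = loopVar c x v :=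
  (((isLogVar_loopVar hc hx hy).mul (isLogVar_loopVar hc hy hv)).congr fun _ _ =>
    ratio_mul_ratio fun h => hy ⟨_, h⟩).unique (isLogVar_loopVar hc hx hv)

theorem loopVar_self (hc : Continuous c) (hx : (x : RSphere) ∉ range c) : loopVar c x x = 0 := by
  have := loopVar_add hc hx hx hx
  simpa using this

/-- Invariance of the winding under homotopies. -/
theorem loopVar_eq_of_homotopy {c : I → UnitAddCircle → RSphere} {x y : I → ℂ}
    (hc : Continuous fun p : I × UnitAddCircle => c p.1 p.2) (hx : Continuous x) (hy : Continuous y)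
    (hxc : ∀ t, (x t : RSphere) ∉ range (c t)) (hyc : ∀ t, (y t : RSphere) ∉ range (c t)) :
    loopVar (c 0) (x 0) (y 0) = loopVar (c 1) (x 1) (y 1) := by
  have hct : ∀ t, Continuous (c t) := fun t => hc.comp (by fun_prop : Continuous fun s => (t, s))
  refine eq_of_continuousOn_of_exp_eq (s := univ) isPreconnected_univ
    (L := fun t => loopVar (c t) (x t) (y t)) ?_ (c := 1)
    (fun t _ => exp_loopVar (hct t) (hxc t) (hyc t)) (mem_univ 0) (mem_univ 1)
  rw [continuousOn_univ, continuous_iff_continuousAt]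
  intro t
  refine continuousAt_of_isLogVar (Φ := fun t s => ratio (c t s) (x t) (y t)) (a := 0) (b := 1)
    (fun s _ => ?_) (Filter.Eventually.of_forall fun t => isLogVar_loopVar (hct t) (hxc t) (hyc t))
  refine ContinuousAt.comp (f := fun p : I × ℝ => (c p.1 p.2, x p.1, y p.1))
    (g := fun p : RSphere × ℂ × ℂ => ratio p.1 p.2.1 p.2.2)
    (continuousAt_ratio fun h => hyc t ⟨_, h⟩) ?_
  refine ContinuousAt.prodMk ?_ (by fun_prop)
  exact (hc.comp (continuous_fst.prodMk ((AddCircle.continuous_mk' 1).comp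
    continuous_snd))).continuousAt

/-- The winding is locally constant in the complement of the loop. -/
theorem loopVar_eq_of_isPreconnected (hc : Continuous c) (hy : (y : RSphere) ∉ range c)
    {s : Set RSphere} (hs : IsPreconnected s) (hsc : ∀ z ∈ s, z ∉ range c)
    (hsi : OnePoint.infty ∉ s) {z w : RSphere} (hz : z ∈ s) (hw : w ∈ s) :
    loopVar c (finitePart z) y = loopVar c (finitePart w) y := by
  have hfin : ∀ z ∈ s, z ≠ OnePoint.infty := fun z hz h => hsi (h ▸ hz)
  refine eq_of_continuousOn_of_exp_eq hs (L := fun z => loopVar c (finitePart z) y) ?_ (c := 1)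
    (fun z hz => exp_loopVar hc (by rw [coe_finitePart (hfin z hz)]; exact hsc z hz) hy) hz hw
  intro z hz
  apply ContinuousAt.continuousWithinAt
  refine continuousAt_of_isLogVar (Φ := fun z s => ratio (c s) (finitePart z) y) (a := 0) (b := 1)
    (fun s _ => ?_) ?_
  · refine ContinuousAt.comp (f := fun p : RSphere × ℝ => (c p.2, finitePart p.1, y))
      (g := fun p : RSphere × ℂ × ℂ => ratio p.1 p.2.1 p.2.2)
      (continuousAt_ratio fun h => hy ⟨_, h⟩) ?_
    refine ((continuous_loop_lift hc).comp continuous_snd).continuousAt.prodMk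
      (ContinuousAt.prodMk ?_ continuousAt_const)
    exact ContinuousAt.comp (g := finitePart) (continuousAt_finitePart (hfin z hz))
      continuous_fst.continuousAt
  · have h1 : ∀ᶠ w in 𝓝 z, w ∉ range c :=
      (isCompact_range hc).isClosed.isOpen_compl.mem_nhds (hsc z hz)
    filter_upwards [h1, isOpen_ne.mem_nhds (hfin z hz)] with w hw hwi
    exact isLogVar_loopVar hc (by rwa [coe_finitePart hwi]) hy

end LoopVar

/-! ### Jordan curves through `∞` -/

theorem unitAddCircle_coe_eq_iff {s t : ℝ} :
    (s : UnitAddCircle) = t ↔ ∃ n : ℤ, s = t + n := by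
  rw [← sub_eq_zero, ← AddCircle.coe_sub, AddCircle.coe_eq_zero_iff]
  constructor
  · rintro ⟨n, hn⟩
    exact ⟨n, by simp only [zsmul_eq_mul, mul_one] at hn; linarith⟩
  · rintro ⟨n, hn⟩
    exact ⟨n, by simp only [zsmul_eq_mul, mul_one]; linarith⟩

theorem unitAddCircle_exists_coe_eq (a : ℝ) (s : UnitAddCircle) :
    ∃ t ∈ Ico a (a + 1), (t : UnitAddCircle) = s := by
  have : Fact ((0 : ℝ) < 1) := ⟨one_pos⟩
  exact ⟨_, (AddCircle.equivIco 1 a s).2, AddCircle.coe_equivIco⟩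

theorem int_eq_zero_of_abs_lt_one {n : ℤ} (h1 : (-1 : ℝ) < n) (h2 : (n : ℝ) < 1) : n = 0 := by
  have h1' : -1 < n := by exact_mod_cast h1
  have h2' : n < 1 := by exact_mod_cast h2
  omega

namespace IsOrientedJordanCurve

variable {C : Set RSphere} {γ : UnitAddCircle → RSphere}

theorem eq_iff (h : IsOrientedJordanCurve C γ) {s t : ℝ} :
    γ (s : UnitAddCircle) = γ (t : UnitAddCircle) ↔ ∃ n : ℤ, s = t + n := by
  rw [h.injective.eq_iff, unitAddCircle_coe_eq_iff]

theorem exists_eq (h : IsOrientedJordanCurve C γ) (a : ℝ) {z : RSphere} (hz : z ∈ C) :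
    ∃ t ∈ Ico a (a + 1), γ (t : UnitAddCircle) = z := by
  rw [← h.range_eq] at hz
  obtain ⟨s, rfl⟩ := hz
  obtain ⟨t, ht, rfl⟩ := unitAddCircle_exists_coe_eq a s
  exact ⟨t, ht, rfl⟩

theorem mem (h : IsOrientedJordanCurve C γ) (t : UnitAddCircle) : γ t ∈ C :=
  h.range_eq ▸ mem_range_self t

theorem isClosed (h : IsOrientedJordanCurve C γ) : IsClosed C :=
  h.range_eq ▸ (isCompact_range h.continuous).isClosed

theorem isClosedEmbedding (h : IsOrientedJordanCurve C γ) : IsClosedEmbedding γ :=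
  h.continuous.isClosedEmbedding h.injective

theorem continuous_lift (h : IsOrientedJordanCurve C γ) : Continuous fun t : ℝ => γ t :=
  continuous_loop_lift h.continuous

theorem injOn_lift (h : IsOrientedJordanCurve C γ) {a b : ℝ} (hab : b - a < 1) :
    InjOn (fun t : ℝ => γ t) (Icc a b) := by
  intro s hs t ht hst
  obtain ⟨n, hn⟩ := h.eq_iff.1 hst
  have : n = 0 := int_eq_zero_of_abs_lt_one (by linarith [hs.1, hs.2, ht.1, ht.2])
    (by linarith [hs.1, hs.2, ht.1, ht.2])
  simpa [this] using hn

theorem comp_homeomorph (h : IsOrientedJordanCurve C γ) (κ : RSphere ≃ₜ RSphere) :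
    IsOrientedJordanCurve (κ '' C) (κ ∘ γ) :=
  ⟨κ.continuous.comp h.continuous, κ.injective.comp h.injective, by rw [range_comp, h.range_eq]⟩

/-- A nonvanishing function without winding along the curve has a logarithm on it. -/
theorem exists_log (h : IsOrientedJordanCurve C γ) {φ : RSphere → ℂ}
    (hφ : Continuous fun t : ℝ => φ (γ t)) (h0 : ∀ t : ℝ, φ (γ t) ≠ 0)
    (hv : IsLogVar (fun t => φ (γ t)) 0 1 0) :
    ∃ g : RSphere → ℂ, Continuous g ∧ ∀ z ∈ C, Complex.exp (g z) = φ z := by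
  obtain ⟨g, hgc, hg, hgv⟩ := exists_global_isLogVar hφ h0
  have hper : Function.Periodic g 1 := fun t => by
    have h1 := eq_of_continuousOn_of_exp_eq (s := univ) isPreconnected_univ
      (L := fun t => g (t + 1) - g t) (by fun_prop) (c := 1) (fun t _ => by
        rw [Complex.exp_sub, hg, hg, coe_add_one, div_self (h0 t)])
      (mem_univ 0) (mem_univ t)
    have h2 := (hgv 0 1).unique hv
    rw [zero_add, h2] at h1
    linear_combination -h1
  -- Vanishing variation makes `g` periodic, so it descends to the circle. The Tietze extension
  -- theorem then carries it from the curve to the whole sphere.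
  have hlc : Continuous (hper.lift : UnitAddCircle → ℂ) := continuous_quot_lift _ hgc
  obtain ⟨G, hG⟩ := ContinuousMap.exists_extension' h.isClosedEmbedding
    (⟨hper.lift, hlc⟩ : C(UnitAddCircle, ℂ))
  refine ⟨G, G.continuous, fun z hz => ?_⟩
  obtain ⟨t, -, rfl⟩ := h.exists_eq 0 hz
  have := congrFun hG (t : UnitAddCircle)
  simp only [Function.comp_apply, ContinuousMap.coe_mk, Function.Periodic.lift_coe] at this
  rw [this, hg]

theorem mem_connectedComponentIn_of_loopVar_eq_zero (h : IsOrientedJordanCurve C γ) {x y : ℂ}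
    (hx : (x : RSphere) ∉ C) (hy : (y : RSphere) ∉ C) (hv : loopVar γ x y = 0) :
    (y : RSphere) ∈ connectedComponentIn Cᶜ (x : RSphere) := by
  by_contra hyU
  have hxr : (x : RSphere) ∉ range γ := by rwa [h.range_eq]
  have hyr : (y : RSphere) ∉ range γ := by rwa [h.range_eq]
  obtain ⟨g, hgc, hg⟩ := h.exists_log (φ := fun z => ratio z x y)
    (continuous_ratio_loop h.continuous hyr) (ratio_loop_ne_zero hxr hyr)
    (hv ▸ isLogVar_loopVar h.continuous hxr hyr)
  have := eq_zero_of_ratio_zpow_mul_eq_exp h.isClosed hx hy hyU (h := fun _ => 1)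
    continuousOn_const (fun _ _ => one_ne_zero) hgc (k := 1)
    fun z hz => by simp [hg z hz]
  omega

/-- The complement of a Jordan curve has at most two components. -/
theorem mem_connectedComponentIn_of_notMem (h : IsOrientedJordanCurve C γ) {x y v : ℂ}
    (hx : (x : RSphere) ∉ C) (hy : (y : RSphere) ∉ C) (hv : (v : RSphere) ∉ C)
    (hxy : (y : RSphere) ∉ connectedComponentIn Cᶜ (x : RSphere))
    (hxv : (v : RSphere) ∉ connectedComponentIn Cᶜ (x : RSphere)) :
    (v : RSphere) ∈ connectedComponentIn Cᶜ (y : RSphere) := by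
  have hxr : (x : RSphere) ∉ range γ := by rwa [h.range_eq]
  have hyr : (y : RSphere) ∉ range γ := by rwa [h.range_eq]
  have hvr : (v : RSphere) ∉ range γ := by rwa [h.range_eq]
  have hcl : ∀ w : RSphere, w ∉ C → w ∉ connectedComponentIn Cᶜ (x : RSphere) →
      w ∉ closure (connectedComponentIn Cᶜ (x : RSphere)) := fun w hw hw' hc =>
    hw' (closure_connectedComponentIn_inter_subset hx ⟨hc, hw⟩)
  obtain ⟨m, hm⟩ := Complex.exp_eq_one_iff.1 (exp_loopVar h.continuous hxr hyr)
  obtain ⟨n, hn⟩ := Complex.exp_eq_one_iff.1 (exp_loopVar h.continuous hyr hvr)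
  -- The two variations are `m` and `n` times `2πi`, so the exponents `n` and `-m` cancel them. The
  -- product has a logarithm on `C`; in the component of `x` its second factor has no zeros or
  -- poles, which forces `n = 0`.
  have hlv := ((isLogVar_loopVar h.continuous hxr hyr).zpow n).mul
    ((isLogVar_loopVar h.continuous hyr hvr).zpow (-m))
  have h0 : (n : ℂ) * loopVar γ x y + ((-m : ℤ) : ℂ) * loopVar γ y v = 0 := by
    rw [hm, hn]; push_cast; ring
  rw [h0] at hlv
  obtain ⟨g, hgc, hg⟩ := h.exists_log (φ := fun z => ratio z x y ^ n * ratio z y v ^ (-m))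
    (((continuous_ratio_loop h.continuous hyr).zpow₀ n
      fun t => Or.inl (ratio_loop_ne_zero hxr hyr t)).mul
      ((continuous_ratio_loop h.continuous hvr).zpow₀ (-m)
      fun t => Or.inl (ratio_loop_ne_zero hyr hvr t)))
    (fun t => mul_ne_zero (zpow_ne_zero _ (ratio_loop_ne_zero hxr hyr t))
      (zpow_ne_zero _ (ratio_loop_ne_zero hyr hvr t))) hlv
  have hne : ∀ z ∈ closure (connectedComponentIn Cᶜ (x : RSphere)), ratio z y v ≠ 0 := fun z hz =>
    ratio_ne_zero (fun e => hcl _ hy hxy (e ▸ hz)) (fun e => hcl _ hv hxv (e ▸ hz))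
  have := eq_zero_of_ratio_zpow_mul_eq_exp h.isClosed hx hy hxy
    (h := fun z => ratio z y v ^ (-m)) (fun z hz => by
      apply ContinuousAt.continuousWithinAt
      refine ContinuousAt.zpow₀ ?_ _ (Or.inl (hne z hz))
      exact ContinuousAt.comp (f := fun z : RSphere => (z, y, v))
        (g := fun p : RSphere × ℂ × ℂ => ratio p.1 p.2.1 p.2.2)
        (continuousAt_ratio (fun e => hcl _ hv hxv (e ▸ hz))) (by fun_prop))
    (fun z hz => zpow_ne_zero _ (hne z hz)) hgc (k := n) fun z hz => (hg z hz).symm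
  exact h.mem_connectedComponentIn_of_loopVar_eq_zero hy hv (by rw [hn, this]; simp)

theorem loopVar_eq_of_mem_connectedComponentIn (h : IsOrientedJordanCurve C γ)
    (hi : OnePoint.infty ∈ C) {y : ℂ} (hy : (y : RSphere) ∉ C) {z w : RSphere} (hz : z ∉ C)
    (hw : w ∈ connectedComponentIn Cᶜ z) :
    loopVar γ (finitePart z) y = loopVar γ (finitePart w) y :=
  loopVar_eq_of_isPreconnected h.continuous (by rwa [h.range_eq])
    isPreconnected_connectedComponentIn
    (fun v hv => by rw [h.range_eq]; exact connectedComponentIn_subset _ _ hv)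
    (fun hc => absurd hi (connectedComponentIn_subset Cᶜ z hc)) (mem_connectedComponentIn hz) hw

end IsOrientedJordanCurve

/-- The sphere stays connected when finitely many points are removed. -/
theorem isPreconnected_compl_of_finite {V : Set RSphere} (hV : V.Finite) : IsPreconnected Vᶜ := by
  let V' : Set ℂ := (↑) ⁻¹' V
  have hV' : V'.Finite := hV.preimage OnePoint.coe_injective.injOn
  have hc : IsPreconnected V'ᶜ :=
    (hV'.countable.isConnected_compl_of_one_lt_rank (by simp)).isPreconnected
  refine (hc.image ((↑) : ℂ → RSphere) OnePoint.continuous_coe.continuousOn).subset_closure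
    (image_subset_iff.2 fun z hz => hz) ?_
  have hd : Dense V'ᶜ := hV'.countable.dense_compl ℝ
  have : Dense ((↑) '' V'ᶜ : Set RSphere) :=
    OnePoint.denseRange_coe.dense_image OnePoint.continuous_coe hd
  rw [this.closure_eq]
  exact subset_univ _

theorem isClosed_image_lift {γ : UnitAddCircle → RSphere} (h : Continuous γ) (a b : ℝ) :
    IsClosed ((fun t : ℝ => γ t) '' Icc a b) :=
  (isCompact_Icc.image (continuous_loop_lift h)).isClosed

namespace IsOrientedJordanCurve

variable {C : Set RSphere} {γ : UnitAddCircle → RSphere}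

theorem image_Icc_union (h : IsOrientedJordanCurve C γ) {a b : ℝ} (hab : a ≤ b)
    (hba : b ≤ a + 1) :
    (fun t : ℝ => γ t) '' Icc a b ∪ (fun t : ℝ => γ t) '' Icc b (a + 1) = C := by
  rw [← image_union, Icc_union_Icc_eq_Icc hab hba]
  apply Subset.antisymm
  · rintro _ ⟨t, -, rfl⟩
    exact h.mem _
  · intro z hz
    obtain ⟨t, ht, rfl⟩ := h.exists_eq a hz
    exact ⟨t, Ico_subset_Icc_self ht, rfl⟩

theorem image_Icc_inter (h : IsOrientedJordanCurve C γ) {a b : ℝ} :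
    (fun t : ℝ => γ t) '' Icc a b ∩ (fun t : ℝ => γ t) '' Icc b (a + 1) ⊆
      {γ (a : UnitAddCircle), γ (b : UnitAddCircle)} := by
  rintro _ ⟨⟨s, hs, rfl⟩, t, ht, hst⟩
  obtain ⟨n, hn⟩ := h.eq_iff.1 hst
  have h1 : (0 : ℝ) ≤ n := by linarith [hs.1, hs.2, ht.1, ht.2]
  have h2 : (n : ℝ) ≤ 1 := by linarith [hs.1, hs.2, ht.1, ht.2]
  have h1' : 0 ≤ n := by exact_mod_cast h1
  have h2' : n ≤ 1 := by exact_mod_cast h2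
  obtain rfl | rfl : n = 0 ∨ n = 1 := by omega
  · right
    have : s = b := by
      have := hs.2; have := ht.1; push_cast at hn; linarith
    simp [this]
  · left
    have : s = a := by
      have := hs.1; have := ht.2; push_cast at hn; linarith
    simp [this]

/-- Removing two points disconnects the curve but not the sphere. -/
theorem exists_notMem (h : IsOrientedJordanCurve C γ) : ∃ z, z ∉ C := by
  by_contra! hC
  have hab : γ ((0 : ℝ) : UnitAddCircle) ≠ γ ((1 / 2 : ℝ) : UnitAddCircle) := by
    intro e
    have := h.injOn_lift (a := 0) (b := 1 / 2) (by norm_num) (by norm_num) (by norm_num) e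
    norm_num at this
  set A := (fun t : ℝ => γ t) '' Icc 0 (1 / 2) with hA
  set B := (fun t : ℝ => γ t) '' Icc (1 / 2) (0 + 1) with hB
  have hu : A ∪ B = C := h.image_Icc_union (by norm_num) (by norm_num)
  have hi : A ∩ B ⊆ _ := h.image_Icc_inter
  set V : Set RSphere := {γ ((0 : ℝ) : UnitAddCircle), γ ((1 / 2 : ℝ) : UnitAddCircle)} with hV
  have hVf : V.Finite := by simp [hV]
  have hmem : ∀ t : ℝ, t ∈ Ioo (0 : ℝ) 1 → t ≠ 1 / 2 → γ (t : UnitAddCircle) ∈ Vᶜ := by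
    rintro t ht ht2 (e | e)
    · obtain ⟨n, hn⟩ := h.eq_iff.1 e
      have := int_eq_zero_of_abs_lt_one (n := n) (by linarith [ht.1, ht.2])
        (by linarith [ht.1, ht.2])
      simp only [this, Int.cast_zero, add_zero] at hn
      linarith [ht.1]
    · obtain ⟨n, hn⟩ := h.eq_iff.1 e
      have := int_eq_zero_of_abs_lt_one (n := n) (by linarith [ht.1, ht.2])
        (by linarith [ht.1, ht.2])
      simp only [this, Int.cast_zero, add_zero] at hn
      exact ht2 hn
  have := isPreconnected_closed_iff.1 (isPreconnected_compl_of_finite hVf) A B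
    (isClosed_image_lift h.continuous _ _) (isClosed_image_lift h.continuous _ _)
    (fun z _ => hu ▸ hC z)
    ⟨_, hmem (1 / 4) (by norm_num) (by norm_num), ⟨1 / 4, by norm_num, rfl⟩⟩
    ⟨_, hmem (3 / 4) (by norm_num) (by norm_num), ⟨3 / 4, by norm_num, rfl⟩⟩
  obtain ⟨z, hz, hz'⟩ := this
  exact hz (hi hz')

/-- The variation of the logarithm along a subarc depends continuously on the zero. -/
theorem exists_arc_logVar (h : IsOrientedJordanCurve C γ) {a b : ℝ} (hab : a ≤ b) {y : ℂ}
    (hy : (y : RSphere) ∉ C) : ∃ L : ℂ → ℂ, ∀ z : ℂ, (z : RSphere) ∉ (fun t : ℝ => γ t) '' Icc a b →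
      IsLogVar (fun t => ratio (γ t) z y) a b (L z) ∧ ContinuousAt L z := by
  have hne : ∀ z : ℂ, (z : RSphere) ∉ (fun t : ℝ => γ t) '' Icc a b →
      ∃ L, IsLogVar (fun t => ratio (γ t) z y) a b L := fun z hz => by
    refine exists_isLogVar (continuous_ratio_loop h.continuous
      (by rwa [h.range_eq])).continuousOn fun t ht => ratio_ne_zero (fun e => hz ?_)
      (fun e => hy (e ▸ h.mem _))
    rw [uIcc_of_le hab] at ht
    exact ⟨t, ht, e⟩
  choose! L hL using hne
  refine ⟨L, fun z hz => ⟨hL z hz, ?_⟩⟩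
  refine continuousAt_of_isLogVar (Φ := fun z t => ratio (γ t) z y) (a := a) (b := b)
    (fun s _ => ?_) ?_
  · refine ContinuousAt.comp (f := fun p : ℂ × ℝ => (γ p.2, p.1, y))
      (g := fun p : RSphere × ℂ × ℂ => ratio p.1 p.2.1 p.2.2)
      (continuousAt_ratio fun e => hy (e ▸ h.mem _)) ?_
    exact (h.continuous_lift.comp continuous_snd).continuousAt.prodMk (by fun_prop)
  · have : ∀ᶠ w : ℂ in 𝓝 z, (w : RSphere) ∉ (fun t : ℝ => γ t) '' Icc a b :=
      OnePoint.continuous_coe.continuousAt.eventually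
        ((isClosed_image_lift h.continuous a b).isOpen_compl.mem_nhds hz)
    exact this.mono fun w hw => hL w hw

/-- A Jordan curve separates the sphere. -/
theorem exists_loopVar_ne_zero (h : IsOrientedJordanCurve C γ) (hi : OnePoint.infty ∈ C) :
    ∃ x y : ℂ, (x : RSphere) ∉ C ∧ (y : RSphere) ∉ C ∧ loopVar γ x y ≠ 0 := by
  classical
  by_contra! hcon
  obtain ⟨z₀, hz₀⟩ : ∃ z₀ : ℂ, (z₀ : RSphere) ∉ C := by
    obtain ⟨z, hz⟩ := h.exists_notMem
    have hzi : z ≠ OnePoint.infty := fun e => hz (e ▸ hi)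
    exact ⟨finitePart z, by rwa [coe_finitePart hzi]⟩
  obtain ⟨s₀, -, hs₀⟩ := h.exists_eq 0 hi
  have hfin : ∀ r : ℝ, 0 < r → r < 1 → ∃ a : ℂ, γ ((s₀ + r : ℝ) : UnitAddCircle) = a := by
    intro r hr hr1
    refine ⟨_, (coe_finitePart fun e => ?_).symm⟩
    rw [← hs₀] at e
    obtain ⟨n, hn⟩ := h.eq_iff.1 e
    have hn' : r = n := by linarith
    have := int_eq_zero_of_abs_lt_one (n := n) (by linarith) (by linarith)
    simp [this] at hn'
    linarith
  -- The curve is at `∞` at time `s₀`; cutting at thirds of a period keeps both division points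
  -- finite.
  set s := s₀ + 1 / 3 with hs
  set t := s₀ + 2 / 3 with ht
  obtain ⟨a, ha⟩ := hfin (1 / 3) (by norm_num) (by norm_num)
  obtain ⟨b, hb⟩ := hfin (2 / 3) (by norm_num) (by norm_num)
  rw [← hs] at ha
  rw [← ht] at hb
  have hst : s ≤ t := by rw [hs, ht]; linarith
  have hts : t ≤ s + 1 := by rw [hs, ht]; linarith
  have hab : a ≠ b := fun e => by
    have := h.injOn_lift (a := s) (b := t) (by rw [hs, ht]; linarith) ⟨le_rfl, hst⟩ ⟨hst, le_rfl⟩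
      (by simp only [ha, hb, e])
    rw [hs, ht] at this
    linarith
  set A := (fun t : ℝ => γ t) '' Icc s t with hA
  set B := (fun t : ℝ => γ t) '' Icc t (s + 1) with hB
  have hu : A ∪ B = C := h.image_Icc_union hst hts
  have hin : A ∩ B ⊆ _ := h.image_Icc_inter
  rw [ha, hb] at hin
  have haA : (a : RSphere) ∈ A := ⟨s, ⟨le_rfl, hst⟩, ha⟩
  obtain ⟨LA, hLA⟩ := h.exists_arc_logVar hst hz₀
  obtain ⟨LB, hLB⟩ := h.exists_arc_logVar hts hz₀
  have hsum : ∀ z : ℂ, (z : RSphere) ∉ C → LA z = - LB z := fun z hz => by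
    have hzr : (z : RSphere) ∉ range γ := by rwa [h.range_eq]
    have hz₀r : (z₀ : RSphere) ∉ range γ := by rwa [h.range_eq]
    have h1 := (hLA z fun hc => hz (hu ▸ Or.inl hc)).1
    have h2 := (hLB z fun hc => hz (hu ▸ Or.inr hc)).1
    have h3 := (h1.trans (continuous_ratio_loop h.continuous hz₀r)
      (ratio_loop_ne_zero hzr hz₀r) h2).unique (isLogVar_loopVar_period h.continuous hzr hz₀r s)
    rw [hcon z z₀ hz hz₀] at h3
    linear_combination h3
  -- If all windings vanish, the variations along the complementary arcs `A` and `B` cancel off `C`.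
  -- So `LA` and `-LB` glue to a continuous function off `a` and `b`, and it is a logarithm of a
  -- Möbius function with zero `b` and pole `a`.
  let G : ℂ → ℂ := fun z => if (z : RSphere) ∉ A then LA z else - LB z
  have hGc : ∀ z : ℂ, z ≠ a → z ≠ b → ContinuousAt G z := by
    intro z hza hzb
    by_cases hzA : (z : RSphere) ∈ A
    · have hzB : (z : RSphere) ∉ B := fun hc => by
        rcases hin ⟨hzA, hc⟩ with e | e
        · exact hza (OnePoint.coe_injective e)
        · exact hzb (OnePoint.coe_injective e)
      refine (hLB z hzB).2.neg.congr ?_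
      have : ∀ᶠ w : ℂ in 𝓝 z, (w : RSphere) ∉ B :=
        OnePoint.continuous_coe.continuousAt.eventually
          ((isClosed_image_lift h.continuous _ _).isOpen_compl.mem_nhds hzB)
      filter_upwards [this] with w hw
      by_cases hwA : (w : RSphere) ∈ A
      · simp [G, hwA]
      · simp only [G, hwA, not_false_eq_true, if_true]
        exact (hsum w fun hc => by rw [← hu] at hc; exact hc.elim hwA hw).symm
    · refine (hLA z hzA).2.congr ?_
      have : ∀ᶠ w : ℂ in 𝓝 z, (w : RSphere) ∉ A :=
        OnePoint.continuous_coe.continuousAt.eventually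
          ((isClosed_image_lift h.continuous _ _).isOpen_compl.mem_nhds hzA)
      filter_upwards [this] with w hw
      simp [G, hw]
  have haz₀ : a - z₀ ≠ 0 := sub_ne_zero.2 fun e => hz₀ (e ▸ ha ▸ h.mem _)
  have hbz₀ : b - z₀ ≠ 0 := sub_ne_zero.2 fun e => hz₀ (e ▸ hb ▸ h.mem _)
  have hGe : ∀ z : ℂ, z ≠ a → z ≠ b →
      Complex.exp (G z) = (b - z) / (b - z₀) * ((a - z₀) / (a - z)) := by
    intro z hza hzb
    have hza' : a - z ≠ 0 := sub_ne_zero.2 hza.symm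
    have hzb' : b - z ≠ 0 := sub_ne_zero.2 hzb.symm
    by_cases hzA : (z : RSphere) ∈ A
    · have hzB : (z : RSphere) ∉ B := fun hc => by
        rcases hin ⟨hzA, hc⟩ with e | e
        · exact hza (OnePoint.coe_injective e)
        · exact hzb (OnePoint.coe_injective e)
      have h1 := (hLB z hzB).1.exp_mul
      rw [coe_add_one, ha, hb, ratio_coe, ratio_coe] at h1
      simp only [G, hzA, not_true_eq_false, if_false, Complex.exp_neg]
      have h2 : Complex.exp (LB z) = (a - z) / (a - z₀) * ((b - z₀) / (b - z)) := by
        field_simp at h1 ⊢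
        linear_combination h1
      rw [h2]
      field_simp
    · have h1 := (hLA z hzA).1.exp_mul
      rw [ha, hb, ratio_coe, ratio_coe] at h1
      simp only [G, hzA, not_false_eq_true, if_true]
      field_simp at h1 ⊢
      linear_combination h1
  let E : ℝ → ℂ := fun t => Complex.exp (2 * Real.pi * Complex.I * t)
  have hE0 : ∀ t, E t ≠ 0 := fun t => Complex.exp_ne_zero _
  have hE1 : ∀ t, ‖E t‖ = 1 := norm_exp_two_pi_I_mul
  have hEc : Continuous E := by simp only [E]; fun_prop
  have hE01 : E 0 = E 1 := by simp [E, Complex.exp_two_pi_mul_I]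
  -- The circle about `b` of radius `|a - b| / 2` encloses the zero but not the pole, so the Möbius
  -- function winds once along it and cannot have a logarithm there.
  set ρ : ℂ := (a - b) / 2 with hρ
  have hab' : a - b ≠ 0 := sub_ne_zero.2 hab
  have hρ0 : ρ ≠ 0 := div_ne_zero hab' two_ne_zero
  have hnz : ∀ t, 1 + -(E t / 2) ≠ 0 := fun t e => by
    have h2 : E t = 2 := by linear_combination -2 * e
    have h3 := hE1 t
    rw [h2] at h3
    norm_num at h3
  have hbz : ∀ t, b + ρ * E t ≠ b := fun t e => by
    simp [hρ0, hE0] at e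
  have haz : ∀ t, b + ρ * E t ≠ a := fun t e => hnz t (by
    have : (a - b) * (1 + -(E t / 2)) = 0 := by rw [hρ] at e; linear_combination -e
    exact (mul_eq_zero.1 this).resolve_left hab')
  have h1 : IsLogVar (fun t => Complex.exp (G (b + ρ * E t))) 0 1 0 := by
    refine ⟨fun t => G (b + ρ * E t), ?_, fun t _ => rfl, by simp only [hE01, sub_self]⟩
    apply Continuous.continuousOn
    rw [continuous_iff_continuousAt]
    intro t
    exact ContinuousAt.comp (g := G) (hGc _ (haz t) (hbz t)) (by fun_prop)
  have h2 := (isLogVar_circle hρ0).mul ((isLogVar_one_add_of_norm_le (u := fun t => -(E t / 2))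
    (by fun_prop) (by simp only [hE01]) (fun t => by simp [hE1])).inv.mul
    (IsLogVar.const (c := - ((a - z₀) / ((b - z₀) * (a - b)))) (by
      refine neg_ne_zero.2 (div_ne_zero haz₀ (mul_ne_zero hbz₀ hab'))) 0 1))
  have h3 := h1.unique (h2.congr fun t _ => by
    rw [hGe _ (haz t) (hbz t)]
    have h4 : a - (b + ρ * E t) = (a - b) * (1 + -(E t / 2)) := by rw [hρ]; ring
    have h5 := hnz t
    rw [h4]
    change ρ * E t * _ = _
    field_simp
    ring)
  simp [Real.pi_ne_zero] at h3

theorem exists_notMem_connectedComponentIn (h : IsOrientedJordanCurve C γ)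
    (hi : OnePoint.infty ∈ C) {z : RSphere} (hz : z ∉ C) :
    ∃ w ∉ C, w ∉ connectedComponentIn Cᶜ z := by
  obtain ⟨x, y, hx, hy, hxy⟩ := h.exists_loopVar_ne_zero hi
  have hy' : (y : RSphere) ∉ range γ := by rwa [h.range_eq]
  by_contra! hcon
  have h1 := h.loopVar_eq_of_mem_connectedComponentIn hi hy hz (hcon x hx)
  have h2 := h.loopVar_eq_of_mem_connectedComponentIn hi hy hz (hcon y hy)
  rw [h1] at h2
  exact hxy (h2.trans (loopVar_self h.continuous hy'))

/-- A proper subarc of a Jordan curve does not separate the sphere. -/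
theorem mem_connectedComponentIn_compl_arc (h : IsOrientedJordanCurve C γ) {a b : ℝ}
    (hba : b - a < 1) {x y : ℂ} (hx : (x : RSphere) ∉ C) (hy : (y : RSphere) ∉ C) :
    (y : RSphere) ∈ connectedComponentIn ((fun t : ℝ => γ t) '' Icc a b)ᶜ (x : RSphere) := by
  by_contra hyU
  have hxr : (x : RSphere) ∉ range γ := by rwa [h.range_eq]
  have hyr : (y : RSphere) ∉ range γ := by rwa [h.range_eq]
  have hsub : (fun t : ℝ => γ t) '' Icc a b ⊆ C := by
    rintro _ ⟨t, -, rfl⟩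
    exact h.mem _
  obtain ⟨g, hgc, hg, -⟩ := exists_global_isLogVar
    (continuous_ratio_loop (x := x) h.continuous hyr) (ratio_loop_ne_zero hxr hyr)
  have hemb : IsClosedEmbedding (fun t : Icc a b => γ ((t : ℝ) : UnitAddCircle)) :=
    (h.continuous_lift.comp continuous_subtype_val).isClosedEmbedding
      (injOn_iff_injective.1 (h.injOn_lift hba))
  -- A logarithm along the lifted curve always exists. On an arc shorter than a period the parameter
  -- is a function of the point, so this logarithm descends to the arc without any condition on the
  -- winding.
  obtain ⟨G, hG⟩ := ContinuousMap.exists_extension' hemb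
    (⟨fun t => g t, hgc.comp continuous_subtype_val⟩ : C(Icc a b, ℂ))
  have := eq_zero_of_ratio_zpow_mul_eq_exp (isClosed_image_lift h.continuous a b)
    (fun hc => hx (hsub hc)) (fun hc => hy (hsub hc)) hyU (h := fun _ => 1)
    continuousOn_const (fun _ _ => one_ne_zero) G.continuous (k := 1) (by
      rintro _ ⟨t, ht, rfl⟩
      have := congrFun hG ⟨t, ht⟩
      simp only [Function.comp_apply, ContinuousMap.coe_mk] at this
      simp [this, hg])
  omega

/-- Every point of a Jordan curve is in the boundary of each complementary component. -/
theorem mem_closure_connectedComponentIn (h : IsOrientedJordanCurve C γ)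
    (hi : OnePoint.infty ∈ C) {p z : RSphere} (hp : p ∈ C) (hz : z ∉ C) :
    p ∈ closure (connectedComponentIn Cᶜ z) := by
  by_contra hpU
  set U := connectedComponentIn Cᶜ z with hU
  obtain ⟨w, hw, hwU⟩ := h.exists_notMem_connectedComponentIn hi hz
  obtain ⟨t₀, -, rfl⟩ := h.exists_eq 0 hp
  have hN := h.continuous_lift.continuousAt.eventually (isClosed_closure.isOpen_compl.mem_nhds hpU)
  obtain ⟨δ', hδ', hδN⟩ := Metric.eventually_nhds_iff.1 hN
  obtain ⟨δ, hδ, hδ1, hδ2⟩ : ∃ δ : ℝ, 0 < δ ∧ δ < δ' ∧ δ < 1 / 2 :=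
    ⟨min δ' (1 / 2) / 2, by positivity, by
      have := min_le_left δ' (1 / 2); linarith, by
      have := min_le_right δ' (1 / 2); linarith⟩
  set A := (fun t : ℝ => γ t) '' Icc (t₀ + δ) (t₀ + 1 - δ) with hA
  have hCA : ∀ v ∈ C, v ∉ A → v ∉ closure U := by
    intro v hv hvA
    obtain ⟨t, ht, rfl⟩ := h.exists_eq (t₀ - δ) hv
    refine hδN ?_
    by_contra hd
    refine hvA ⟨t, ⟨?_, by linarith [ht.2]⟩, rfl⟩
    by_contra! hlt
    exact hd (by rw [Real.dist_eq, abs_lt]; constructor <;> linarith [ht.1])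
  have hAC : A ⊆ C := by
    rintro _ ⟨t, -, rfl⟩
    exact h.mem _
  set O := connectedComponentIn Aᶜ z with hO
  have hzz : ((finitePart z : ℂ) : RSphere) = z := coe_finitePart fun e => hz (e ▸ hi)
  have hww : ((finitePart w : ℂ) : RSphere) = w := coe_finitePart fun e => hw (e ▸ hi)
  have hwO : w ∈ O := by
    have := h.mem_connectedComponentIn_compl_arc (a := t₀ + δ) (b := t₀ + 1 - δ)
      (by linarith) (x := finitePart z) (y := finitePart w) (by rwa [hzz]) (by rwa [hww])
    rwa [hzz, hww] at this
  have hzO : z ∈ O := mem_connectedComponentIn fun hc => hz (hAC hc)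
  -- If `closure U` misses a subarc around `p`, then off the remaining arc `A` it meets no point of
  -- `C`. Hence `O` is covered by the disjoint open sets `U` and `(closure U)ᶜ`; but `O` contains
  -- both `z` and `w`.
  have hOU : O ⊆ U := by
    refine isPreconnected_connectedComponentIn.subset_left_of_subset_union
      h.isClosed.isOpen_compl.connectedComponentIn isClosed_closure.isOpen_compl
      (disjoint_compl_right_iff_subset.2 subset_closure) (fun v hv => ?_)
      ⟨z, hzO, mem_connectedComponentIn hz⟩
    by_cases hvU : v ∈ closure U
    · left
      by_cases hvC : v ∈ C
      · exact absurd hvU (hCA v hvC (connectedComponentIn_subset _ _ hv))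
      · exact closure_connectedComponentIn_inter_subset hz ⟨hvU, hvC⟩
    · exact Or.inr hvU
  exact hwU (hOU hwO)

end IsOrientedJordanCurve

/-! ### Rational maps in homogeneous form -/

open Classical in
/-- The point of the sphere with homogeneous coordinates `[a : b]`. -/
noncomputable def homPoint (a b : ℂ) : RSphere :=
  if b = 0 then OnePoint.infty else ((a / b : ℂ) : RSphere)

theorem homPoint_of_ne_zero (a : ℂ) {b : ℂ} (hb : b ≠ 0) :
    homPoint a b = ((a / b : ℂ) : RSphere) := if_neg hb

@[simp] theorem homPoint_zero (a : ℂ) : homPoint a 0 = OnePoint.infty := if_pos rfl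

theorem homPoint_eq_infty_iff {a b : ℂ} : homPoint a b = OnePoint.infty ↔ b = 0 := by
  constructor
  · intro h
    by_contra hb
    rw [homPoint_of_ne_zero a hb] at h
    exact OnePoint.coe_ne_infty _ h
  · rintro rfl
    simp

theorem homPoint_mul_left {c : ℂ} (hc : c ≠ 0) (a b : ℂ) :
    homPoint (c * a) (c * b) = homPoint a b := by
  rcases eq_or_ne b 0 with rfl | hb
  · simp
  · rw [homPoint_of_ne_zero _ (mul_ne_zero hc hb), homPoint_of_ne_zero _ hb,
      mul_div_mul_left _ _ hc]

theorem sphereInv_homPoint {a b : ℂ} (h : a ≠ 0 ∨ b ≠ 0) :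
    sphereInv (homPoint a b) = homPoint b a := by
  rcases eq_or_ne b 0 with rfl | hb
  · simp [homPoint_of_ne_zero 0 (h.resolve_right (by simp))]
  · rcases eq_or_ne a 0 with rfl | ha
    · simp [homPoint_of_ne_zero _ hb]
    · rw [homPoint_of_ne_zero _ hb, homPoint_of_ne_zero _ ha, sphereInv_coe (div_ne_zero ha hb),
        inv_div]

theorem sphereTranslate_homPoint (v a b : ℂ) :
    sphereTranslate v (homPoint a b) = homPoint (a + v * b) b := by
  rcases eq_or_ne b 0 with rfl | hb
  · simp
  · rw [homPoint_of_ne_zero _ hb, homPoint_of_ne_zero _ hb, sphereTranslate_coe]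
    congr 1
    field_simp

/-- `f` is given in homogeneous coordinates by two forms of degree `d` without common zeros, whose
dehomogenizations are `p` and `q`. -/
structure IsRatPair (f : RSphere → RSphere) (d : ℕ) (p q : ℂ[X]) : Prop where
  natDegree_left : p.natDegree ≤ d
  natDegree_right : q.natDegree ≤ d
  eval_ne_zero : ∀ z, p.eval z ≠ 0 ∨ q.eval z ≠ 0
  coeff_ne_zero : p.coeff d ≠ 0 ∨ q.coeff d ≠ 0
  apply_coe : ∀ z : ℂ, f z = homPoint (p.eval z) (q.eval z)
  apply_infty : f OnePoint.infty = homPoint (p.coeff d) (q.coeff d)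

/-- `f` is given by some pair of forms of degree `d` without common zeros. -/
def HasRatPair (f : RSphere → RSphere) (d : ℕ) : Prop := ∃ p q, IsRatPair f d p q

theorem IsRationalMapOfDegree.hasRatPair {f : RSphere → RSphere} {d : ℕ}
    (hf : IsRationalMapOfDegree f d) (hd : 1 ≤ d) : HasRatPair f d := by
  obtain ⟨p, q, hpq, hdeg, hz, h1, h2⟩ := hf
  refine ⟨p, q, hdeg ▸ le_max_left _ _, hdeg ▸ le_max_right _ _, fun z => ?_, ?_, fun z => ?_, ?_⟩
  · by_contra! h
    obtain ⟨a, b, hab⟩ := hpq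
    have := congrArg (Polynomial.eval z) hab
    simp [h.1, h.2] at this
  · rcases max_choice p.natDegree q.natDegree with h | h
    · left
      rw [hdeg, h, coeff_natDegree, Ne, leadingCoeff_eq_zero]
      rintro rfl
      simp at h hdeg
      omega
    · right
      rw [hdeg, h, coeff_natDegree, Ne, leadingCoeff_eq_zero]
      rintro rfl
      simp at h hdeg
      omega
  · by_cases hq : q.eval z = 0
    · rw [(hz z).2 hq, hq, homPoint_zero]
    · rw [(hz z).1 hq, homPoint_of_ne_zero _ hq]
  · by_cases hq : q.coeff d = 0
    · rw [h2 hq, hq, homPoint_zero]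
    · rw [h1 hq, homPoint_of_ne_zero _ hq]

theorem eval_reflect {d : ℕ} {p : ℂ[X]} (hp : p.natDegree ≤ d) {z : ℂ} (hz : z ≠ 0) :
    (p.reflect d).eval z = z ^ d * p.eval z⁻¹ := by
  have : Invertible z⁻¹ := invertibleOfNonzero (inv_ne_zero hz)
  have h := eval₂_reflect_mul_pow (RingHom.id ℂ) z⁻¹ d p hp
  rw [invOf_eq_inv, inv_inv] at h
  rw [eval, eval, ← h, inv_pow]
  field_simp

theorem eval_reflect_zero (d : ℕ) (p : ℂ[X]) : (p.reflect d).eval 0 = p.coeff d := by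
  rw [← coeff_zero_eq_eval_zero, coeff_reflect, revAt_le (Nat.zero_le d), Nat.sub_zero]

theorem coeff_reflect_self (d : ℕ) (p : ℂ[X]) : (p.reflect d).coeff d = p.eval 0 := by
  rw [coeff_reflect, revAt_le le_rfl, Nat.sub_self, coeff_zero_eq_eval_zero]

theorem coeff_taylor_of_natDegree_le {d : ℕ} {p : ℂ[X]} (hp : p.natDegree ≤ d) (v : ℂ) :
    (taylor v p).coeff d = p.coeff d := by
  rcases hp.lt_or_eq with h | rfl
  · rw [coeff_eq_zero_of_natDegree_lt h, coeff_eq_zero_of_natDegree_lt (by rwa [natDegree_taylor])]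
  · have := leadingCoeff_taylor (r := v) (f := p)
    rwa [leadingCoeff, natDegree_taylor] at this

namespace HasRatPair

variable {f : RSphere → RSphere} {d : ℕ}

theorem sphereInv_comp (hf : HasRatPair f d) : HasRatPair (sphereInv ∘ f) d := by
  obtain ⟨p, q, h⟩ := hf
  refine ⟨q, p, h.natDegree_right, h.natDegree_left, fun z => (h.eval_ne_zero z).symm,
    h.coeff_ne_zero.symm, fun z => ?_, ?_⟩
  · rw [Function.comp_apply, h.apply_coe, sphereInv_homPoint (h.eval_ne_zero z)]
  · rw [Function.comp_apply, h.apply_infty, sphereInv_homPoint h.coeff_ne_zero]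

theorem comp_sphereInv (hf : HasRatPair f d) : HasRatPair (f ∘ sphereInv) d := by
  obtain ⟨p, q, h⟩ := hf
  refine ⟨p.reflect d, q.reflect d, natDegree_reflect_le.trans (by simp [h.natDegree_left]),
    natDegree_reflect_le.trans (by simp [h.natDegree_right]), fun z => ?_, ?_, fun z => ?_, ?_⟩
  · rcases eq_or_ne z 0 with rfl | hz
    · simpa only [eval_reflect_zero] using h.coeff_ne_zero
    · rw [eval_reflect h.natDegree_left hz, eval_reflect h.natDegree_right hz]
      exact (h.eval_ne_zero z⁻¹).imp (mul_ne_zero (pow_ne_zero _ hz)) (mul_ne_zero (pow_ne_zero _ hz))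
  · simpa only [coeff_reflect_self] using h.eval_ne_zero 0
  · rcases eq_or_ne z 0 with rfl | hz
    · simp only [Function.comp_apply, sphereInv_zero, eval_reflect_zero, h.apply_infty]
    · rw [eval_reflect h.natDegree_left hz, eval_reflect h.natDegree_right hz,
        homPoint_mul_left (pow_ne_zero _ hz), Function.comp_apply, sphereInv_coe hz, h.apply_coe]
  · simp only [Function.comp_apply, sphereInv_infty, coeff_reflect_self, h.apply_coe]

theorem sphereTranslate_comp (hf : HasRatPair f d) (v : ℂ) :
    HasRatPair (sphereTranslate v ∘ f) d := by
  obtain ⟨p, q, h⟩ := hf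
  refine ⟨p + Polynomial.C v * q, q, ?_, h.natDegree_right, fun z => ?_, ?_, fun z => ?_, ?_⟩
  · exact (natDegree_add_le _ _).trans (max_le h.natDegree_left
      ((natDegree_C_mul_le _ _).trans h.natDegree_right))
  · by_contra! hc
    have := h.eval_ne_zero z
    simp [hc.2] at this hc
    exact this hc
  · by_contra! hc
    have := h.coeff_ne_zero
    simp [hc.2] at this hc
    exact this hc
  · rw [Function.comp_apply, h.apply_coe, sphereTranslate_homPoint]
    simp
  · rw [Function.comp_apply, h.apply_infty, sphereTranslate_homPoint]
    simp

theorem comp_sphereTranslate (hf : HasRatPair f d) (v : ℂ) :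
    HasRatPair (f ∘ sphereTranslate v) d := by
  obtain ⟨p, q, h⟩ := hf
  refine ⟨taylor v p, taylor v q, by rw [natDegree_taylor]; exact h.natDegree_left,
    by rw [natDegree_taylor]; exact h.natDegree_right, fun z => ?_, ?_, fun z => ?_, ?_⟩
  · simpa only [taylor_eval] using h.eval_ne_zero _
  · rw [coeff_taylor_of_natDegree_le h.natDegree_left,
      coeff_taylor_of_natDegree_le h.natDegree_right]
    exact h.coeff_ne_zero
  · rw [Function.comp_apply, sphereTranslate_coe, h.apply_coe, taylor_eval, taylor_eval]
  · rw [coeff_taylor_of_natDegree_le h.natDegree_left,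
      coeff_taylor_of_natDegree_le h.natDegree_right, Function.comp_apply, sphereTranslate_infty,
      h.apply_infty]

theorem coordAt_comp (hf : HasRatPair f d) (v : RSphere) : HasRatPair (coordAt v ∘ f) d := by
  by_cases hv : v = OnePoint.infty
  · simpa [coordAt, hv] using hf
  · have := (hf.sphereTranslate_comp (-finitePart v)).sphereInv_comp
    simpa [coordAt, hv, Function.comp_def] using! this

theorem comp_coordAt_symm (hf : HasRatPair f d) (u : RSphere) :
    HasRatPair (f ∘ (coordAt u).symm) d := by
  by_cases hu : u = OnePoint.infty
  · simpa [coordAt, hu] using! hf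
  · have := (hf.comp_sphereTranslate (finitePart u)).comp_sphereInv
    have e : f ∘ (coordAt u).symm = (f ∘ sphereTranslate (finitePart u)) ∘ sphereInv := by
      funext z
      simp only [Function.comp_apply]
      congr 1
      rw [Homeomorph.symm_apply_eq]
      simp only [coordAt, hu, if_false, Homeomorph.trans_apply]
      rw [← sphereTranslate_symm, Homeomorph.symm_apply_apply, sphereInv_sphereInv]
    rwa [e]

end HasRatPair

/-- At a finite point with finite image, `f` is given by a quotient of polynomials. -/
theorem IsRatPair.eventually_eq {f : RSphere → RSphere} {d : ℕ} {p q : ℂ[X]}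
    (h : IsRatPair f d p q) {z : ℂ} (hz : q.eval z ≠ 0) :
    ∀ᶠ w : ℂ in 𝓝 z, f w = ((p.eval w / q.eval w : ℂ) : RSphere) := by
  filter_upwards [q.continuous.continuousAt.eventually_ne hz] with w hw
  rw [h.apply_coe, homPoint_of_ne_zero _ hw]

theorem IsRatPair.analyticAt {q : ℂ[X]} (p : ℂ[X]) {z : ℂ} (hz : q.eval z ≠ 0) :
    AnalyticAt ℂ (fun w => p.eval w / q.eval w) z := by
  have h : ∀ r : ℂ[X], AnalyticAt ℂ (fun w => r.eval w) z := fun r =>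
    r.differentiable.analyticAt z
  exact (h p).div (h q) hz

/-- A constant quotient gives `p = v * q`. Without common zeros `q` is then a nonzero constant, and
both coefficients of degree `d ≥ 1` vanish. -/
theorem IsRatPair.not_eventually_const {f : RSphere → RSphere} {d : ℕ} {p q : ℂ[X]}
    (h : IsRatPair f d p q) (hd : 1 ≤ d) {z : ℂ} (hz : q.eval z ≠ 0) (v : ℂ) :
    ¬ ∀ᶠ w : ℂ in 𝓝 z, p.eval w / q.eval w = v := by
  intro hev
  have h1 : ∀ᶠ w : ℂ in 𝓝 z, (p - Polynomial.C v * q).eval w = 0 := by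
    filter_upwards [hev, q.continuous.continuousAt.eventually_ne hz] with w hw hqw
    rw [div_eq_iff hqw] at hw
    simp [hw]
  have h2 : p - Polynomial.C v * q = 0 :=
    eq_zero_of_infinite_isRoot _ (infinite_of_mem_nhds z h1)
  have hpq : p = Polynomial.C v * q := sub_eq_zero.1 h2
  have hq0 : ∀ w, q.eval w ≠ 0 := fun w hw => by
    have := h.eval_ne_zero w
    simp [hpq, hw] at this
  have hdeg : q.degree = 0 := by
    by_contra hne
    obtain ⟨w, hw⟩ := IsAlgClosed.exists_root q hne
    exact hq0 w hw
  have hqd : q.coeff d = 0 :=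
    coeff_eq_zero_of_natDegree_lt (by rw [natDegree_eq_zero_iff_degree_le_zero.2 hdeg.le]; omega)
  have := h.coeff_ne_zero
  simp [hpq, hqd] at this

namespace HasRatPair

variable {f : RSphere → RSphere} {d : ℕ}

/-- At finite points with finite image this is the open mapping theorem for a quotient of
polynomials; inversion in the target or in the source reduces the other cases to it. -/
theorem continuousAt_and_nhds_le (hf : HasRatPair f d) (hd : 1 ≤ d) (z : RSphere) :
    ContinuousAt f z ∧ 𝓝 (f z) ≤ Filter.map f (𝓝 z) := by
  have hfin : ∀ {f : RSphere → RSphere}, HasRatPair f d → ∀ z : ℂ, f z ≠ OnePoint.infty →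
      ContinuousAt f z ∧ 𝓝 (f z) ≤ Filter.map f (𝓝 (z : RSphere)) := by
    rintro f ⟨p, q, h⟩ z hz
    have hq : q.eval z ≠ 0 := fun hq => hz (by rw [h.apply_coe, hq, homPoint_zero])
    have hev := h.eventually_eq hq
    have han := IsRatPair.analyticAt p hq
    constructor
    · rw [OnePoint.continuousAt_coe]
      refine ContinuousAt.congr ?_ (hev.mono fun w hw => hw.symm)
      exact OnePoint.continuous_coe.continuousAt.comp han.continuousAt
    · have h1 := han.eventually_constant_or_nhds_le_map_nhds.resolve_left
        (h.not_eventually_const hd hq _)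
      rw [OnePoint.nhds_coe_eq, Filter.map_map, hev.self_of_nhds, OnePoint.nhds_coe_eq,
        Filter.map_congr (m₁ := f ∘ OnePoint.some)
          (m₂ := OnePoint.some ∘ fun w : ℂ => p.eval w / q.eval w) hev,
        ← Filter.map_map]
      exact Filter.map_mono h1
  have hfin' : ∀ {f : RSphere → RSphere}, HasRatPair f d → ∀ z : ℂ,
      ContinuousAt f z ∧ 𝓝 (f z) ≤ Filter.map f (𝓝 (z : RSphere)) := by
    intro f hf z
    by_cases hz : f z = OnePoint.infty
    · obtain ⟨h1, h2⟩ := hfin hf.sphereInv_comp z (by simp [hz])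
      have e : f = sphereInv ∘ (sphereInv ∘ f) := by funext z; simp
      constructor
      · rw [e]
        exact sphereInv.continuous.continuousAt.comp h1
      · have h3 := Filter.map_mono (m := sphereInv) h2
        rw [Filter.map_map, ← e, sphereInv.map_nhds_eq, Function.comp_apply,
          sphereInv_sphereInv] at h3
        exact h3
    · exact hfin hf z hz
  induction z using OnePoint.rec with
  | coe z => exact hfin' hf z
  | infty =>
    obtain ⟨h1, h2⟩ := hfin' hf.comp_sphereInv 0
    have e : f = (f ∘ sphereInv) ∘ sphereInv := by funext z; simp
    constructor
    · rw [e]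
      refine ContinuousAt.comp ?_ sphereInv.continuous.continuousAt
      rwa [sphereInv_infty]
    · rw [← Filter.map_map, sphereInv.map_nhds_eq, sphereInv_zero, Function.comp_apply,
        sphereInv_zero] at h2
      exact h2

theorem continuous (hf : HasRatPair f d) (hd : 1 ≤ d) : Continuous f :=
  continuous_iff_continuousAt.2 fun z => (hf.continuousAt_and_nhds_le hd z).1

theorem isOpenMap (hf : HasRatPair f d) (hd : 1 ≤ d) : IsOpenMap f :=
  IsOpenMap.of_nhds_le fun z => (hf.continuousAt_and_nhds_le hd z).2

theorem surjective (hf : HasRatPair f d) (hd : 1 ≤ d) : Function.Surjective f := by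
  have h1 : IsClopen (range f) := ⟨(isCompact_range (hf.continuous hd)).isClosed,
    (hf.isOpenMap hd).isOpen_range⟩
  exact range_eq_univ.1 (h1.eq_univ (range_nonempty f))

end HasRatPair

/-! ### Critical points -/

/-- A locally injective holomorphic function has nonzero derivative. -/
theorem AnalyticAt.deriv_ne_zero_of_injOn {F : ℂ → ℂ} {z : ℂ} (hF : AnalyticAt ℂ F z) {U : Set ℂ}
    (hU : U ∈ 𝓝 z) (hinj : InjOn F U) : deriv F z ≠ 0 := by
  intro hd0
  have hnc : ∀ V : Set ℂ, IsOpen V → V ⊆ U → ∀ w ∈ V, ¬ ∀ᶠ w' in 𝓝 w, F w' = F w := by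
    intro V hV hVU w hw hev
    have h1 : {w' | F w' = F w} ∩ V ∈ 𝓝 w := Filter.inter_mem hev (hV.mem_nhds hw)
    obtain ⟨w', hw', hne⟩ := (infinite_of_mem_nhds w h1).exists_notMem_finite (finite_singleton w)
    exact hne (hinj (hVU hw'.2) (hVU hw) hw'.1)
  have hpn : ∀ᶠ w in 𝓝[≠] z, deriv F w ≠ 0 := by
    refine hF.deriv.eventually_eq_zero_or_eventually_ne_zero.resolve_left fun hev => ?_
    obtain ⟨r, hr, hb⟩ := Metric.eventually_nhds_iff_ball.1
      (hev.and (hF.eventually_analyticAt.and hU))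
    refine hnc (Metric.ball z r) Metric.isOpen_ball (fun w hw => (hb w hw).2.2) z
      (Metric.mem_ball_self hr) ?_
    filter_upwards [Metric.ball_mem_nhds z hr] with w hw
    exact Metric.isOpen_ball.is_const_of_deriv_eq_zero (convex_ball z r).isPreconnected
      (fun v hv => (hb v hv).2.1.differentiableAt.differentiableWithinAt) (fun v hv => (hb v hv).1)
      hw (Metric.mem_ball_self hr)
  obtain ⟨r, hr, hb⟩ := Metric.eventually_nhds_iff_ball.1
    ((eventually_nhdsWithin_iff.1 hpn).and (hF.eventually_analyticAt.and hU))
  set B := Metric.ball z r with hB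
  have hBU : B ⊆ U := fun w hw => (hb w hw).2.2
  have hzB : z ∈ B := Metric.mem_ball_self hr
  have hBn : ∀ w ∈ B, B ∈ 𝓝 w := fun w hw => Metric.isOpen_ball.mem_nhds hw
  let g := Function.invFunOn F B
  have hg : ∀ w ∈ B, g (F w) = w := fun w hw => (hinj.mono hBU).leftInvOn_invFunOn hw
  have hop : ∀ w ∈ B, 𝓝 (F w) ≤ Filter.map F (𝓝 w) := fun w hw =>
    ((hb w hw).2.1.eventually_constant_or_nhds_le_map_nhds).resolve_left
      (hnc B Metric.isOpen_ball hBU w hw)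
  have hgc : ∀ w ∈ B, ContinuousAt g (F w) := fun w hw V hV => by
    rw [hg w hw] at hV
    refine hop w hw (Filter.mem_map.2 ?_)
    filter_upwards [hV, hBn w hw] with w' hw' hw'B
    rwa [mem_preimage, mem_preimage, hg w' hw'B]
  have hFg : ∀ w ∈ B, ∀ᶠ u in 𝓝 (F w), F (g u) = u := fun w hw => by
    refine hop w hw (Filter.mem_map.2 ?_)
    filter_upwards [hBn w hw] with w' hw'
    change F (g (F w')) = F w'
    rw [hg w' hw']
  -- The local inverse is continuous, and differentiable off `F z` because `deriv F` vanishes only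
  -- at `z`. The singularity at `F z` is therefore removable, and a differentiable inverse
  -- contradicts `deriv F z = 0`.
  have hgan : AnalyticAt ℂ g (F z) := by
    refine Complex.analyticAt_of_differentiable_on_punctured_nhds_of_continuousAt ?_ (hgc z hzB)
    rw [eventually_nhdsWithin_iff]
    refine hop z hzB (Filter.mem_map.2 ?_)
    filter_upwards [hBn z hzB] with w hw hne
    have hwz : w ≠ z := fun e => hne (by rw [e]; rfl)
    refine (HasDerivAt.of_local_left_inverse (f := F) (f' := deriv F w) (hgc w hw) ?_
      ((hb w hw).1 hwz) (hFg w hw)).differentiableAt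
    rw [hg w hw]
    exact (hb w hw).2.1.differentiableAt.hasDerivAt
  refine not_differentiableAt_of_local_left_inverse_hasDerivAt_zero (f := F) (g := g) (a := F z)
    ?_ (hFg z hzB) hgan.differentiableAt
  rw [hg z hzB, ← hd0]
  exact hF.differentiableAt.hasDerivAt

/-- In finite coordinates, a rational map has a nonzero derivative at noncritical points. -/
theorem HasRatPair.exists_hasStrictDerivAt {f : RSphere → RSphere} {d : ℕ} (hf : HasRatPair f d)
    {z : ℂ} (hz : f z ≠ OnePoint.infty) (hinj : ∃ U ∈ 𝓝 (z : RSphere), InjOn f U) :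
    ∃ (F : ℂ → ℂ) (F' : ℂ), F' ≠ 0 ∧ HasStrictDerivAt F F' z ∧
      ∀ᶠ w : ℂ in 𝓝 z, f w = (F w : RSphere) := by
  obtain ⟨p, q, h⟩ := hf
  have hq : q.eval z ≠ 0 := fun hq => hz (by rw [h.apply_coe, hq, homPoint_zero])
  have hev := h.eventually_eq hq
  have han := IsRatPair.analyticAt p hq
  obtain ⟨U, hU, hinj⟩ := hinj
  rw [OnePoint.nhds_coe_eq, Filter.mem_map] at hU
  refine ⟨_, _, ?_, han.hasStrictDerivAt, hev⟩
  refine han.deriv_ne_zero_of_injOn (Filter.inter_mem hU hev) fun w hw w' hw' e => ?_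
  refine OnePoint.coe_injective (hinj hw.1 hw'.1 ?_)
  rw [show f w = _ from hw.2, show f w' = _ from hw'.2]
  exact congrArg OnePoint.some e

/-- A degree count. The hypothesis on `q` says that `f` fixes `∞`, so `e = deg q < d = deg p` and
the Wronskian has degree at least `d - 1 + e`. If all its roots were zeros of `q`, it would have at
most `e` of them with multiplicity, contradicting `d ≥ 2`. -/
theorem IsRatPair.exists_root_wronskian {f : RSphere → RSphere} {d : ℕ} {p q : ℂ[X]}
    (h : IsRatPair f d p q) (hd : 2 ≤ d) (hqd : q.coeff d = 0) :
    ∃ a : ℂ, q.eval a ≠ 0 ∧ (derivative p * q - p * derivative q).eval a = 0 := by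
  by_contra! hcon
  set W := derivative p * q - p * derivative q with hW
  have hpd : p.coeff d ≠ 0 := h.coeff_ne_zero.resolve_right (by simpa using hqd)
  have hq0 : q ≠ 0 := by
    rintro rfl
    have hp : p.degree = 0 := by
      by_contra hne
      obtain ⟨w, hw⟩ := IsAlgClosed.exists_root p hne
      have := h.eval_ne_zero w
      simp [hw.eq_zero] at this
    exact hpd (coeff_eq_zero_of_natDegree_lt
      (by rw [natDegree_eq_zero_iff_degree_le_zero.2 hp.le]; omega))
  obtain ⟨k, rfl⟩ : ∃ k, d = k + 1 := ⟨d - 1, by omega⟩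
  set e := q.natDegree with he
  have hek : e < k + 1 := lt_of_le_of_ne h.natDegree_right fun e' =>
    hq0 (leadingCoeff_eq_zero.1 (by rw [leadingCoeff, ← he, e', hqd]))
  have hqe : q.coeff e ≠ 0 := by rw [he, coeff_natDegree]; exact leadingCoeff_ne_zero.2 hq0
  have hp' : (derivative p).natDegree ≤ k :=
    (natDegree_derivative_le p).trans (by have := h.natDegree_left; omega)
  have hcoeff : W.coeff (k + e) = ((k + 1 : ℂ) - e) * (p.coeff (k + 1) * q.coeff e) := by
    rw [hW, coeff_sub, coeff_mul_add_eq_of_natDegree_le hp' he.ge, coeff_derivative]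
    rcases Nat.eq_zero_or_pos e with h0 | hpos
    · have : derivative q = 0 := by
        rw [eq_C_of_natDegree_eq_zero (he.symm.trans h0), derivative_C]
      simp [this, h0]
      ring
    · obtain ⟨m, hm⟩ : ∃ m, e = m + 1 := ⟨e - 1, by omega⟩
      have hq' : (derivative q).natDegree ≤ m := (natDegree_derivative_le q).trans (by omega)
      rw [show k + e = (k + 1) + m by omega, coeff_mul_add_eq_of_natDegree_le h.natDegree_left hq',
        coeff_derivative, hm]
      push_cast
      ring
  have hWc : W.coeff (k + e) ≠ 0 := by
    rw [hcoeff]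
    refine mul_ne_zero (sub_ne_zero.2 fun hc => ?_) (mul_ne_zero hpd hqe)
    have : k + 1 = e := by exact_mod_cast hc
    omega
  have hW0 : W ≠ 0 := fun h0 => hWc (by rw [h0, coeff_zero])
  have hdegW : k + e ≤ W.natDegree := le_natDegree_of_ne_zero hWc
  -- At a zero of `q` of order `m`, where `p` does not vanish, divisibility of `W` by the `m`-th
  -- power would pass to `derivative q`, whose order there is only `m - 1`.
  have hroots : W.roots ≤ q.roots := by
    rw [Multiset.le_iff_count]
    intro a
    rw [count_roots, count_roots]
    by_cases hqa : q.eval a = 0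
    · by_contra! hlt
      set m := q.rootMultiplicity a with hm
      have hm0 : 0 < m := (rootMultiplicity_pos hq0).2 hqa
      have h1 : (X - Polynomial.C a) ^ m ∣ W :=
        (pow_dvd_pow _ hlt.le).trans (pow_rootMultiplicity_dvd W a)
      have h2 : (X - Polynomial.C a) ^ m ∣ p * derivative q := by
        have : p * derivative q = derivative p * q - W := by rw [hW]; ring
        rw [this]
        exact dvd_sub ((pow_rootMultiplicity_dvd q a).mul_left _) h1
      have h3 : IsCoprime ((X - Polynomial.C a) ^ m) p := by
        refine IsCoprime.pow_left ?_
        refine ((irreducible_X_sub_C a).coprime_iff_not_dvd).2 fun hdvd => ?_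
        have := h.eval_ne_zero a
        simp [hqa, (dvd_iff_isRoot.1 hdvd).eq_zero] at this
      have h4 := h3.dvd_of_dvd_mul_left h2
      have hq'0 : derivative q ≠ 0 := fun h0 => by
        have := derivative_eq_zero.1 h0
        rw [eq_C_of_natDegree_eq_zero this, eval_C] at hqa
        rw [eq_C_of_natDegree_eq_zero this, hqa, C_0] at hq0
        exact hq0 rfl
      have h5 := (le_rootMultiplicity_iff hq'0).2 h4
      rw [derivative_rootMultiplicity_of_root hqa] at h5
      omega
    · rw [rootMultiplicity_eq_zero (p := W) (x := a) (hcon a hqa)]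
      exact Nat.zero_le _
  have hcard := Multiset.card_le_card hroots
  rw [IsAlgClosed.card_roots_eq_natDegree] at hcard
  have := q.card_roots'
  omega

theorem isCriticalPoint_homeomorph_iff {f : RSphere → RSphere} (κ κ' : RSphere ≃ₜ RSphere)
    {c : RSphere} : IsCriticalPoint (κ' ∘ f ∘ κ.symm) (κ c) ↔ IsCriticalPoint f c := by
  refine not_congr ⟨?_, ?_⟩
  · rintro ⟨U, hU, hinj⟩
    refine ⟨κ ⁻¹' U, κ.continuous.continuousAt.preimage_mem_nhds hU, fun x hx y hy e => ?_⟩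
    exact κ.injective (hinj hx hy (by simp [e]))
  · rintro ⟨U, hU, hinj⟩
    refine ⟨κ '' U, κ.isOpenMap.image_mem_nhds hU, ?_⟩
    rintro _ ⟨x, hx, rfl⟩ _ ⟨y, hy, rfl⟩ e
    rw [hinj hx hy (by simpa using e)]

/-- A rational map of degree at least `2` has at least two critical values. -/
theorem HasRatPair.exists_isCriticalPoint {f : RSphere → RSphere} {d : ℕ} (hf : HasRatPair f d)
    (hd : 2 ≤ d) (v : RSphere) : ∃ c, IsCriticalPoint f c ∧ f c ≠ v := by
  obtain ⟨u, hu⟩ := hf.surjective (by omega) v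
  -- In coordinates sending the preimage `u` and the value `v` to `∞`, a value different from `v` is
  -- a finite one. A root of the Wronskian off the zeros of `q` is then the required critical point.
  obtain ⟨p, q, h⟩ := (hf.coordAt_comp v).comp_coordAt_symm u
  have hinf : (coordAt u).symm OnePoint.infty = u := by
    rw [Homeomorph.symm_apply_eq, coordAt_self]
  have hqd : q.coeff d = 0 := by
    have := h.apply_infty
    rw [Function.comp_apply, hinf, Function.comp_apply, hu, coordAt_self] at this
    exact homPoint_eq_infty_iff.1 this.symm
  obtain ⟨a, hqa, hWa⟩ := h.exists_root_wronskian hd hqd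
  refine ⟨(coordAt u).symm a, ?_, fun e => ?_⟩
  · rw [← isCriticalPoint_homeomorph_iff (coordAt u) (coordAt v), Homeomorph.apply_symm_apply]
    rintro ⟨U, hU, hinj⟩
    have hev := h.eventually_eq hqa
    rw [OnePoint.nhds_coe_eq, Filter.mem_map] at hU
    refine (IsRatPair.analyticAt p hqa).deriv_ne_zero_of_injOn (Filter.inter_mem hU hev)
      (fun w hw w' hw' e => ?_) ?_
    · refine OnePoint.coe_injective (hinj hw.1 hw'.1 ?_)
      have h1 := hw.2
      have h2 := hw'.2
      simp only [mem_ofPred_eq, Function.comp_apply] at h1 h2 ⊢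
      rw [h1, h2]
      exact congrArg OnePoint.some e
    · refine ((p.hasDerivAt a).div (q.hasDerivAt a) hqa).deriv.trans ?_
      simp only [eval_sub, eval_mul] at hWa
      rw [hWa, zero_div]
  · have := h.apply_coe a
    rw [Function.comp_apply, Function.comp_apply, e, coordAt_self] at this
    exact hqa (homPoint_eq_infty_iff.1 this.symm)

theorem nontrivial_postcriticalSet {f : RSphere → RSphere} {d : ℕ} (hf : HasRatPair f d)
    (hd : 2 ≤ d) : (postcriticalSet f).Nontrivial := by
  obtain ⟨c, hc, -⟩ := hf.exists_isCriticalPoint hd OnePoint.infty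
  obtain ⟨c', hc', hne⟩ := hf.exists_isCriticalPoint hd (f c)
  exact ⟨f c', ⟨c', hc', 1, le_rfl, rfl⟩, f c, ⟨c, hc, 1, le_rfl, rfl⟩, hne⟩

/-! ### Subarcs of a Jordan curve -/

namespace IsOrientedJordanCurve

variable {C : Set RSphere} {γ : UnitAddCircle → RSphere}

theorem apply_add_one (t : ℝ) : γ ((t + 1 : ℝ) : UnitAddCircle) = γ (t : UnitAddCircle) := by
  rw [coe_add_one]

/-- The parameter interval between two consecutive points of a closed subset of the curve. -/
theorem exists_Ioo (h : IsOrientedJordanCurve C γ) {W : Set RSphere} (hW : IsClosed W)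
    (hWC : W ⊆ C) (hne : W.Nonempty) {t₀ : ℝ} (ht₀ : γ (t₀ : UnitAddCircle) ∉ W) :
    ∃ a b : ℝ, t₀ ∈ Ioo a b ∧ b ≤ a + 1 ∧ γ (a : UnitAddCircle) ∈ W ∧ γ (b : UnitAddCircle) ∈ W ∧
      ∀ t ∈ Ioo a b, γ (t : UnitAddCircle) ∉ W := by
  set T : Set ℝ := (fun t : ℝ => γ t) ⁻¹' W with hT
  have hTc : IsClosed T := hW.preimage h.continuous_lift
  obtain ⟨w, hw⟩ := hne
  obtain ⟨s, hs, hsw⟩ := h.exists_eq t₀ (hWC hw)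
  have hsT : s ∈ T := by rw [hT, mem_preimage, hsw]; exact hw
  have hs1T : s - 1 ∈ T := by
    rw [hT, mem_preimage, ← apply_add_one (γ := γ) (s - 1), sub_add_cancel, hsw]
    exact hw
  set a := sSup (T ∩ Iic t₀) with ha
  set b := sInf (T ∩ Ici t₀) with hb
  have hbdA : BddAbove (T ∩ Iic t₀) := ⟨t₀, fun t ht => ht.2⟩
  have hbdB : BddBelow (T ∩ Ici t₀) := ⟨t₀, fun t ht => ht.2⟩
  have haT : a ∈ T ∩ Iic t₀ := (hTc.inter isClosed_Iic).csSup_mem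
    ⟨s - 1, hs1T, by have := hs.2; simp only [mem_Iic]; linarith⟩ hbdA
  have hbT : b ∈ T ∩ Ici t₀ := (hTc.inter isClosed_Ici).csInf_mem ⟨s, hsT, hs.1⟩ hbdB
  have hat : a < t₀ := lt_of_le_of_ne haT.2 fun e => ht₀ (e ▸ haT.1)
  have hbt : t₀ < b := lt_of_le_of_ne hbT.2 fun e => ht₀ (e ▸ hbT.1)
  have ha1 : a + 1 ∈ T := by
    rw [hT, mem_preimage, apply_add_one (γ := γ) a]
    exact haT.1
  refine ⟨a, b, ⟨hat, hbt⟩, ?_, haT.1, hbT.1, fun t ht htW => ?_⟩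
  · refine csInf_le hbdB ⟨ha1, ?_⟩
    by_contra hlt
    have := le_csSup hbdA (⟨ha1, le_of_lt (by simpa using hlt)⟩ : a + 1 ∈ T ∩ Iic t₀)
    linarith
  · rcases le_total t t₀ with hle | hle
    · exact absurd (le_csSup hbdA ⟨htW, hle⟩) (not_le.2 ht.1)
    · exact absurd (csInf_le hbdB ⟨htW, hle⟩) (not_le.2 ht.2)

theorem lt_add_one_of_nontrivial (h : IsOrientedJordanCurve C γ) {W : Set RSphere}
    (hWC : W ⊆ C) (hW : W.Nontrivial) {a b : ℝ} (hba : b ≤ a + 1)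
    (hab : ∀ t ∈ Ioo a b, γ (t : UnitAddCircle) ∉ W) : b < a + 1 := by
  refine lt_of_le_of_ne hba fun e => ?_
  have : ∀ w ∈ W, w = γ (a : UnitAddCircle) := fun w hw => by
    obtain ⟨t, ht, rfl⟩ := h.exists_eq a (hWC hw)
    rcases ht.1.eq_or_lt with rfl | hlt
    · rfl
    · exact absurd hw (hab t ⟨hlt, e ▸ ht.2⟩)
  obtain ⟨w, hw, w', hw', hne⟩ := hW
  exact hne ((this w hw).trans (this w' hw').symm)

/-- The two closed arcs into which the points at `a` and `b` divide the curve meet only at these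
points of `W`, so a connected set avoiding `W` stays in one of them. -/
theorem subset_image_Ioo (h : IsOrientedJordanCurve C γ) {W : Set RSphere} {a b t₀ : ℝ}
    (ht₀ : t₀ ∈ Ioo a b) (hba : b ≤ a + 1) (ha : γ (a : UnitAddCircle) ∈ W)
    (hb : γ (b : UnitAddCircle) ∈ W) {s : Set RSphere} (hs : IsPreconnected s) (hsC : s ⊆ C \ W)
    (hts : γ (t₀ : UnitAddCircle) ∈ s) : s ⊆ (fun t : ℝ => γ t) '' Ioo a b := by
  have hab : a ≤ b := (ht₀.1.trans ht₀.2).le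
  have hu := h.image_Icc_union hab hba
  have hi := h.image_Icc_inter (a := a) (b := b)
  have hnot : ∀ z ∈ s, z ∉ (fun t : ℝ => γ t) '' Icc b (a + 1) := by
    intro z hz hzB
    obtain ⟨w, hw, hw'⟩ := isPreconnected_closed_iff.1 hs _ _
      (isClosed_image_lift h.continuous a b) (isClosed_image_lift h.continuous b (a + 1))
      (fun z hz => hu ▸ (hsC hz).1) ⟨_, hts, ⟨t₀, Ioo_subset_Icc_self ht₀, rfl⟩⟩ ⟨z, hz, hzB⟩
    rcases hi hw' with e | e
    · exact (hsC hw).2 (e ▸ ha)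
    · exact (hsC hw).2 (e ▸ hb)
  intro z hz
  have hzC : z ∈ (fun t : ℝ => γ t) '' Icc a b ∪ (fun t : ℝ => γ t) '' Icc b (a + 1) :=
    hu ▸ (hsC hz).1
  obtain ⟨t, ht, rfl⟩ := hzC.resolve_right (hnot z hz)
  refine ⟨t, ⟨lt_of_le_of_ne ht.1 fun e => (hsC hz).2 (e ▸ ha),
    lt_of_le_of_ne ht.2 fun e => (hsC hz).2 (e ▸ hb)⟩, rfl⟩

theorem connectedComponentIn_eq_image_Ioo (h : IsOrientedJordanCurve C γ) {W : Set RSphere}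
    {a b t₀ : ℝ} (ht₀ : t₀ ∈ Ioo a b) (hba : b ≤ a + 1) (ha : γ (a : UnitAddCircle) ∈ W)
    (hb : γ (b : UnitAddCircle) ∈ W) (hab : ∀ t ∈ Ioo a b, γ (t : UnitAddCircle) ∉ W) :
    connectedComponentIn (C \ W) (γ (t₀ : UnitAddCircle)) = (fun t : ℝ => γ t) '' Ioo a b := by
  apply Subset.antisymm
  · exact h.subset_image_Ioo ht₀ hba ha hb isPreconnected_connectedComponentIn
      (connectedComponentIn_subset _ _) (mem_connectedComponentIn ⟨h.mem _, hab _ ht₀⟩)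
  · refine (isPreconnected_Ioo.image _ h.continuous_lift.continuousOn).subset_connectedComponentIn
      ⟨t₀, ht₀, rfl⟩ ?_
    rintro _ ⟨t, ht, rfl⟩
    exact ⟨h.mem _, hab t ht⟩

theorem closure_image_Ioo (h : IsOrientedJordanCurve C γ) {a b : ℝ} (hab : a < b) :
    closure ((fun t : ℝ => γ t) '' Ioo a b) = (fun t : ℝ => γ t) '' Icc a b := by
  apply Subset.antisymm
  · exact closure_minimal (image_mono Ioo_subset_Icc_self) (isClosed_image_lift h.continuous a b)
  · rw [← closure_Ioo hab.ne]
    exact image_closure_subset_closure_image h.continuous_lift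

/-- Continuous coordinate along a subarc. -/
theorem exists_continuous_param (h : IsOrientedJordanCurve C γ) {c e : ℝ} (hec : e - c < 1)
    {a b : ℝ} (hab : a ≤ b) {y : ℝ → RSphere} (hy : Continuous y)
    (hm : ∀ t ∈ Icc a b, y t ∈ (fun t : ℝ => γ t) '' Icc c e) :
    ∃ θ : ℝ → ℝ, Continuous θ ∧ (∀ t ∈ Icc a b, θ t ∈ Icc c e) ∧
      ∀ t ∈ Icc a b, γ (θ t : UnitAddCircle) = y t := by
  have hemb : IsClosedEmbedding (fun t : Icc c e => γ ((t : ℝ) : UnitAddCircle)) :=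
    (h.continuous_lift.comp continuous_subtype_val).isClosedEmbedding
      (injOn_iff_injective.1 (h.injOn_lift hec))
  have hex : ∀ t : Icc a b, ∃ s : Icc c e, γ ((s : ℝ) : UnitAddCircle) = y t := fun t => by
    obtain ⟨s, hs, hst⟩ := hm t t.2
    exact ⟨⟨s, hs⟩, hst⟩
  choose θ₀ hθ₀ using hex
  have hc : Continuous θ₀ := by
    rw [hemb.isEmbedding.isInducing.continuous_iff]
    have : (fun t : Icc c e => γ ((t : ℝ) : UnitAddCircle)) ∘ θ₀ = fun t : Icc a b => y t := funext hθ₀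
    rw [this]
    exact hy.comp continuous_subtype_val
  refine ⟨fun t => θ₀ (projIcc a b hab t), by fun_prop, fun t ht => ?_, fun t ht => ?_⟩
  · exact (θ₀ (projIcc a b hab t)).2
  · simp only [hθ₀, projIcc_of_mem hab ht]

end IsOrientedJordanCurve

/-! ### Monotone parameter changes and orientations of subarcs. -/

/-- Equal values at two points produce an interior local extremum between them, as in Rolle's
theorem. Near it `θ` is injective, hence strictly monotone, which excludes an extremum. -/
theorem injOn_Icc_of_locally_injective {θ : ℝ → ℝ} {a b : ℝ} (hθ : ContinuousOn θ (Icc a b))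
    (hloc : ∀ t ∈ Ioo a b, ∃ U ∈ 𝓝 t, InjOn θ U) : InjOn θ (Icc a b) := by
  have key : ∀ s ∈ Icc a b, ∀ t ∈ Icc a b, s < t → θ s ≠ θ t := by
    intro s hs t ht hst e
    obtain ⟨r, hr, hext⟩ := exists_isLocalExtr_Ioo hst (hθ.mono (Icc_subset_Icc hs.1 ht.2)) e
    have hrab : r ∈ Ioo a b := ⟨hs.1.trans_lt hr.1, hr.2.trans_le ht.2⟩
    obtain ⟨U, hU, hinj⟩ := hloc r hrab
    obtain ⟨V, hV, hVe⟩ : ∃ V ∈ 𝓝 r, (∀ u ∈ V, θ r ≤ θ u) ∨ ∀ u ∈ V, θ u ≤ θ r :=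
      hext.elim (fun h => ⟨_, h, Or.inl fun u hu => hu⟩) fun h => ⟨_, h, Or.inr fun u hu => hu⟩
    obtain ⟨δ, hδ, hδU⟩ := Metric.mem_nhds_iff.1 (Filter.inter_mem hU
      (Filter.inter_mem (Ioo_mem_nhds hrab.1 hrab.2) hV))
    have hsub : Icc (r - δ / 2) (r + δ / 2) ⊆ Metric.ball r δ := fun u hu => by
      rw [Metric.mem_ball, Real.dist_eq, abs_lt]
      constructor <;> linarith [hu.1, hu.2]
    have hl : r - δ / 2 ∈ Icc (r - δ / 2) (r + δ / 2) := ⟨le_rfl, by linarith⟩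
    have hm : r ∈ Icc (r - δ / 2) (r + δ / 2) := ⟨by linarith, by linarith⟩
    have hh : r + δ / 2 ∈ Icc (r - δ / 2) (r + δ / 2) := ⟨by linarith, le_rfl⟩
    have hmono := ContinuousOn.strictMonoOn_of_injOn_Icc' (a := r - δ / 2) (b := r + δ / 2)
      (by linarith) (hθ.mono fun u hu => Ioo_subset_Icc_self (hδU (hsub hu)).2.1)
      (hinj.mono fun u hu => (hδU (hsub hu)).1)
    have hlV := (hδU (hsub hl)).2.2
    have hhV := (hδU (hsub hh)).2.2
    have hlr : r - δ / 2 < r := by linarith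
    have hrh : r < r + δ / 2 := by linarith
    rcases hmono with hmono | hmono <;> rcases hVe with hVe | hVe
    · exact (hmono hl hm hlr).not_ge (hVe _ hlV)
    · exact (hmono hm hh hrh).not_ge (hVe _ hhV)
    · exact (hmono hm hh hrh).not_ge (hVe _ hhV)
    · exact (hmono hl hm hlr).not_ge (hVe _ hlV)
  intro s hs t ht e
  rcases lt_trichotomy s t with hlt | rfl | hlt
  · exact absurd e (key s hs t ht hlt)
  · rfl
  · exact absurd e.symm (key t ht s hs hlt)

/-- A strictly increasing path in the line from `a` to `b`. -/
structure IsIncreasingPath (a b : ℝ) (τ : I → ℝ) : Prop where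
  continuous : Continuous τ
  strictMono : StrictMono τ
  map_zero : τ 0 = a
  map_one : τ 1 = b

namespace IsIncreasingPath

variable {a b : ℝ} {τ : I → ℝ}

theorem mem_Icc (h : IsIncreasingPath a b τ) (s : I) : τ s ∈ Icc a b :=
  ⟨h.map_zero ▸ h.strictMono.monotone s.2.1, h.map_one ▸ h.strictMono.monotone s.2.2⟩

theorem range_eq (h : IsIncreasingPath a b τ) : range τ = Icc a b := by
  apply Subset.antisymm
  · rintro _ ⟨s, rfl⟩
    exact h.mem_Icc s
  · intro t ht
    rw [← h.map_zero, ← h.map_one] at ht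
    obtain ⟨s, -, hs⟩ := intermediate_value_Icc (zero_le_one : (0 : I) ≤ 1) h.continuous.continuousOn ht
    exact ⟨s, hs⟩

end IsIncreasingPath

theorem exists_isIncreasingPath {a b : ℝ} (hab : a < b) : ∃ τ, IsIncreasingPath a b τ := by
  refine ⟨fun s => a + (b - a) * s, by fun_prop, fun s t hst => ?_, by simp, by simp⟩
  have h1 : (s : ℝ) < t := hst
  have h2 : 0 < b - a := by linarith
  change a + (b - a) * s < a + (b - a) * t
  nlinarith

theorem mem_curveOrientation_iff {C : Set RSphere} {γ : UnitAddCircle → RSphere}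
    (h : IsOrientedJordanCurve C γ) {a b : ℝ} (hab : a < b) (hba : b - a < 1) {α : I → RSphere} :
    α ∈ curveOrientation γ ((fun t : ℝ => γ t) '' Icc a b) ↔
      ∃ τ, IsIncreasingPath a b τ ∧ ∀ s, α s = γ (τ s : UnitAddCircle) := by
  constructor
  · rintro ⟨hα, τ₀, hτc, hτm, hτ⟩
    have hex : ∀ s, ∃ n : ℤ, τ₀ s - n ∈ Icc a b := fun s => by
      have : α s ∈ (fun t : ℝ => γ t) '' Icc a b := hα.range_eq ▸ mem_range_self s
      obtain ⟨t, ht, hts⟩ := this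
      obtain ⟨n, hn⟩ := h.eq_iff.1 ((hτ s).symm.trans hts.symm)
      exact ⟨n, by rw [hn, add_sub_cancel_right]; exact ht⟩
    obtain ⟨n, hn⟩ := hex 0
    -- The lift stays in the integer translates of `[a, b]`. As `b < a + 1` there are gaps between
    -- them, and a continuous path that left its translate would take a value `u` in a gap.
    have hmem : ∀ s, τ₀ s - n ∈ Icc a b := fun s => by
      have hle : τ₀ 0 ≤ τ₀ s := hτm.monotone s.2.1
      refine ⟨by linarith [hn.1], ?_⟩
      by_contra! hlt
      obtain ⟨u, hu1, hu2⟩ : ∃ u, b < u ∧ u < min (τ₀ s - n) (a + 1) :=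
        exists_between (lt_min hlt (by linarith))
      have hu3 := hu2.trans_le (min_le_left _ _)
      have hu4 := hu2.trans_le (min_le_right _ _)
      obtain ⟨r, -, hr⟩ := intermediate_value_Icc (show (0 : I) ≤ s from s.2.1) hτc.continuousOn
        (show u + n ∈ Icc (τ₀ 0) (τ₀ s) from ⟨by linarith [hn.2], by linarith⟩)
      obtain ⟨m, hm⟩ := hex r
      rw [hr] at hm
      have h1 : (0 : ℝ) < ((m - n : ℤ) : ℝ) := by push_cast; linarith [hm.2]
      have h2 : ((m - n : ℤ) : ℝ) < 1 := by push_cast; linarith [hm.1]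
      have := int_eq_zero_of_abs_lt_one (n := m - n) (by linarith) h2
      rw [this] at h1
      simp at h1
    have hval : ∀ s, α s = γ ((τ₀ s - n : ℝ) : UnitAddCircle) := fun s => by
      rw [hτ s, h.eq_iff]
      exact ⟨n, by ring⟩
    have hend : ∀ t ∈ Icc a b, ∃ s, τ₀ s - n = t := fun t ht => by
      have : γ (t : UnitAddCircle) ∈ range α := hα.range_eq ▸ ⟨t, ht, rfl⟩
      obtain ⟨s, hs⟩ := this
      exact ⟨s, h.injOn_lift hba (hmem s) ht ((hval s).symm.trans hs)⟩
    refine ⟨fun s => τ₀ s - n, ⟨by fun_prop, fun s t hst => sub_lt_sub_right (hτm hst) _, ?_, ?_⟩,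
      hval⟩
    · obtain ⟨s, hs⟩ := hend a ⟨le_rfl, hab.le⟩
      have : τ₀ 0 ≤ τ₀ s := hτm.monotone s.2.1
      exact le_antisymm (by linarith) (hmem 0).1
    · obtain ⟨s, hs⟩ := hend b ⟨hab.le, le_rfl⟩
      have : τ₀ s ≤ τ₀ 1 := hτm.monotone s.2.2
      exact le_antisymm (hmem 1).2 (by linarith)
  · rintro ⟨τ, hτ, hα⟩
    obtain rfl : α = fun s => γ (τ s : UnitAddCircle) := funext hα
    refine ⟨⟨h.continuous_lift.comp hτ.continuous, fun s t hst => ?_, ?_⟩, τ, hτ.continuous,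
      hτ.strictMono, fun _ => rfl⟩
    · exact hτ.strictMono.injective (h.injOn_lift hba (hτ.mem_Icc s) (hτ.mem_Icc t) hst)
    · rw [← hτ.range_eq, ← range_comp]
      rfl

/-- A continuous strictly increasing bijection of intervals has an inverse of the same kind. -/
theorem exists_inverse_of_strictMonoOn {θ : ℝ → ℝ} {a b : ℝ} (hab : a ≤ b)
    (hθ : ContinuousOn θ (Icc a b)) (hm : StrictMonoOn θ (Icc a b)) :
    ∃ ϑ : ℝ → ℝ, ContinuousOn ϑ (Icc (θ a) (θ b)) ∧ StrictMonoOn ϑ (Icc (θ a) (θ b)) ∧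
      ϑ (θ a) = a ∧ ϑ (θ b) = b ∧ ∀ s ∈ Icc (θ a) (θ b), θ (ϑ s) = s := by
  have ha : a ∈ Icc a b := ⟨le_rfl, hab⟩
  have hb : b ∈ Icc a b := ⟨hab, le_rfl⟩
  have hsurj : SurjOn θ (Icc a b) (Icc (θ a) (θ b)) := intermediate_value_Icc hab hθ
  let ϑ := Function.invFunOn θ (Icc a b)
  have h1 : ∀ s ∈ Icc (θ a) (θ b), θ (ϑ s) = s := fun s hs => Function.invFunOn_eq (hsurj hs)
  have h2 : ∀ s ∈ Icc (θ a) (θ b), ϑ s ∈ Icc a b := fun s hs => Function.invFunOn_mem (hsurj hs)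
  have h3 : ∀ t ∈ Icc a b, ϑ (θ t) = t := fun t ht => hm.injOn.leftInvOn_invFunOn ht
  have hmaps : ∀ t ∈ Icc a b, θ t ∈ Icc (θ a) (θ b) := fun t ht =>
    ⟨hm.monotoneOn ha ht ht.1, hm.monotoneOn ht hb ht.2⟩
  have hmono : StrictMonoOn ϑ (Icc (θ a) (θ b)) := fun s hs t ht hst => by
    rw [← hm.lt_iff_lt (h2 s hs) (h2 t ht), h1 s hs, h1 t ht]
    exact hst
  refine ⟨ϑ, ?_, hmono, h3 a ha, h3 b hb, h1⟩
  let e : Icc (θ a) (θ b) → Icc a b := fun s => ⟨ϑ s, h2 s s.2⟩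
  have he : StrictMono e := fun s t hst => hmono s.2 t.2 hst
  have hes : Function.Surjective e := fun t => ⟨⟨θ t, hmaps t t.2⟩, Subtype.ext (h3 t t.2)⟩
  have hec : Continuous e := (he.orderIsoOfSurjective e hes).continuous
  rw [continuousOn_iff_continuous_domRestrict]
  exact continuous_subtype_val.comp hec

/-! ### Elementary deformations and orientations -/

/-- The standing assumptions on a rational map, an oriented Jordan curve through its postcritical
points and an elementary deformation of this curve. -/
structure IsDeformationSetting (f : RSphere → RSphere) (d : ℕ) (C : Set RSphere)
    (γ : UnitAddCircle → RSphere) (H : RSphere × I → RSphere) : Prop where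
  rat : HasRatPair f d
  two_le : 2 ≤ d
  finite : (postcriticalSet f).Finite
  curve : IsOrientedJordanCurve C γ
  post_subset : postcriticalSet f ⊆ C
  deformation : IsElementaryDeformation f C H

/-- A coordinate of `f ∘ H₁` along an arc of the curve between consecutive points that are deformed
to `1`-vertices. -/
structure IsEdgeChart (f : RSphere → RSphere) (C : Set RSphere) (γ : UnitAddCircle → RSphere)
    (H : RSphere × I → RSphere) (a b : ℝ) (θ : ℝ → ℝ) : Prop where
  lt : a < b
  sub_lt : b - a < 1
  left_mem : γ (a : UnitAddCircle) ∈ vertexPreimages f C H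
  right_mem : γ (b : UnitAddCircle) ∈ vertexPreimages f C H
  notMem : ∀ t ∈ Ioo a b, γ (t : UnitAddCircle) ∉ vertexPreimages f C H
  continuous : Continuous θ
  eq : ∀ t ∈ Icc a b, γ (θ t : UnitAddCircle) = f (endMap H (γ (t : UnitAddCircle)))
  abs_lt : |θ b - θ a| < 1
  mono : StrictMonoOn θ (Icc a b) ∨ StrictAntiOn θ (Icc a b)

namespace IsDeformationSetting

variable {f : RSphere → RSphere} {d : ℕ} {C : Set RSphere} {γ : UnitAddCircle → RSphere}
  {H : RSphere × I → RSphere}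

theorem continuous_map (S : IsDeformationSetting f d C γ H) : Continuous f :=
  S.rat.continuous (by have := S.two_le; omega)

theorem isOpenMap_map (S : IsDeformationSetting f d C γ H) : IsOpenMap f :=
  S.rat.isOpenMap (by have := S.two_le; omega)

theorem surjective_map (S : IsDeformationSetting f d C γ H) : Function.Surjective f :=
  S.rat.surjective (by have := S.two_le; omega)

theorem continuous_endMap (S : IsDeformationSetting f d C γ H) : Continuous (endMap H) :=
  S.deformation.pseudoIsotopy.continuous.comp (by fun_prop : Continuous fun x => (x, (1 : I)))

theorem post_nontrivial (S : IsDeformationSetting f d C γ H) : (postcriticalSet f).Nontrivial :=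
  nontrivial_postcriticalSet S.rat S.two_le

theorem map_mem_post {x : RSphere} (hx : x ∈ postcriticalSet f) : f x ∈ postcriticalSet f := by
  obtain ⟨c, hc, n, hn, rfl⟩ := hx
  exact ⟨c, hc, n + 1, by omega, Function.iterate_succ_apply' f n c⟩

theorem endMap_post (S : IsDeformationSetting f d C γ H) {x : RSphere}
    (hx : x ∈ postcriticalSet f) : endMap H x = x :=
  S.deformation.pseudoIsotopy.rel x hx 1

theorem post_subset_vertexPreimages (S : IsDeformationSetting f d C γ H) :
    postcriticalSet f ⊆ vertexPreimages f C H := fun x hx =>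
  ⟨by rw [mem_preimage, S.endMap_post hx]; exact map_mem_post hx, S.post_subset hx⟩

theorem vertexPreimages_subset : vertexPreimages f C H ⊆ C := inter_subset_right

theorem map_endMap_mem (S : IsDeformationSetting f d C γ H) {z : RSphere} (hz : z ∈ C) :
    f (endMap H z) ∈ C := by
  have : endMap H z ∈ f ⁻¹' C := S.deformation.image_eq ▸ mem_image_of_mem _ hz
  exact this

theorem map_endMap_mem_post_iff {z : RSphere} (hz : z ∈ C) :
    f (endMap H z) ∈ postcriticalSet f ↔ z ∈ vertexPreimages f C H :=
  ⟨fun h => ⟨h, hz⟩, fun h => h.1⟩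

theorem injOn_endMap (S : IsDeformationSetting f d C γ H) :
    InjOn (endMap H) (C \ vertexPreimages f C H) := by
  obtain ⟨e, he⟩ := S.deformation.homeo
  intro x hx y hy hxy
  have : e ⟨x, hx⟩ = e ⟨y, hy⟩ := Subtype.ext (by rw [he, he]; exact hxy)
  exact congrArg Subtype.val (e.injective this)

theorem exists_injOn {z : RSphere} (hz : f z ∉ postcriticalSet f) : ∃ U ∈ 𝓝 z, InjOn f U := by
  by_contra h
  exact hz ⟨z, h, 1, le_rfl, rfl⟩

theorem exists_isEdgeChart (S : IsDeformationSetting f d C γ H) {t₀ : ℝ}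
    (ht₀ : γ (t₀ : UnitAddCircle) ∉ vertexPreimages f C H) :
    ∃ a b θ, t₀ ∈ Ioo a b ∧ IsEdgeChart f C γ H a b θ := by
  have hJ := S.curve
  obtain ⟨a, b, hab, hba, ha, hb, hW⟩ := hJ.exists_Ioo S.deformation.finite.isClosed
    vertexPreimages_subset (S.post_nontrivial.nonempty.mono S.post_subset_vertexPreimages) ht₀
  have hlt : a < b := hab.1.trans hab.2
  let y : ℝ → RSphere := fun t => f (endMap H (γ t))
  have hyc : Continuous y := S.continuous_map.comp (S.continuous_endMap.comp hJ.continuous_lift)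
  have hyC : ∀ t, y t ∈ C := fun t => S.map_endMap_mem (hJ.mem _)
  have hyp : ∀ t ∈ Ioo a b, y t ∉ postcriticalSet f := fun t ht h =>
    hW t ht ((map_endMap_mem_post_iff (hJ.mem _)).1 h)
  obtain ⟨s₀, -, hs₀⟩ := hJ.exists_eq 0 (hyC t₀)
  obtain ⟨c, e, hce, hec, hc, he, hP⟩ := hJ.exists_Ioo S.finite.isClosed S.post_subset
    S.post_nontrivial.nonempty (t₀ := s₀) (by rw [hs₀]; exact hyp t₀ hab)
  have hec1 : e < c + 1 := hJ.lt_add_one_of_nontrivial S.post_subset S.post_nontrivial hec hP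
  -- The open arc has a connected image avoiding the postcritical set, so the image stays between
  -- two consecutive postcritical points and has a real coordinate `θ`.
  have hyI : y '' Ioo a b ⊆ (fun t : ℝ => γ t) '' Ioo c e := by
    refine hJ.subset_image_Ioo hce hec hc he (isPreconnected_Ioo.image _ hyc.continuousOn) ?_
      ⟨t₀, hab, hs₀.symm⟩
    rintro _ ⟨t, ht, rfl⟩
    exact ⟨hyC t, hyp t ht⟩
  have hyI' : ∀ t ∈ Icc a b, y t ∈ (fun t : ℝ => γ t) '' Icc c e := by
    intro t ht
    rw [← closure_Ioo hlt.ne] at ht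
    rw [← hJ.closure_image_Ioo (hce.1.trans hce.2)]
    exact closure_mono hyI (image_closure_subset_closure_image hyc ⟨t, ht, rfl⟩)
  obtain ⟨θ, hθc, hθm, hθ⟩ := hJ.exists_continuous_param (by linarith) hlt.le hyc hyI'
  -- Local injectivity: `H₁` is injective off the vertex preimages, and `f` is locally injective
  -- wherever its value is not postcritical.
  have hinj : InjOn θ (Icc a b) := by
    refine injOn_Icc_of_locally_injective hθc.continuousOn fun t ht => ?_
    obtain ⟨U, hU, hUi⟩ := exists_injOn (hyp t ht)
    refine ⟨(fun t : ℝ => endMap H (γ t)) ⁻¹' U ∩ Ioo a b, Filter.inter_mem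
      ((S.continuous_endMap.comp hJ.continuous_lift).continuousAt.preimage_mem_nhds hU)
      (Ioo_mem_nhds ht.1 ht.2), fun r hr s hs hrs => ?_⟩
    have h1 : y r = y s := by
      rw [← hθ r (Ioo_subset_Icc_self hr.2), ← hθ s (Ioo_subset_Icc_self hs.2), hrs]
    have h2 := S.injOn_endMap ⟨hJ.mem _, hW r hr.2⟩ ⟨hJ.mem _, hW s hs.2⟩ (hUi hr.1 hs.1 h1)
    obtain ⟨n, hn⟩ := hJ.eq_iff.1 h2
    have := int_eq_zero_of_abs_lt_one (n := n) (by linarith [hr.2.1, hr.2.2, hs.2.1, hs.2.2])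
      (by linarith [hr.2.1, hr.2.2, hs.2.1, hs.2.2])
    simpa [this] using hn
  have haI : a ∈ Icc a b := ⟨le_rfl, hlt.le⟩
  have hbI : b ∈ Icc a b := ⟨hlt.le, le_rfl⟩
  refine ⟨a, b, θ, hab, hlt, ?_, ha, hb, hW, hθc, hθ, ?_,
    hθc.continuousOn.strictMonoOn_of_injOn_Icc' hlt.le hinj⟩
  -- A full period would give equal values of `θ` at the two ends.
  · have : b ≠ a + 1 := fun h => by
      have h1 : γ (θ b : UnitAddCircle) = γ (θ a : UnitAddCircle) := by
        rw [hθ b hbI, hθ a haI, h]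
        simp only [y, coe_add_one]
      have h2 := hinj hbI haI (hJ.injOn_lift (by linarith) (hθm b hbI) (hθm a haI) h1)
      linarith
    have := lt_of_le_of_ne hba this
    linarith
  · have h1 := hθm a haI
    have h2 := hθm b hbI
    rw [abs_lt]
    constructor <;> linarith [h1.1, h1.2, h2.1, h2.2]

end IsDeformationSetting

namespace IsEdgeChart

variable {f : RSphere → RSphere} {d : ℕ} {C : Set RSphere} {γ : UnitAddCircle → RSphere}
  {H : RSphere × I → RSphere} {a b : ℝ} {θ : ℝ → ℝ}

theorem left_mem_Icc (h : IsEdgeChart f C γ H a b θ) : a ∈ Icc a b := ⟨le_rfl, h.lt.le⟩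

theorem right_mem_Icc (h : IsEdgeChart f C γ H a b θ) : b ∈ Icc a b := ⟨h.lt.le, le_rfl⟩

theorem injOn (h : IsEdgeChart f C γ H a b θ) : InjOn θ (Icc a b) :=
  h.mono.elim StrictMonoOn.injOn StrictAntiOn.injOn

theorem image_eq (h : IsEdgeChart f C γ H a b θ) : θ '' Icc a b = uIcc (θ a) (θ b) := by
  apply Subset.antisymm
  · rintro _ ⟨t, ht, rfl⟩
    rcases h.mono with hm | hm
    · exact Icc_subset_uIcc ⟨hm.monotoneOn h.left_mem_Icc ht ht.1,
        hm.monotoneOn ht h.right_mem_Icc ht.2⟩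
    · exact Icc_subset_uIcc' ⟨hm.antitoneOn ht h.right_mem_Icc ht.2,
        hm.antitoneOn h.left_mem_Icc ht ht.1⟩
  · have := intermediate_value_uIcc (a := a) (b := b) h.continuous.continuousOn
    rwa [uIcc_of_le h.lt.le] at this

theorem min_lt_max (h : IsEdgeChart f C γ H a b θ) : min (θ a) (θ b) < max (θ a) (θ b) := by
  exact _root_.min_lt_max.2 fun e => h.lt.ne (h.injOn h.left_mem_Icc h.right_mem_Icc e)

theorem max_sub_min_lt (h : IsEdgeChart f C γ H a b θ) :
    max (θ a) (θ b) - min (θ a) (θ b) < 1 := by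
  rw [max_sub_min_eq_abs]
  exact h.abs_lt

theorem map_image (h : IsEdgeChart f C γ H a b θ) :
    f '' (endMap H '' ((fun t : ℝ => γ t) '' Icc a b)) =
      (fun t : ℝ => γ t) '' Icc (min (θ a) (θ b)) (max (θ a) (θ b)) := by
  rw [image_image, image_image, show Icc (min (θ a) (θ b)) (max (θ a) (θ b)) = uIcc (θ a) (θ b) from
    rfl, ← h.image_eq, image_image]
  exact image_congr fun t ht => (h.eq t ht).symm

theorem injOn_map (h : IsEdgeChart f C γ H a b θ) (hJ : IsOrientedJordanCurve C γ) :
    InjOn f (endMap H '' ((fun t : ℝ => γ t) '' Icc a b)) := by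
  rintro _ ⟨_, ⟨s, hs, rfl⟩, rfl⟩ _ ⟨_, ⟨t, ht, rfl⟩, rfl⟩ e
  rw [← h.eq s hs, ← h.eq t ht] at e
  have hs' : θ s ∈ uIcc (θ a) (θ b) := h.image_eq ▸ mem_image_of_mem _ hs
  have ht' : θ t ∈ uIcc (θ a) (θ b) := h.image_eq ▸ mem_image_of_mem _ ht
  rw [h.injOn hs ht (hJ.injOn_lift h.max_sub_min_lt hs' ht' e)]

/-- The comparison of the two orientations of a `1`-edge, up to a reparametrization `ρ`. -/
theorem mem_pushOrientation_iff (h : IsEdgeChart f C γ H a b θ) (hJ : IsOrientedJordanCurve C γ)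
    (hHc : Continuous (endMap H)) {ρ : I → I} (hρc : Continuous ρ) (hρ : ∀ s, ρ (ρ s) = s)
    (h1 : ∀ τ, IsIncreasingPath a b τ →
      IsIncreasingPath (min (θ a) (θ b)) (max (θ a) (θ b)) fun s => θ (τ (ρ s)))
    (h2 : ∀ τ', IsIncreasingPath (min (θ a) (θ b)) (max (θ a) (θ b)) τ' →
      ∃ τ, IsIncreasingPath a b τ ∧ ∀ s, θ (τ s) = τ' (ρ s)) {β : I → RSphere} :
    β ∈ pushOrientation γ (endMap H) ((fun t : ℝ => γ t) '' Icc a b) ↔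
      β ∘ ρ ∈ pullOrientation γ f (endMap H '' ((fun t : ℝ => γ t) '' Icc a b)) := by
  have hρs : Function.Surjective ρ := fun s => ⟨ρ s, hρ s⟩
  constructor
  · rintro ⟨α, hα, rfl⟩
    obtain ⟨τ, hτ, hατ⟩ := (mem_curveOrientation_iff hJ h.lt h.sub_lt).1 hα
    have hfβ : f ∘ ((endMap H ∘ α) ∘ ρ) ∈
        curveOrientation γ (f '' (endMap H '' ((fun t : ℝ => γ t) '' Icc a b))) := by
      rw [h.map_image, mem_curveOrientation_iff hJ h.min_lt_max h.max_sub_min_lt]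
      refine ⟨_, h1 τ hτ, fun s => ?_⟩
      simp only [Function.comp_apply]
      rw [h.eq _ (hτ.mem_Icc _), hατ]
    refine ⟨⟨(hHc.comp hα.1.continuous).comp hρc, Function.Injective.of_comp hfβ.1.injective, ?_⟩,
      hfβ⟩
    rw [hρs.range_comp, range_comp, hα.1.range_eq]
  · rintro ⟨hβ, hfβ⟩
    rw [h.map_image, mem_curveOrientation_iff hJ h.min_lt_max h.max_sub_min_lt] at hfβ
    obtain ⟨τ', hτ', hfτ'⟩ := hfβ
    obtain ⟨τ, hτ, hττ'⟩ := h2 τ' hτ'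
    refine ⟨fun s => γ (τ s : UnitAddCircle), (mem_curveOrientation_iff hJ h.lt h.sub_lt).2
      ⟨τ, hτ, fun _ => rfl⟩, funext fun s => ?_⟩
    -- Since `f` is injective on the edge, `β` is determined by `f ∘ β`.
    refine h.injOn_map hJ ?_ ⟨_, ⟨τ s, hτ.mem_Icc s, rfl⟩, rfl⟩ ?_
    · rw [← hβ.range_eq, hρs.range_comp]
      exact mem_range_self s
    · have := hfτ' (ρ s)
      simp only [Function.comp_apply, hρ] at this ⊢
      rw [this, ← hττ' s, h.eq _ (hτ.mem_Icc s)]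

theorem pushOrientation_eq_of_strictMonoOn (h : IsEdgeChart f C γ H a b θ)
    (hJ : IsOrientedJordanCurve C γ) (hHc : Continuous (endMap H))
    (hm : StrictMonoOn θ (Icc a b)) :
    pushOrientation γ (endMap H) ((fun t : ℝ => γ t) '' Icc a b) =
      pullOrientation γ f (endMap H '' ((fun t : ℝ => γ t) '' Icc a b)) := by
  ext β
  have hlt : θ a < θ b := hm h.left_mem_Icc h.right_mem_Icc h.lt
  refine h.mem_pushOrientation_iff hJ hHc continuous_id (fun _ => rfl) ?_ ?_
  · intro τ hτ
    rw [min_eq_left hlt.le, max_eq_right hlt.le]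
    exact ⟨h.continuous.comp hτ.continuous, fun s t hst => hm (hτ.mem_Icc s) (hτ.mem_Icc t)
      (hτ.strictMono hst), by simp [hτ.map_zero], by simp [hτ.map_one]⟩
  · intro τ' hτ'
    rw [min_eq_left hlt.le, max_eq_right hlt.le] at hτ'
    obtain ⟨ϑ, hϑc, hϑm, hϑa, hϑb, hϑ⟩ :=
      exists_inverse_of_strictMonoOn h.lt.le h.continuous.continuousOn hm
    exact ⟨fun s => ϑ (τ' s), ⟨hϑc.comp_continuous hτ'.continuous hτ'.mem_Icc,
      fun s t hst => hϑm (hτ'.mem_Icc s) (hτ'.mem_Icc t) (hτ'.strictMono hst),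
      by rw [hτ'.map_zero, hϑa], by rw [hτ'.map_one, hϑb]⟩, fun s => hϑ _ (hτ'.mem_Icc s)⟩

theorem pushOrientation_eq_of_strictAntiOn (h : IsEdgeChart f C γ H a b θ)
    (hJ : IsOrientedJordanCurve C γ) (hHc : Continuous (endMap H))
    (hm : StrictAntiOn θ (Icc a b)) :
    pushOrientation γ (endMap H) ((fun t : ℝ => γ t) '' Icc a b) = oppositeOrientation
      (pullOrientation γ f (endMap H '' ((fun t : ℝ => γ t) '' Icc a b))) := by
  ext β
  have hlt : θ b < θ a := hm h.left_mem_Icc h.right_mem_Icc h.lt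
  refine h.mem_pushOrientation_iff hJ hHc unitInterval.continuous_symm unitInterval.symm_symm ?_ ?_
  · intro τ hτ
    rw [min_eq_right hlt.le, max_eq_left hlt.le]
    exact ⟨h.continuous.comp (hτ.continuous.comp unitInterval.continuous_symm),
      fun s t hst => hm (hτ.mem_Icc _) (hτ.mem_Icc _)
      (hτ.strictMono (unitInterval.strictAnti_symm hst)), by simp [hτ.map_one],
      by simp [hτ.map_zero]⟩
  · intro τ' hτ'
    rw [min_eq_right hlt.le, max_eq_left hlt.le] at hτ'
    -- The inversion lemma concerns increasing functions, so it is applied to `-θ`.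
    obtain ⟨ϑ, hϑc, hϑm, hϑa, hϑb, hϑ⟩ := exists_inverse_of_strictMonoOn (θ := fun t => - θ t)
      h.lt.le h.continuous.neg.continuousOn fun s hs t ht hst => neg_lt_neg (hm hs ht hst)
    have hmem : ∀ s, - τ' s ∈ Icc (- θ a) (- θ b) := fun s =>
      ⟨neg_le_neg (hτ'.mem_Icc s).2, neg_le_neg (hτ'.mem_Icc s).1⟩
    refine ⟨fun s => ϑ (- τ' (unitInterval.symm s)), ⟨hϑc.comp_continuous
      (hτ'.continuous.comp unitInterval.continuous_symm).neg fun s => hmem _,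
      fun s t hst => hϑm (hmem _) (hmem _)
        (neg_lt_neg (hτ'.strictMono (unitInterval.strictAnti_symm hst))),
      by simp [hτ'.map_one, hϑa], by simp [hτ'.map_zero, hϑb]⟩, fun s => ?_⟩
    have := hϑ _ (hmem (unitInterval.symm s))
    linarith

theorem pushOrientation_nonempty (h : IsEdgeChart f C γ H a b θ) (hJ : IsOrientedJordanCurve C γ) :
    (pushOrientation γ (endMap H) ((fun t : ℝ => γ t) '' Icc a b)).Nonempty := by
  obtain ⟨τ, hτ⟩ := exists_isIncreasingPath h.lt
  exact ⟨_, _, (mem_curveOrientation_iff hJ h.lt h.sub_lt).2 ⟨τ, hτ, fun _ => rfl⟩, rfl⟩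

end IsEdgeChart

/-- If `f ∘ β` ran in the direction of `γ` both forwards and backwards, the difference of the two
lifts, one of them reversed, would be continuous, strictly increasing and integer-valued. -/
theorem ne_oppositeOrientation_pullOrientation {C : Set RSphere} {γ : UnitAddCircle → RSphere}
    (hJ : IsOrientedJordanCurve C γ) {f : RSphere → RSphere} {E : Set RSphere}
    (hne : (pullOrientation γ f E).Nonempty) :
    pullOrientation γ f E ≠ oppositeOrientation (pullOrientation γ f E) := by
  intro e
  obtain ⟨β, hβ⟩ := hne
  have hβ' : β ∘ unitInterval.symm ∈ pullOrientation γ f E := by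
    rw [e] at hβ
    exact hβ
  obtain ⟨-, -, τ, hτc, hτm, hτ⟩ := hβ
  obtain ⟨-, -, τ', hτ'c, hτ'm, hτ'⟩ := hβ'
  have hint : ∀ s, ∃ n : ℤ, τ s - τ' (unitInterval.symm s) = n := fun s => by
    have h1 := hτ s
    have h2 := hτ' (unitInterval.symm s)
    simp only [Function.comp_apply, unitInterval.symm_symm] at h1 h2
    obtain ⟨n, hn⟩ := hJ.eq_iff.1 (h1.symm.trans h2)
    exact ⟨n, by rw [hn]; ring⟩
  have hmono : StrictMono fun s => τ s - τ' (unitInterval.symm s) := fun s t hst =>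
    sub_lt_sub (hτm hst) (hτ'm (unitInterval.strictAnti_symm hst))
  have hcont : Continuous fun s => τ s - τ' (unitInterval.symm s) :=
    hτc.sub (hτ'c.comp unitInterval.continuous_symm)
  have h01 : (0 : I) < 1 := zero_lt_one
  obtain ⟨n, hn⟩ := hint 0
  obtain ⟨u, hu0, hu⟩ := exists_between (lt_min (hmono h01)
    (lt_add_one (τ 0 - τ' (unitInterval.symm 0))))
  obtain ⟨s, -, hs⟩ := intermediate_value_Icc h01.le hcont.continuousOn
    ⟨hu0.le, (hu.trans_le (min_le_left _ _)).le⟩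
  obtain ⟨m, hm⟩ := hint s
  have hu1 := hu.trans_le (min_le_right _ _)
  simp only at hs hu0
  rw [← hs, hm, hn] at hu0 hu1
  have h1 : n < m := by exact_mod_cast hu0
  have h2 : m < n + 1 := by exact_mod_cast hu1
  omega

namespace IsDeformationSetting

variable {f : RSphere → RSphere} {d : ℕ} {C : Set RSphere} {γ : UnitAddCircle → RSphere}
  {H : RSphere × I → RSphere}

theorem exists_isEdgeChart_of_isDeformedArc (S : IsDeformationSetting f d C γ H) {A : Set RSphere}
    (hA : IsDeformedArc f C H A) :
    ∃ a b θ, IsEdgeChart f C γ H a b θ ∧ A = (fun t : ℝ => γ t) '' Icc a b := by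
  obtain ⟨_, ⟨x, hx, rfl⟩, rfl⟩ := hA
  obtain ⟨t, -, rfl⟩ := S.curve.exists_eq 0 hx.1
  obtain ⟨a, b, θ, ht, h⟩ := S.exists_isEdgeChart hx.2
  refine ⟨a, b, θ, h, ?_⟩
  rw [S.curve.connectedComponentIn_eq_image_Ioo ht (by linarith [h.sub_lt]) h.left_mem h.right_mem
    h.notMem, S.curve.closure_image_Ioo h.lt]

theorem isDeformedArc (S : IsDeformationSetting f d C γ H) {a b : ℝ} {θ : ℝ → ℝ}
    (h : IsEdgeChart f C γ H a b θ) : IsDeformedArc f C H ((fun t : ℝ => γ t) '' Icc a b) := by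
  obtain ⟨t, ht⟩ := exists_between h.lt
  refine ⟨_, ⟨_, ⟨S.curve.mem _, h.notMem t ht⟩, rfl⟩, ?_⟩
  rw [S.curve.connectedComponentIn_eq_image_Ioo ht (by linarith [h.sub_lt]) h.left_mem h.right_mem
    h.notMem, S.curve.closure_image_Ioo h.lt]

/-- The deformation maps the arcs of the curve to `1`-edges. -/
theorem isOneEdge_image (S : IsDeformationSetting f d C γ H) {A : Set RSphere}
    (hA : IsDeformedArc f C H A) : IsOneEdge f C (endMap H '' A) := by
  obtain ⟨_, ⟨x, hx, rfl⟩, rfl⟩ := hA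
  obtain ⟨e, he⟩ := S.deformation.homeo
  refine ⟨_, ⟨e ⟨x, hx⟩, (e ⟨x, hx⟩).2, rfl⟩, ?_⟩
  have h1 : connectedComponentIn (f ⁻¹' C \ oneVertices f) (e ⟨x, hx⟩ : RSphere) =
      endMap H '' connectedComponentIn (C \ vertexPreimages f C H) x := by
    rw [connectedComponentIn_eq_image (e ⟨x, hx⟩).2, connectedComponentIn_eq_image hx, image_image]
    have h2 : e '' connectedComponent ⟨x, hx⟩ = connectedComponent (e ⟨x, hx⟩) := by
      have := e.image_connectedComponentIn (mem_univ (⟨x, hx⟩ : ↥(C \ vertexPreimages f C H)))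
      simpa [connectedComponentIn_univ, e.surjective.range_eq] using this
    rw [Subtype.coe_eta, ← h2, image_image]
    exact image_congr fun z _ => he z
  rw [h1]
  exact image_closure_of_isCompact isClosed_closure.isCompact S.continuous_endMap.continuousOn

end IsDeformationSetting

/-! ### Crossing a curve -/

/-- The ratio is `1` when both of its points are `P`. By compactness, an arc that avoids `P`
contributes little to the variation for points near `P`. -/
theorem eventually_norm_ratio_sub_one_le {c : UnitAddCircle → RSphere} (hc : Continuous c) {P : ℂ}
    {a b : ℝ} (hP : ∀ t ∈ Icc a b, c (t : UnitAddCircle) ≠ P) :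
    ∀ᶠ p : ℂ × ℂ in 𝓝 (P, P), ∀ t ∈ Icc a b, ‖ratio (c (t : UnitAddCircle)) p.1 p.2 - 1‖ ≤ 1 / 2 := by
  refine isCompact_Icc.eventually_forall_of_forall_eventually fun t ht => ?_
  have h1 : ContinuousAt (fun z : (ℂ × ℂ) × ℝ =>
      ‖ratio (c (z.2 : UnitAddCircle)) z.1.1 z.1.2 - 1‖) ((P, P), t) := by
    refine ContinuousAt.norm (ContinuousAt.sub ?_ continuousAt_const)
    refine ContinuousAt.comp (f := fun z : (ℂ × ℂ) × ℝ => (c (z.2 : UnitAddCircle), z.1.1, z.1.2))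
      (g := fun p : RSphere × ℂ × ℂ => ratio p.1 p.2.1 p.2.2) (continuousAt_ratio (hP t ht)) ?_
    exact ((continuous_loop_lift hc).comp continuous_snd).continuousAt.prodMk (by fun_prop)
  have h2 : ratio (c (t : UnitAddCircle)) P P = 1 := by
    have := ratio_mul_ratio (x := P) (y := P) (v := P) (hP t ht)
    exact mul_right_cancel₀ (ratio_ne_zero (hP t ht) (hP t ht)) (by rw [this, one_mul])
  have h3 : ∀ᶠ z : (ℂ × ℂ) × ℝ in 𝓝 ((P, P), t),
      ‖ratio (c (z.2 : UnitAddCircle)) z.1.1 z.1.2 - 1‖ < 1 / 2 :=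
    h1.eventually_lt_const (by simp [h2])
  exact h3.mono fun z hz => hz.le

/-- Holomorphic maps with nonzero derivative almost preserve the ratios of small differences. -/
theorem HasStrictDerivAt.exists_ball_norm_ratio_le {F : ℂ → ℂ} {F' P : ℂ}
    (hF : HasStrictDerivAt F F' P) (hF' : F' ≠ 0) :
    ∃ ρ > 0, ∀ z ∈ Metric.ball P ρ, ∀ u ∈ Metric.ball P ρ, ∀ v ∈ Metric.ball P ρ,
      z ≠ u → z ≠ v →
      ‖(F z - F u) / (F z - F v) * ((z - u) / (z - v))⁻¹ - 1‖ ≤ 1 / 2 := by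
  have hn : 0 < ‖F'‖ := norm_pos_iff.2 hF'
  -- Relative errors of `1 / 8` suffice: `(1 / 8 + 1 / 8) / (7 / 8) ≤ 1 / 2`.
  have h1 := hF.hasStrictFDerivAt.isLittleO.def (c := ‖F'‖ / 8) (by positivity)
  rw [nhds_prod_eq, Filter.eventually_prod_self_iff'] at h1
  obtain ⟨t, ht, h2⟩ := h1
  obtain ⟨ρ, hρ, hb⟩ := Metric.mem_nhds_iff.1 ht
  refine ⟨ρ, hρ, fun z hz u hu v hv hzu hzv => ?_⟩
  have key : ∀ w ∈ Metric.ball P ρ, z ≠ w →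
      ∃ e : ℂ, ‖e‖ ≤ 1 / 8 ∧ F z - F w = F' * (z - w) * (1 + e) := by
    intro w hw hzw
    have h3 := h2 z (hb hz) w (hb hw)
    have hzw' : z - w ≠ 0 := sub_ne_zero.2 hzw
    refine ⟨(F z - F w - (z - w) * F') / (F' * (z - w)), ?_, ?_⟩
    · rw [norm_div, norm_mul, div_le_iff₀ (by positivity)]
      simp only [ContinuousLinearMap.toSpanSingleton_apply, smul_eq_mul] at h3
      linarith
    · field_simp
      ring
  obtain ⟨e₁, he₁, h₁⟩ := key u hu hzu
  obtain ⟨e₂, he₂, h₂⟩ := key v hv hzv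
  have hzu' : z - u ≠ 0 := sub_ne_zero.2 hzu
  have hzv' : z - v ≠ 0 := sub_ne_zero.2 hzv
  have hlow : 7 / 8 ≤ ‖1 + e₂‖ := by
    have := norm_sub_norm_le (1 : ℂ) (-e₂)
    rw [norm_neg, norm_one, sub_neg_eq_add] at this
    linarith
  have he₂0 : 1 + e₂ ≠ 0 := norm_pos_iff.1 (by linarith)
  have : (F z - F u) / (F z - F v) * ((z - u) / (z - v))⁻¹ - 1 = (e₁ - e₂) / (1 + e₂) := by
    rw [h₁, h₂]
    field_simp
    ring
  rw [this, norm_div, div_le_iff₀ (by linarith)]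
  have := norm_sub_le e₁ e₂
  linarith

/-- Near a simple point, a holomorphic map with nonzero derivative that carries a subarc of `c₁` to a
subarc of `c` preserves the winding up to the sign of the parameter change. -/
theorem exists_nhds_loopVar_eq {c₁ c : UnitAddCircle → RSphere} (hc₁ : Continuous c₁)
    (hc : Continuous c) {F : ℂ → ℂ} {F' P : ℂ} (hF : HasStrictDerivAt F F' P) (hF' : F' ≠ 0)
    {t₀ a b : ℝ} (ht₀ : t₀ ∈ Ioo a b) {θ : ℝ → ℝ} (hθ : Continuous θ) {ε : ℂ}
    (hε : StrictMonoOn θ (Icc a b) ∧ ε = 1 ∨ StrictAntiOn θ (Icc a b) ∧ ε = -1)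
    (hP : ∀ t : ℝ, c₁ (t : UnitAddCircle) = P ↔ ∃ n : ℤ, t = t₀ + n)
    (hFP : ∀ t : ℝ, c (t : UnitAddCircle) = F P ↔ ∃ n : ℤ, t = θ t₀ + n)
    (hcF : ∀ᶠ t : ℝ in 𝓝 t₀, ∀ w : ℂ, c₁ (t : UnitAddCircle) = w → c (θ t : UnitAddCircle) = F w) :
    ∃ N ∈ 𝓝 P, ∀ u ∈ N, ∀ v ∈ N, (u : RSphere) ∉ range c₁ → (v : RSphere) ∉ range c₁ →
      (F u : RSphere) ∉ range c → (F v : RSphere) ∉ range c →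
      loopVar c₁ u v = ε * loopVar c (F u) (F v) := by
  obtain ⟨ρ, hρ, hball⟩ := hF.exists_ball_norm_ratio_le hF'
  have hc₁t₀ : c₁ (t₀ : UnitAddCircle) = P := (hP t₀).2 ⟨0, by simp⟩
  have hopen : ((↑) '' Metric.ball P ρ : Set RSphere) ∈ 𝓝 (c₁ (t₀ : UnitAddCircle)) := by
    rw [hc₁t₀]
    exact OnePoint.isOpenMap_coe.image_mem_nhds (Metric.ball_mem_nhds P hρ)
  have hθt : ∀ᶠ t in 𝓝 t₀, |θ t - θ t₀| < 1 / 2 := by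
    have := Metric.tendsto_nhds.1 (hθ.tendsto t₀) (1 / 2) (by norm_num)
    simpa [Real.dist_eq] using this
  obtain ⟨δ', hδ', hδb⟩ := Metric.eventually_nhds_iff_ball.1 (hcF.and (hθt.and
    (((continuous_loop_lift hc₁).continuousAt.eventually hopen).and (Ioo_mem_nhds ht₀.1 ht₀.2))))
  obtain ⟨δ, hδ, hδ1, hδ2⟩ : ∃ δ : ℝ, 0 < δ ∧ δ < δ' ∧ δ < 1 / 2 :=
    ⟨min δ' (1 / 2) / 2, by positivity, by
      have := min_le_left δ' (1 / 2); linarith, by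
      have := min_le_right δ' (1 / 2); linarith⟩
  set l := t₀ - δ with hl
  set r := t₀ + δ with hr
  have hlr : l ≤ r := by rw [hl, hr]; linarith
  have hsub : ∀ t ∈ Icc l r, t ∈ Metric.ball t₀ δ' := fun t ht => by
    rw [Metric.mem_ball, Real.dist_eq, abs_lt]
    constructor <;> linarith [ht.1, ht.2]
  have hlI : l ∈ Icc l r := ⟨le_rfl, hlr⟩
  have hrI : r ∈ Icc l r := ⟨hlr, le_rfl⟩
  have ht₀I : t₀ ∈ Icc l r := ⟨by linarith, by linarith⟩
  have hIab : Icc l r ⊆ Icc a b := fun t ht => Ioo_subset_Icc_self (hδb t (hsub t ht)).2.2.2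
  have habs : ∀ t ∈ Icc l r, |θ t - θ t₀| < 1 / 2 := fun t ht => (hδb t (hsub t ht)).2.1
  have hrest₁ := eventually_norm_ratio_sub_one_le hc₁ (P := P) (a := r) (b := l + 1)
    fun t ht e => by
      obtain ⟨n, hn⟩ := (hP t).1 e
      have h1 : (0 : ℝ) < n := by linarith [ht.1]
      have h2 : (n : ℝ) < 1 := by linarith [ht.2]
      have := int_eq_zero_of_abs_lt_one (n := n) (by linarith) h2
      rw [this] at h1
      simp at h1
  have hFc : ContinuousAt (fun p : ℂ × ℂ => (F p.1, F p.2)) (P, P) := by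
    have h1 : ContinuousAt F P := hF.hasDerivAt.continuousAt
    exact (ContinuousAt.comp (f := Prod.fst) (x := ((P, P) : ℂ × ℂ)) h1 continuousAt_fst).prodMk
      (ContinuousAt.comp (f := Prod.snd) (x := ((P, P) : ℂ × ℂ)) h1 continuousAt_snd)
  set l' := min (θ l) (θ r) with hl'
  set r' := max (θ l) (θ r) with hr'
  have hlt' : l' < θ t₀ ∧ θ t₀ < r' := by
    rcases hε with ⟨hm, -⟩ | ⟨hm, -⟩
    · exact ⟨(min_le_left _ _).trans_lt (hm (hIab hlI) (hIab ht₀I) (by linarith)),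
        (hm (hIab ht₀I) (hIab hrI) (by linarith)).trans_le (le_max_right _ _)⟩
    · exact ⟨(min_le_right _ _).trans_lt (hm (hIab ht₀I) (hIab hrI) (by linarith)),
        (hm (hIab hlI) (hIab ht₀I) (by linarith)).trans_le (le_max_left _ _)⟩
  have hl'b : θ t₀ - 1 / 2 < l' := lt_min (by have := abs_lt.1 (habs l hlI); linarith)
    (by have := abs_lt.1 (habs r hrI); linarith)
  have hr'b : r' < θ t₀ + 1 / 2 := max_lt (by have := abs_lt.1 (habs l hlI); linarith)
    (by have := abs_lt.1 (habs r hrI); linarith)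
  have hrest := eventually_norm_ratio_sub_one_le hc (P := F P) (a := r') (b := l' + 1)
    fun t ht e => by
      obtain ⟨n, hn⟩ := (hFP t).1 e
      have h1 : (0 : ℝ) < n := by linarith [ht.1]
      have h2 : (n : ℝ) < 1 := by linarith [ht.2]
      have := int_eq_zero_of_abs_lt_one (n := n) (by linarith) h2
      rw [this] at h1
      simp at h1
  have hev := (hrest₁.and (hFc.eventually hrest))
  rw [nhds_prod_eq, Filter.eventually_prod_self_iff'] at hev
  obtain ⟨N, hN, hNe⟩ := hev
  refine ⟨N ∩ Metric.ball P ρ, Filter.inter_mem hN (Metric.ball_mem_nhds P hρ), ?_⟩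
  rintro u ⟨huN, huB⟩ v ⟨hvN, hvB⟩ hu hv hFu hFv
  obtain ⟨hR₁, hR⟩ := hNe u huN v hvN
  have hφ₁ := continuous_ratio_loop (x := u) hc₁ hv
  have hφ₁0 := ratio_loop_ne_zero hu hv
  have hφ := continuous_ratio_loop (x := F u) hc hFv
  have hφ0 := ratio_loop_ne_zero hFu hFv
  obtain ⟨g₁, -, -, hg₁⟩ := exists_global_isLogVar hφ₁ hφ₁0
  obtain ⟨g, -, -, hg⟩ := exists_global_isLogVar hφ hφ0
  -- Each loop is cut into a short arc through the crossing point and the rest. The rests contribute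
  -- at most `3 / 2` each.
  have hA₁ : loopVar c₁ u v = (g₁ r - g₁ l) + (g₁ (l + 1) - g₁ r) := by
    rw [(isLogVar_loopVar_period hc₁ hu hv l).unique (hg₁ l (l + 1))]
    ring
  have hA : loopVar c (F u) (F v) = (g r' - g l') + (g (l' + 1) - g r') := by
    rw [(isLogVar_loopVar_period hc hFu hFv l').unique (hg l' (l' + 1))]
    ring
  have hB₁ : ‖g₁ (l + 1) - g₁ r‖ ≤ 3 * (1 / 2) :=
    (hg₁ r (l + 1)).norm_le le_rfl fun t ht => by
      rw [uIcc_of_le (by linarith)] at ht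
      exact hR₁ t ht
  have hB : ‖g (l' + 1) - g r'‖ ≤ 3 * (1 / 2) :=
    (hg r' (l' + 1)).norm_le le_rfl fun t ht => by
      rw [uIcc_of_le (by linarith)] at ht
      exact hR t ht
  have hmaps : MapsTo θ (uIcc l r) (uIcc (θ l) (θ r)) := by
    rw [uIcc_of_le hlr]
    intro t ht
    rcases hε with ⟨hm, -⟩ | ⟨hm, -⟩
    · exact Icc_subset_uIcc ⟨hm.monotoneOn (hIab hlI) (hIab ht) ht.1,
        hm.monotoneOn (hIab ht) (hIab hrI) ht.2⟩
    · exact Icc_subset_uIcc' ⟨hm.antitoneOn (hIab ht) (hIab hrI) ht.2,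
        hm.antitoneOn (hIab hlI) (hIab ht) ht.1⟩
  -- On the short arcs `F` carries one loop to the other and almost preserves the ratio, so the two
  -- variations differ by at most `3 / 2`.
  have hD : ‖(g (θ r) - g (θ l)) + -(g₁ r - g₁ l)‖ ≤ 3 * (1 / 2) := by
    refine (((hg (θ l) (θ r)).comp hθ.continuousOn hmaps).mul (hg₁ l r).inv).norm_le le_rfl
      fun t ht => ?_
    rw [uIcc_of_le hlr] at ht
    obtain ⟨z, hz, hzt⟩ := (hδb t (hsub t ht)).2.2.1
    have h1 := (hδb t (hsub t ht)).1 z hzt.symm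
    rw [h1, ← hzt, ratio_coe, ratio_coe]
    exact hball z hz u huB v hvB (fun e => hu ⟨t, by rw [← hzt, e]⟩)
      (fun e => hv ⟨t, by rw [← hzt, e]⟩)
  have hM : g (θ r) - g (θ l) = ε * (g r' - g l') := by
    rcases hε with ⟨hm, rfl⟩ | ⟨hm, rfl⟩
    · have : θ l < θ r := hm (hIab hlI) (hIab hrI) (by linarith)
      rw [hl', hr', min_eq_left this.le, max_eq_right this.le]
      ring
    · have : θ r < θ l := hm (hIab hlI) (hIab hrI) (by linarith)
      rw [hl', hr', min_eq_right this.le, max_eq_left this.le]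
      ring
  have hεn : ‖ε‖ = 1 := by
    rcases hε with ⟨-, rfl⟩ | ⟨-, rfl⟩ <;> simp
  have hexp : Complex.exp (loopVar c₁ u v - ε * loopVar c (F u) (F v)) = 1 := by
    rw [Complex.exp_sub, exp_loopVar hc₁ hu hv]
    rcases hε with ⟨-, rfl⟩ | ⟨-, rfl⟩
    · rw [one_mul, exp_loopVar hc hFu hFv, div_one]
    · rw [neg_one_mul, Complex.exp_neg, exp_loopVar hc hFu hFv, inv_one, div_one]
  -- The three errors add up to at most `9 / 2 < 2π`, while the difference is a period of `exp`.
  refine sub_eq_zero.1 (eq_zero_of_exp_eq_one hexp ?_)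
  have heq : loopVar c₁ u v - ε * loopVar c (F u) (F v) =
      -((g (θ r) - g (θ l)) + -(g₁ r - g₁ l)) + (g₁ (l + 1) - g₁ r) -
        ε * (g (l' + 1) - g r') := by
    rw [hA₁, hA, hM]
    ring
  rw [heq]
  have h1 := norm_sub_le (-((g (θ r) - g (θ l)) + -(g₁ r - g₁ l)) + (g₁ (l + 1) - g₁ r))
    (ε * (g (l' + 1) - g r'))
  have h2 := norm_add_le (-((g (θ r) - g (θ l)) + -(g₁ r - g₁ l))) (g₁ (l + 1) - g₁ r)
  rw [norm_neg] at h2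
  rw [norm_mul, hεn, one_mul] at h1
  linarith [Real.pi_gt_three]

/-! ### Winding in the coordinate at a point of the curve -/

/-- The winding of the loop `c` relative to `x` and `y`, in the coordinate in which `q` is `∞`. -/
noncomputable def relVar (q : RSphere) (c : UnitAddCircle → RSphere) (x y : RSphere) : ℂ :=
  loopVar (coordAt q ∘ c) (finitePart (coordAt q x)) (finitePart (coordAt q y))

theorem coe_finitePart_coordAt {q x : RSphere} (hx : x ≠ q) :
    (finitePart (coordAt q x) : RSphere) = coordAt q x :=
  coe_finitePart (coordAt_ne_infty hx)

theorem coe_finitePart_coordAt_notMem {q x : RSphere} {c : UnitAddCircle → RSphere} (hx : x ≠ q)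
    (hxc : x ∉ range c) : (finitePart (coordAt q x) : RSphere) ∉ range (coordAt q ∘ c) := by
  rw [coe_finitePart_coordAt hx]
  rintro ⟨t, ht⟩
  exact hxc ⟨t, (coordAt q).injective ht⟩

theorem relVar_sub_relVar {q : RSphere} {c : UnitAddCircle → RSphere} (hc : Continuous c)
    (hq : q ∈ range c) {x y v : RSphere} (hx : x ∉ range c) (hy : y ∉ range c)
    (hv : v ∉ range c) : relVar q c x v - relVar q c y v = relVar q c x y := by
  have h := loopVar_add ((coordAt q).continuous.comp hc)
    (coe_finitePart_coordAt_notMem (ne_of_mem_of_not_mem hq hx).symm hx)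
    (coe_finitePart_coordAt_notMem (ne_of_mem_of_not_mem hq hy).symm hy)
    (coe_finitePart_coordAt_notMem (ne_of_mem_of_not_mem hq hv).symm hv)
  rw [relVar, relVar, relVar, ← h]
  ring

theorem relVar_eq_of_mem_connectedComponentIn {q : RSphere} {c : UnitAddCircle → RSphere}
    (hc : Continuous c) (hq : q ∈ range c) {x y v : RSphere} (hx : x ∉ range c)
    (hv : v ∉ range c) (hy : y ∈ connectedComponentIn (range c)ᶜ x) :
    relVar q c x v = relVar q c y v := by
  refine loopVar_eq_of_isPreconnected ((coordAt q).continuous.comp hc)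
    (coe_finitePart_coordAt_notMem (ne_of_mem_of_not_mem hq hv).symm hv)
    (s := coordAt q '' connectedComponentIn (range c)ᶜ x)
    (isPreconnected_connectedComponentIn.image _ (coordAt q).continuous.continuousOn) ?_ ?_
    (mem_image_of_mem _ (mem_connectedComponentIn hx)) (mem_image_of_mem _ hy)
  · rintro _ ⟨z, hz, rfl⟩ ⟨t, ht⟩
    exact connectedComponentIn_subset _ _ hz ⟨t, (coordAt q).injective ht⟩
  · rintro ⟨z, hz, hzi⟩
    rw [← coordAt_self q] at hzi
    exact connectedComponentIn_subset _ _ hz ((coordAt q).injective hzi ▸ hq)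

namespace IsOrientedJordanCurve

variable {C : Set RSphere} {γ : UnitAddCircle → RSphere} {q x y v : RSphere}

theorem image_component (q : RSphere) (hx : x ∉ C) :
    coordAt q '' connectedComponentIn Cᶜ x =
      connectedComponentIn (coordAt q '' C)ᶜ (coordAt q x) := by
  rw [(coordAt q).image_connectedComponentIn (s := Cᶜ) hx, image_compl_eq (coordAt q).bijective]

theorem infty_mem_image (hq : q ∈ C) : OnePoint.infty ∈ coordAt q '' C :=
  ⟨q, hq, coordAt_self q⟩

theorem coordAt_notMem_image (hx : x ∉ C) : coordAt q x ∉ coordAt q '' C := by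
  rintro ⟨z, hz, e⟩
  exact hx ((coordAt q).injective e ▸ hz)

theorem mem_component_iff (q : RSphere) (hx : x ∉ C) :
    coordAt q y ∈ connectedComponentIn (coordAt q '' C)ᶜ (coordAt q x) ↔
      y ∈ connectedComponentIn Cᶜ x := by
  rw [← image_component q hx, (coordAt q).injective.mem_set_image]

theorem relVar_eq_zero_iff (h : IsOrientedJordanCurve C γ) (hq : q ∈ C) (hx : x ∉ C)
    (hy : y ∉ C) : relVar q γ x y = 0 ↔ y ∈ connectedComponentIn Cᶜ x := by
  have hxq : x ≠ q := fun e => hx (e ▸ hq)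
  have hyq : y ≠ q := fun e => hy (e ▸ hq)
  constructor
  · intro h0
    have := (h.comp_homeomorph (coordAt q)).mem_connectedComponentIn_of_loopVar_eq_zero
      (by rw [coe_finitePart_coordAt hxq]; exact coordAt_notMem_image hx)
      (by rw [coe_finitePart_coordAt hyq]; exact coordAt_notMem_image hy) h0
    rwa [coe_finitePart_coordAt hxq, coe_finitePart_coordAt hyq, mem_component_iff q hx] at this
  · intro hm
    rw [← h.range_eq] at hm hq hx hy
    rw [relVar_eq_of_mem_connectedComponentIn h.continuous hq hx hy hm]
    exact loopVar_self ((coordAt q).continuous.comp h.continuous)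
      (coe_finitePart_coordAt_notMem hyq hy)

theorem mem_component_of_notMem (h : IsOrientedJordanCurve C γ) (hq : q ∈ C) (hx : x ∉ C)
    (hy : y ∉ C) (hv : v ∉ C) (hxy : y ∉ connectedComponentIn Cᶜ x)
    (hxv : v ∉ connectedComponentIn Cᶜ x) : v ∈ connectedComponentIn Cᶜ y := by
  have hxq : x ≠ q := fun e => hx (e ▸ hq)
  have hyq : y ≠ q := fun e => hy (e ▸ hq)
  have hvq : v ≠ q := fun e => hv (e ▸ hq)
  rw [← mem_component_iff q hy]
  rw [← mem_component_iff q hx] at hxy hxv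
  have hx' := coordAt_notMem_image (q := q) hx
  have hy' := coordAt_notMem_image (q := q) hy
  have hv' := coordAt_notMem_image (q := q) hv
  rw [← coe_finitePart_coordAt hyq, ← coe_finitePart_coordAt hvq]
  rw [← coe_finitePart_coordAt hxq] at hx' hxy hxv
  rw [← coe_finitePart_coordAt hyq] at hy' hxy
  rw [← coe_finitePart_coordAt hvq] at hv' hxv
  exact (h.comp_homeomorph (coordAt q)).mem_connectedComponentIn_of_notMem hx' hy' hv' hxy hxv

theorem exists_notMem_component (h : IsOrientedJordanCurve C γ) (hq : q ∈ C) (hx : x ∉ C) :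
    ∃ y ∉ C, y ∉ connectedComponentIn Cᶜ x := by
  obtain ⟨w, hw, hw'⟩ := (h.comp_homeomorph (coordAt q)).exists_notMem_connectedComponentIn
    (infty_mem_image hq) (coordAt_notMem_image (q := q) hx)
  obtain ⟨y, rfl⟩ := (coordAt q).surjective w
  exact ⟨y, fun hy => hw ⟨y, hy, rfl⟩, fun hy => hw' ((mem_component_iff q hx).2 hy)⟩

theorem mem_closure_component (h : IsOrientedJordanCurve C γ) (hq : q ∈ C) {p : RSphere}
    (hp : p ∈ C) (hx : x ∉ C) : p ∈ closure (connectedComponentIn Cᶜ x) := by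
  have := (h.comp_homeomorph (coordAt q)).mem_closure_connectedComponentIn (infty_mem_image hq)
    (mem_image_of_mem _ hp) (coordAt_notMem_image (q := q) hx)
  rwa [← image_component q hx, ← (coordAt q).image_closure,
    (coordAt q).injective.mem_set_image] at this

end IsOrientedJordanCurve

namespace IsDeformationSetting

variable {f : RSphere → RSphere} {d : ℕ} {C : Set RSphere} {γ : UnitAddCircle → RSphere}
  {H : RSphere × I → RSphere} {q : RSphere}

theorem continuous_endLoop (S : IsDeformationSetting f d C γ H) : Continuous (endMap H ∘ γ) :=
  S.continuous_endMap.comp S.curve.continuous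

theorem range_endLoop (S : IsDeformationSetting f d C γ H) : range (endMap H ∘ γ) = f ⁻¹' C := by
  rw [range_comp, S.curve.range_eq, S.deformation.image_eq]

theorem post_subset_preimage (S : IsDeformationSetting f d C γ H) :
    postcriticalSet f ⊆ f ⁻¹' C := fun _ hx => S.post_subset (map_mem_post hx)

theorem notMem_of_endMap_notMem (S : IsDeformationSetting f d C γ H) {x : RSphere}
    (hx : endMap H x ∉ f ⁻¹' C) : x ∉ C := fun h => hx (S.map_endMap_mem h)

/-- The times at which a given point is attained form a closed set by compactness of the sphere, and
this set contains every `t < 1`. -/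
theorem surjective_endMap (S : IsDeformationSetting f d C γ H) :
    Function.Surjective (endMap H) := by
  intro y
  have hH := S.deformation.pseudoIsotopy
  set T : Set I := Prod.snd '' (H ⁻¹' {y}) with hT
  have hTc : IsClosed T :=
    (((isClosed_singleton.preimage hH.continuous).isCompact).image continuous_snd).isClosed
  have hsub : Iio (1 : I) ⊆ T := fun t ht => by
    obtain ⟨x, hx⟩ := (hH.homeo t ht).surjective y
    exact ⟨(x, t), hx, rfl⟩
  have h1 : (1 : I) ∈ closure (Iio (1 : I)) := by
    rw [closure_Iio' ⟨0, zero_lt_one⟩]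
    exact mem_Iic.2 le_rfl
  obtain ⟨⟨x, t⟩, hx, rfl⟩ := hTc.closure_subset_iff.2 hsub h1
  exact ⟨x, hx⟩

/-- The winding is invariant under the deformation. -/
theorem relVar_endMap (S : IsDeformationSetting f d C γ H) (hq : q ∈ postcriticalSet f)
    {x y : RSphere} (hx : endMap H x ∉ f ⁻¹' C) (hy : endMap H y ∉ f ⁻¹' C) :
    relVar q (endMap H ∘ γ) (endMap H x) (endMap H y) = relVar q γ x y := by
  have hH := S.deformation.pseudoIsotopy
  have hone : ∀ t : I, t < 1 ∨ t = 1 := fun t => lt_or_eq_of_le t.2.2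
  -- For `t < 1` injectivity of `H_t` keeps the moving point off `q` and off the moving loop; at `t
  -- = 1` this is the assumption on `H₁(x)`.
  have hneq : ∀ x, endMap H x ∉ f ⁻¹' C → ∀ t, H (x, t) ≠ q := by
    intro x hx t e
    rcases hone t with ht | rfl
    · have : x = q := (hH.homeo t ht).injective (e.trans (hH.rel q hq t).symm)
      exact S.notMem_of_endMap_notMem hx (this ▸ S.post_subset hq)
    · exact hx (show H (x, 1) ∈ f ⁻¹' C from e ▸ S.post_subset_preimage hq)
  have hrange : ∀ x, endMap H x ∉ f ⁻¹' C → ∀ t,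
      H (x, t) ∉ range (fun s : UnitAddCircle => H (γ s, t)) := by
    rintro x hx t ⟨s, hs⟩
    rcases hone t with ht | rfl
    · have : γ s = x := (hH.homeo t ht).injective hs
      exact S.notMem_of_endMap_notMem hx (this ▸ S.curve.mem s)
    · refine hx ?_
      have : endMap H (γ s) = endMap H x := hs
      rw [← this]
      exact S.map_endMap_mem (S.curve.mem s)
  have hcont : ∀ x, endMap H x ∉ f ⁻¹' C →
      Continuous fun t : I => finitePart (coordAt q (H (x, t))) := fun x hx => by
    rw [continuous_iff_continuousAt]
    intro t
    refine ContinuousAt.comp (g := finitePart)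
      (continuousAt_finitePart (coordAt_ne_infty (hneq x hx t))) ?_
    exact ((coordAt q).continuous.comp (hH.continuous.comp (by fun_prop))).continuousAt
  have h := loopVar_eq_of_homotopy (c := fun t s => coordAt q (H (γ s, t)))
    (x := fun t => finitePart (coordAt q (H (x, t))))
    (y := fun t => finitePart (coordAt q (H (y, t))))
    ((coordAt q).continuous.comp (hH.continuous.comp
      ((S.curve.continuous.comp continuous_snd).prodMk continuous_fst))) (hcont x hx) (hcont y hy)
    (fun t => coe_finitePart_coordAt_notMem (hneq x hx t) (hrange x hx t))
    (fun t => coe_finitePart_coordAt_notMem (hneq y hy t) (hrange y hy t))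
  simp only [hH.start] at h
  exact h.symm

/-- Behaviour of the winding at an interior point of a `1`-edge. -/
theorem eventually_relVar_eq (S : IsDeformationSetting f d C γ H) (hq : q ∈ postcriticalSet f)
    {a b : ℝ} {θ : ℝ → ℝ} (h : IsEdgeChart f C γ H a b θ) {t₀ : ℝ} (ht₀ : t₀ ∈ Ioo a b) {ε : ℂ}
    (hε : StrictMonoOn θ (Icc a b) ∧ ε = 1 ∨ StrictAntiOn θ (Icc a b) ∧ ε = -1) :
    ∃ N ∈ 𝓝 (endMap H (γ (t₀ : UnitAddCircle))), ∀ u ∈ N, ∀ v ∈ N, u ∉ f ⁻¹' C → v ∉ f ⁻¹' C →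
      relVar q (endMap H ∘ γ) u v = ε * relVar q γ (f u) (f v) := by
  set κ := coordAt q with hκ
  set p := endMap H (γ (t₀ : UnitAddCircle)) with hp
  have hqC : q ∈ C := S.post_subset hq
  have hqC' : q ∈ f ⁻¹' C := S.post_subset_preimage hq
  have hfp : f p ∉ postcriticalSet f := fun hc =>
    h.notMem t₀ ht₀ ((map_endMap_mem_post_iff (S.curve.mem _)).1 hc)
  have hfpq : f p ≠ q := fun e => hfp (e ▸ hq)
  have hpq : p ≠ q := fun e => hfp (e ▸ map_mem_post hq)
  set P := finitePart (κ p) with hP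
  have hPp : (P : RSphere) = κ p := coe_finitePart_coordAt hpq
  set g : RSphere → RSphere := (κ ∘ f) ∘ κ.symm with hg
  have hgr : HasRatPair g d := (S.rat.coordAt_comp q).comp_coordAt_symm q
  have hgκ : ∀ z, g (κ z) = κ (f z) := fun z => by simp [hg]
  have hgP : g P ≠ OnePoint.infty := by
    rw [hPp, hgκ]
    exact coordAt_ne_infty hfpq
  have hgi : ∃ U ∈ 𝓝 (P : RSphere), InjOn g U := by
    by_contra hc
    rw [hPp] at hc
    have hcrit : IsCriticalPoint (κ ∘ f ∘ κ.symm) (κ p) := hc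
    rw [isCriticalPoint_homeomorph_iff κ κ] at hcrit
    exact hcrit (exists_injOn hfp)
  obtain ⟨F, F', hF', hF, hFg⟩ := hgr.exists_hasStrictDerivAt hgP hgi
  have hFP : (F P : RSphere) = κ (f p) := by
    rw [← hFg.self_of_nhds, hPp, hgκ]
  have hlift : Continuous fun t : ℝ => κ (endMap H (γ t)) :=
    κ.continuous.comp (S.continuous_endMap.comp S.curve.continuous_lift)
  have hmain := exists_nhds_loopVar_eq (c₁ := κ ∘ endMap H ∘ γ) (c := κ ∘ γ)
    (κ.continuous.comp S.continuous_endLoop) (κ.continuous.comp S.curve.continuous) hF hF' ht₀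
    h.continuous hε (fun t => ?_) (fun t => ?_) ?_
  · obtain ⟨N, hN, hNe⟩ := hmain
    have hN' : ∀ᶠ w : ℂ in 𝓝 P, w ∈ N ∧ g w = (F w : RSphere) := Filter.Eventually.and hN hFg
    have hfin : ∀ᶠ z in 𝓝 p, finitePart (κ z) ∈ N ∧
        g (finitePart (κ z)) = (F (finitePart (κ z)) : RSphere) := by
      have hc : ContinuousAt (fun z => finitePart (κ z)) p :=
        ContinuousAt.comp (g := finitePart) (continuousAt_finitePart (coordAt_ne_infty hpq))
          κ.continuous.continuousAt
      exact hc.eventually hN'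
    refine ⟨_, hfin, fun u hu v hv huC hvC => ?_⟩
    have hFf : ∀ z, z ∉ f ⁻¹' C → g (finitePart (κ z)) = (F (finitePart (κ z)) : RSphere) →
        F (finitePart (κ z)) = finitePart (κ (f z)) := fun z hz e => by
      rw [coe_finitePart_coordAt (ne_of_mem_of_not_mem hqC' hz).symm, hgκ] at e
      rw [e, finitePart_coe]
    have hr : ∀ z, z ∉ f ⁻¹' C → (finitePart (κ z) : RSphere) ∉ range (κ ∘ endMap H ∘ γ) :=
      fun z hz => coe_finitePart_coordAt_notMem (ne_of_mem_of_not_mem hqC' hz).symm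
        (by rwa [S.range_endLoop])
    have hr' : ∀ z, z ∉ f ⁻¹' C → (finitePart (κ (f z)) : RSphere) ∉ range (κ ∘ γ) :=
      fun z hz => coe_finitePart_coordAt_notMem (fun e => hz (show f z ∈ C from e ▸ hqC))
        (by rw [S.curve.range_eq]; exact hz)
    have := hNe _ hu.1 _ hv.1 (hr u huC) (hr v hvC) (by rw [hFf u huC hu.2]; exact hr' u huC)
      (by rw [hFf v hvC hv.2]; exact hr' v hvC)
    rw [hFf u huC hu.2, hFf v hvC hv.2] at this
    exact this
  -- The loop passes the crossing point once per period: `f p` is not postcritical, so every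
  -- parameter reaching `p` lies off the vertex preimages, where `H₁` is injective.
  · simp only [Function.comp_apply]
    rw [hPp, κ.injective.eq_iff, hp]
    constructor
    · intro e
      have htW : γ (t : UnitAddCircle) ∉ vertexPreimages f C H := fun hc => by
        rw [← map_endMap_mem_post_iff (S.curve.mem _), e] at hc
        exact hfp hc
      exact S.curve.eq_iff.1 (S.injOn_endMap ⟨S.curve.mem _, htW⟩
        ⟨S.curve.mem _, h.notMem t₀ ht₀⟩ e)
    · intro hn
      rw [S.curve.eq_iff.2 hn]
  · simp only [Function.comp_apply]
    rw [hFP, κ.injective.eq_iff, hp, ← h.eq t₀ (Ioo_subset_Icc_self ht₀), S.curve.eq_iff]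
  · have h1 : ∀ᶠ t : ℝ in 𝓝 t₀, ∀ w : ℂ, κ (endMap H (γ (t : UnitAddCircle))) = w →
        g w = (F w : RSphere) := by
      have h2 : ((↑) '' {w : ℂ | g w = (F w : RSphere)} : Set RSphere) ∈
          𝓝 (κ (endMap H (γ (t₀ : UnitAddCircle)))) := by
        rw [← hp, ← hPp]
        exact OnePoint.isOpenMap_coe.image_mem_nhds hFg
      filter_upwards [hlift.continuousAt.eventually h2] with t ht w hw
      obtain ⟨w', hw', e⟩ := ht
      rw [hw] at e
      rw [← OnePoint.coe_injective e]
      exact hw'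
    filter_upwards [h1, Ioo_mem_nhds ht₀.1 ht₀.2] with t ht htab w hw
    simp only [Function.comp_apply] at hw ⊢
    rw [← ht w hw, ← hw, hgκ, h.eq t (Ioo_subset_Icc_self htab)]

/-- Either every edge is oriented coherently and `f ∘ H₁` preserves the sides of the curve, or every
edge is oriented oppositely and `f ∘ H₁` exchanges the sides. -/
theorem dichotomy (S : IsDeformationSetting f d C γ H) :
    ((∀ x, endMap H x ∉ f ⁻¹' C → f (endMap H x) ∈ connectedComponentIn Cᶜ x) ∧
      ∀ a b θ, IsEdgeChart f C γ H a b θ → StrictMonoOn θ (Icc a b)) ∨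
    ((∀ x, endMap H x ∉ f ⁻¹' C → f (endMap H x) ∉ connectedComponentIn Cᶜ x) ∧
      ∀ a b θ, IsEdgeChart f C γ H a b θ → StrictAntiOn θ (Icc a b)) := by
  have hJ := S.curve
  obtain ⟨q, hq⟩ := S.post_nontrivial.nonempty
  have hqC : q ∈ C := S.post_subset hq
  have hqr : q ∈ range γ := by rwa [hJ.range_eq]
  have hqr₁ : q ∈ range (endMap H ∘ γ) := by
    rw [S.range_endLoop]
    exact S.post_subset_preimage hq
  have hr₁ : ∀ z, z ∉ f ⁻¹' C → z ∉ range (endMap H ∘ γ) := fun z hz => by rwa [S.range_endLoop]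
  have hrγ : ∀ z, z ∉ C → z ∉ range γ := fun z hz => by rwa [hJ.range_eq]
  have hclosed : IsClosed (f ⁻¹' C) := hJ.isClosed.preimage S.continuous_map
  obtain ⟨y, hy⟩ : ∃ y, endMap H y ∉ f ⁻¹' C := by
    obtain ⟨z, hz⟩ := hJ.exists_notMem
    obtain ⟨x, rfl⟩ := S.surjective_map z
    obtain ⟨y, rfl⟩ := S.surjective_endMap x
    exact ⟨y, hz⟩
  have hyC : y ∉ C := S.notMem_of_endMap_notMem hy
  obtain ⟨w, hwC, hwy⟩ := hJ.exists_notMem_component hqC hyC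
  have hyw : y ∉ connectedComponentIn Cᶜ w := fun hc =>
    hwy ((connectedComponentIn_eq hc) ▸ mem_connectedComponentIn hwC)
  set e := relVar q γ w y with he
  have he0 : e ≠ 0 := fun h0 => hyw ((hJ.relVar_eq_zero_iff hqC hwC hyC).1 h0)
  let k₀ : RSphere → ℂ := fun z => relVar q γ z y
  have hk₀y : ∀ z ∈ connectedComponentIn Cᶜ y, k₀ z = 0 := fun z hz => by
    have hzC : z ∉ C := connectedComponentIn_subset _ _ hz
    refine (hJ.relVar_eq_zero_iff hqC hzC hyC).2 ?_
    rw [← connectedComponentIn_eq hz]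
    exact mem_connectedComponentIn hyC
  have hk₀w : ∀ z ∈ connectedComponentIn Cᶜ w, k₀ z = e := fun z hz => by
    rw [← hJ.range_eq] at hz
    exact (relVar_eq_of_mem_connectedComponentIn hJ.continuous hqr (hrγ w hwC) (hrγ y hyC) hz).symm
  have hk₀ : ∀ z ∉ C, k₀ z = 0 ∨ k₀ z = e := fun z hz => by
    by_cases hzy : z ∈ connectedComponentIn Cᶜ y
    · exact Or.inl (hk₀y z hzy)
    · exact Or.inr (hk₀w z (hJ.mem_component_of_notMem hqC hyC hwC hz hwy hzy))
  have hk₀iff : ∀ z ∉ C, ∀ z' ∉ C, k₀ z = k₀ z' ↔ z' ∈ connectedComponentIn Cᶜ z := by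
    intro z hz z' hz'
    rw [← hJ.relVar_eq_zero_iff hqC hz hz', ← relVar_sub_relVar hJ.continuous hqr (hrγ z hz)
      (hrγ z' hz') (hrγ y hyC), sub_eq_zero]
  let k : RSphere → ℂ := fun z => relVar q (endMap H ∘ γ) z (endMap H y)
  -- Homotopy invariance: it transfers the two-valuedness of `k₀` to `k`.
  have hkk₀ : ∀ x, endMap H x ∉ f ⁻¹' C → k (endMap H x) = k₀ x := fun x hx =>
    S.relVar_endMap hq hx hy
  have hk : ∀ z ∉ f ⁻¹' C, k z = 0 ∨ k z = e := fun z hz => by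
    obtain ⟨x, rfl⟩ := S.surjective_endMap z
    rw [hkk₀ x hz]
    exact hk₀ x (S.notMem_of_endMap_notMem hz)
  have hksub : ∀ u ∉ f ⁻¹' C, ∀ v ∉ f ⁻¹' C, k u - k v = relVar q (endMap H ∘ γ) u v :=
    fun u hu v hv => relVar_sub_relVar S.continuous_endLoop hqr₁ (hr₁ u hu) (hr₁ v hv) (hr₁ _ hy)
  have hk₀sub : ∀ u ∉ C, ∀ v ∉ C, k₀ u - k₀ v = relVar q γ u v :=
    fun u hu v hv => relVar_sub_relVar hJ.continuous hqr (hrγ u hu) (hrγ v hv) (hrγ y hyC)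
  let Pos : RSphere → Prop := fun z => ∀ᶠ u in 𝓝 z, u ∉ f ⁻¹' C → k u = k₀ (f u)
  let Neg : RSphere → Prop := fun z => ∀ᶠ u in 𝓝 z, u ∉ f ⁻¹' C → k u = e - k₀ (f u)
  -- Both sides of `C` accumulate at every point of `C` and `f` is open, so near the crossing point
  -- there are `u` and `v` whose images lie on the sides where `k₀` is `0` and `e`.
  have hcross : ∀ {a b θ}, IsEdgeChart f C γ H a b θ → ∀ t ∈ Ioo a b, ∀ ε : ℂ,
      (StrictMonoOn θ (Icc a b) ∧ ε = 1 ∨ StrictAntiOn θ (Icc a b) ∧ ε = -1) →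
      ∃ u v, ∀ᶠ z in 𝓝 (endMap H (γ (t : UnitAddCircle))),
        u ∉ f ⁻¹' C ∧ v ∉ f ⁻¹' C ∧ k u - k v = ε * (0 - e) ∧
        (z ∉ f ⁻¹' C → k z - k v = ε * (k₀ (f z) - e)) := by
    intro a b θ h t ht ε hε
    obtain ⟨N, hN, hNe⟩ := S.eventually_relVar_eq hq h ht hε
    have hfN := S.isOpenMap_map.image_mem_nhds hN
    have hfC : f (endMap H (γ (t : UnitAddCircle))) ∈ C := S.map_endMap_mem (hJ.mem _)
    obtain ⟨_, hu', ⟨u, huN, rfl⟩⟩ := mem_closure_iff_nhds'.1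
      (hJ.mem_closure_component hqC hfC hyC) _ hfN |> fun ⟨z, hz⟩ => (⟨z.1, z.2, hz⟩ :
        ∃ z, z ∈ connectedComponentIn Cᶜ y ∧ z ∈ f '' N)
    obtain ⟨_, hv', ⟨v, hvN, rfl⟩⟩ := mem_closure_iff_nhds'.1
      (hJ.mem_closure_component hqC hfC hwC) _ hfN |> fun ⟨z, hz⟩ => (⟨z.1, z.2, hz⟩ :
        ∃ z, z ∈ connectedComponentIn Cᶜ w ∧ z ∈ f '' N)
    have huC : u ∉ f ⁻¹' C := connectedComponentIn_subset _ _ hu'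
    have hvC : v ∉ f ⁻¹' C := connectedComponentIn_subset _ _ hv'
    have hdiff : ∀ z ∈ N, z ∉ f ⁻¹' C → k z - k v = ε * (k₀ (f z) - e) := fun z hz hzC => by
      rw [hksub z hzC v hvC, hNe z hz v hvN hzC hvC, ← hk₀sub (f z) hzC (f v) hvC, hk₀w _ hv']
    refine ⟨u, v, Filter.mem_of_superset hN fun z hz => ⟨huC, hvC, ?_, hdiff z hz⟩⟩
    rw [← hk₀y _ hu']
    exact hdiff u huN huC
  have hmono : ∀ {a b θ}, IsEdgeChart f C γ H a b θ → StrictMonoOn θ (Icc a b) →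
      ∀ t ∈ Ioo a b, Pos (endMap H (γ (t : UnitAddCircle))) := by
    intro a b θ h hm t ht
    obtain ⟨u, v, huv⟩ := hcross h t ht 1 (Or.inl ⟨hm, rfl⟩)
    filter_upwards [huv] with z hz hzC
    obtain ⟨hu, hv, h1, h2⟩ := hz
    -- As `k` takes only the values `0` and `e`, the jump `k u - k v = -e` leaves only `k u = 0` and
    -- `k v = e`.
    have hkv : k v = e := by
      rcases hk u hu with hu0 | hu0 <;> rcases hk v hv with hv0 | hv0
      · rw [hu0, hv0] at h1
        exact absurd (by linear_combination h1) he0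
      · exact hv0
      · rw [hu0, hv0] at h1
        exact absurd (by linear_combination h1 / 2) he0
      · exact hv0
    have := h2 hzC
    rw [hkv] at this
    linear_combination this
  have hanti : ∀ {a b θ}, IsEdgeChart f C γ H a b θ → StrictAntiOn θ (Icc a b) →
      ∀ t ∈ Ioo a b, Neg (endMap H (γ (t : UnitAddCircle))) := by
    intro a b θ h hm t ht
    obtain ⟨u, v, huv⟩ := hcross h t ht (-1) (Or.inr ⟨hm, rfl⟩)
    filter_upwards [huv] with z hz hzC
    obtain ⟨hu, hv, h1, h2⟩ := hz
    have hkv : k v = 0 := by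
      rcases hk u hu with hu0 | hu0 <;> rcases hk v hv with hv0 | hv0
      · exact hv0
      · rw [hu0, hv0] at h1
        exact absurd (by linear_combination -h1 / 2) he0
      · exact hv0
      · rw [hu0, hv0] at h1
        exact absurd (by linear_combination -h1) he0
    have := h2 hzC
    rw [hkv] at this
    linear_combination this
  -- Otherwise `C` would contain an open set, although each of its points is a limit of points off
  -- `C`. Density makes `Pos` and `Neg` exclusive, since they are not vacuous near any point.
  have hdense : ∀ z, ∃ᶠ u in 𝓝 z, u ∉ f ⁻¹' C := by
    intro z hz
    have hz' : ∀ᶠ u in 𝓝 z, f u ∈ C := hz.mono fun u hu => not_not.1 hu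
    have h1 : C ∈ 𝓝 (f z) := Filter.mem_of_superset (S.isOpenMap_map.image_mem_nhds hz')
      (image_subset_iff.2 fun u hu => hu)
    have h2 := hJ.mem_closure_component hqC hz'.self_of_nhds hyC
    obtain ⟨⟨u, hu⟩, hu'⟩ := mem_closure_iff_nhds'.1 h2 _ h1
    exact connectedComponentIn_subset _ _ hu hu'
  have hnb : ∀ z, Pos z → Neg z → False := by
    intro z hp hn
    obtain ⟨u, hu, hpu, hnu⟩ := ((hdense z).and_eventually (hp.and hn)).exists
    have h1 := hpu hu
    rw [hnu hu] at h1
    rcases hk₀ (f u) hu with h0 | h0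
    · rw [h0] at h1
      exact he0 (by linear_combination h1)
    · rw [h0] at h1
      exact he0 (by linear_combination -h1)
  have hVfin : (oneVertices f).Finite := by
    refine (S.deformation.finite.image (endMap H)).subset fun v hv => ?_
    have hvC : v ∈ f ⁻¹' C := S.post_subset hv
    rw [← S.deformation.image_eq] at hvC
    obtain ⟨z, hz, rfl⟩ := hvC
    exact ⟨z, ⟨hv, hz⟩, rfl⟩
  have hoff : ∀ z ∉ f ⁻¹' C, Pos z ∧ k z = k₀ (f z) ∨ Neg z ∧ k z = e - k₀ (f z) := by
    intro z hz
    have hkloc : ∀ᶠ u in 𝓝 z, k u = k z := by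
      have : connectedComponentIn (range (endMap H ∘ γ))ᶜ z ∈ 𝓝 z := by
        rw [S.range_endLoop]
        exact hclosed.isOpen_compl.connectedComponentIn.mem_nhds (mem_connectedComponentIn hz)
      filter_upwards [this] with u hu
      exact (relVar_eq_of_mem_connectedComponentIn S.continuous_endLoop hqr₁ (hr₁ z hz)
        (hr₁ _ hy) hu).symm
    have hk₀loc : ∀ᶠ u in 𝓝 z, k₀ (f u) = k₀ (f z) := by
      have h1 : connectedComponentIn Cᶜ (f z) ∈ 𝓝 (f z) :=
        hJ.isClosed.isOpen_compl.connectedComponentIn.mem_nhds (mem_connectedComponentIn hz)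
      filter_upwards [S.continuous_map.continuousAt.eventually h1] with u hu
      exact ((hk₀iff _ hz _ (connectedComponentIn_subset _ _ hu)).2 hu).symm
    have hcase : k z = k₀ (f z) ∨ k z = e - k₀ (f z) := by
      rcases hk z hz with h1 | h1 <;> rcases hk₀ (f z) hz with h2 | h2 <;> simp [h1, h2]
    refine hcase.imp (fun h1 => ⟨?_, h1⟩) (fun h1 => ⟨?_, h1⟩)
    · filter_upwards [hkloc, hk₀loc] with u hu hu' _
      rw [hu, hu', h1]
    · filter_upwards [hkloc, hk₀loc] with u hu hu' _
      rw [hu, hu', h1]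
  have hcov : (oneVertices f)ᶜ ⊆ {z | Pos z} ∪ {z | Neg z} := by
    intro z hz
    by_cases hzC : z ∈ f ⁻¹' C
    · have hzC' := hzC
      rw [← S.deformation.image_eq] at hzC'
      obtain ⟨x, hx, rfl⟩ := hzC'
      obtain ⟨t, -, rfl⟩ := hJ.exists_eq 0 hx
      obtain ⟨a, b, θ, ht, h⟩ := S.exists_isEdgeChart (t₀ := t) fun hc => hz hc.1
      exact h.mono.imp (fun hm => hmono h hm t ht) fun hm => hanti h hm t ht
    · exact (hoff z hzC).imp And.left And.left
  have hVC : ∀ z ∉ f ⁻¹' C, z ∈ (oneVertices f)ᶜ := fun z hz hc => hz (S.post_subset hc)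
  have hVt : ∀ {a b θ}, IsEdgeChart f C γ H a b θ → ∀ t ∈ Ioo a b,
      endMap H (γ (t : UnitAddCircle)) ∈ (oneVertices f)ᶜ := fun h t ht hc =>
    h.notMem t ht ⟨hc, hJ.mem _⟩
  have hxk : ∀ x, endMap H x ∉ f ⁻¹' C →
      (k (endMap H x) = k₀ (f (endMap H x)) ↔
        f (endMap H x) ∈ connectedComponentIn Cᶜ x) := fun x hx => by
    rw [hkk₀ x hx, hk₀iff x (S.notMem_of_endMap_notMem hx) _ hx]
  -- Connectedness of the sphere minus the finitely many `1`-vertices makes the sign global.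
  rcases (isPreconnected_compl_of_finite hVfin).subset_or_subset isOpen_setOfPred_eventually_nhds
    isOpen_setOfPred_eventually_nhds (disjoint_left.2 hnb) hcov with hall | hall
  · left
    refine ⟨fun x hx => (hxk x hx).1 ?_, fun a b θ h => ?_⟩
    · exact (Filter.Eventually.self_of_nhds (hall (hVC _ hx))) hx
    · refine h.mono.resolve_right fun hm => ?_
      obtain ⟨t, ht⟩ := exists_between h.lt
      exact hnb _ (hall (hVt h t ht)) (hanti h hm t ht)
  · right
    refine ⟨fun x hx hc => ?_, fun a b θ h => ?_⟩
    · have h1 := (Filter.Eventually.self_of_nhds (hall (hVC _ hx))) hx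
      rcases hoff _ hx with h2 | h2
      · exact hnb _ h2.1 (hall (hVC _ hx))
      · have h3 := (hxk x hx).2 hc
        rw [h3] at h1
        rcases hk₀ _ hx with h0 | h0
        · rw [h0] at h1
          exact he0 (by linear_combination -h1)
        · rw [h0] at h1
          exact he0 (by linear_combination h1)
    · refine h.mono.resolve_left fun hm => ?_
      obtain ⟨t, ht⟩ := exists_between h.lt
      exact hnb _ (hmono h hm t ht) (hall (hVt h t ht))

/-! ### From monotone edge charts to orientations of `1`-edges. -/

theorem exists_edgeChart (S : IsDeformationSetting f d C γ H) :
    ∃ a b θ, IsEdgeChart f C γ H a b θ := by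
  obtain ⟨t, ht⟩ : ∃ t : ℝ, γ (t : UnitAddCircle) ∉ vertexPreimages f C H := by
    by_contra! hall
    have h1 : (γ '' univ).Finite := S.deformation.finite.subset (by
      rintro _ ⟨s, -, rfl⟩
      obtain ⟨t, -, rfl⟩ := unitAddCircle_exists_coe_eq 0 s
      exact hall t)
    have h2 : ((fun t : ℝ => γ t) '' Icc 0 (1 / 2)).Finite :=
      h1.subset (by rintro _ ⟨t, -, rfl⟩; exact ⟨_, mem_univ _, rfl⟩)
    exact (Icc_infinite (by norm_num : (0 : ℝ) < 1 / 2))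
      (h2.of_finite_image (S.curve.injOn_lift (by norm_num)))
  obtain ⟨a, b, θ, -, h⟩ := S.exists_isEdgeChart ht
  exact ⟨a, b, θ, h⟩

theorem isOrientationPreserving (S : IsDeformationSetting f d C γ H)
    (hm : ∀ a b θ, IsEdgeChart f C γ H a b θ → StrictMonoOn θ (Icc a b)) :
    IsOrientationPreservingDeformation f C γ H := by
  rintro E A - hA rfl
  obtain ⟨a, b, θ, h, rfl⟩ := S.exists_isEdgeChart_of_isDeformedArc hA
  exact h.pushOrientation_eq_of_strictMonoOn S.curve S.continuous_endMap (hm a b θ h)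

theorem isOrientationReversing (S : IsDeformationSetting f d C γ H)
    (hm : ∀ a b θ, IsEdgeChart f C γ H a b θ → StrictAntiOn θ (Icc a b)) :
    IsOrientationReversingDeformation f C γ H := by
  rintro E A - hA rfl
  obtain ⟨a, b, θ, h, rfl⟩ := S.exists_isEdgeChart_of_isDeformedArc hA
  exact h.pushOrientation_eq_of_strictAntiOn S.curve S.continuous_endMap (hm a b θ h)

theorem not_preserving_and_reversing (S : IsDeformationSetting f d C γ H) :
    ¬ (IsOrientationPreservingDeformation f C γ H ∧ IsOrientationReversingDeformation f C γ H) := by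
  rintro ⟨hp, hr⟩
  obtain ⟨a, b, θ, h⟩ := S.exists_edgeChart
  have hA := S.isDeformedArc h
  have hE := S.isOneEdge_image hA
  have h1 := hp _ _ hE hA rfl
  have h2 := hr _ _ hE hA rfl
  have hne := h.pushOrientation_nonempty S.curve
  rw [h1] at hne
  exact ne_oppositeOrientation_pullOrientation S.curve hne (h1.symm.trans h2)

end IsDeformationSetting

/-! ### Tiles and their colors -/

theorem IsTile.eq_closure {K X : Set RSphere} (hX : IsTile K X) {x : RSphere} (hx : x ∈ X)
    (hxK : x ∉ K) : X = closure (connectedComponentIn Kᶜ x) := by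
  obtain ⟨_, ⟨z, hz, rfl⟩, rfl⟩ := hX
  rw [connectedComponentIn_eq (closure_connectedComponentIn_inter_subset hz ⟨hx, hxK⟩)]

theorem closure_component_eq_iff {K : Set RSphere} {x y : RSphere} (hx : x ∉ K) (hy : y ∉ K) :
    closure (connectedComponentIn Kᶜ x) = closure (connectedComponentIn Kᶜ y) ↔
      y ∈ connectedComponentIn Kᶜ x := by
  constructor
  · intro e
    refine closure_connectedComponentIn_inter_subset hx ⟨?_, hy⟩
    rw [e]
    exact subset_closure (mem_connectedComponentIn hy)
  · intro h
    rw [connectedComponentIn_eq h]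

/-- A continuous open map sends the components of the preimage of an open set onto components. -/
theorem image_component_preimage {f : RSphere → RSphere} (hfc : Continuous f) (hfo : IsOpenMap f)
    {C : Set RSphere} (hC : IsClosed C) {x : RSphere} (hx : x ∉ f ⁻¹' C) :
    f '' connectedComponentIn (f ⁻¹' C)ᶜ x = connectedComponentIn Cᶜ (f x) := by
  set U := connectedComponentIn (f ⁻¹' C)ᶜ x with hU
  have hxU : x ∈ U := mem_connectedComponentIn hx
  have hUo : IsOpen U := (hC.preimage hfc).isOpen_compl.connectedComponentIn
  apply Subset.antisymm
  · refine (isPreconnected_connectedComponentIn.image f hfc.continuousOn).subset_connectedComponentIn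
      ⟨x, hxU, rfl⟩ ?_
    rintro _ ⟨z, hz, rfl⟩
    have h1 : z ∈ (f ⁻¹' C)ᶜ := connectedComponentIn_subset _ _ hz
    exact h1
  -- The frontier of `U` is mapped into `C`, so the target component is covered by the disjoint open
  -- sets `f '' U` and `(f '' closure U)ᶜ`, and it meets the first.
  · refine isPreconnected_connectedComponentIn.subset_left_of_subset_union (hfo U hUo)
      (v := (f '' closure U)ᶜ) (isClosed_closure.isCompact.image hfc).isClosed.isOpen_compl
      (disjoint_compl_right_iff_subset.2 (image_mono subset_closure)) ?_
      ⟨f x, mem_connectedComponentIn hx, ⟨x, hxU, rfl⟩⟩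
    intro y hy
    by_cases hyU : y ∈ f '' closure U
    · left
      obtain ⟨z, hz, rfl⟩ := hyU
      have h1 : f z ∈ Cᶜ := connectedComponentIn_subset _ _ hy
      exact ⟨z, closure_connectedComponentIn_inter_subset hx ⟨hz, h1⟩, rfl⟩
    · exact Or.inr hyU

theorem IsTile.image_eq_closure {f : RSphere → RSphere} (hfc : Continuous f) (hfo : IsOpenMap f)
    {C : Set RSphere} (hC : IsClosed C) {X : Set RSphere} (hX : IsTile (f ⁻¹' C) X) {x : RSphere}
    (hx : x ∈ X) (hxC : x ∉ f ⁻¹' C) : f '' X = closure (connectedComponentIn Cᶜ (f x)) := by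
  rw [hX.eq_closure hx hxC, ← image_component_preimage hfc hfo hC hxC]
  exact image_closure_of_isCompact isClosed_closure.isCompact hfc.continuousOn

/-- Every set other than `Xw` counts as black, so black determines a tile only because the curve has
at most two complementary components. -/
theorem zeroTileColor_eq_iff {C : Set RSphere} {γ : UnitAddCircle → RSphere}
    (hJ : IsOrientedJordanCurve C γ) {Xw : Set RSphere} (hXw : IsTile C Xw) {x y : RSphere}
    (hx : x ∉ C) (hy : y ∉ C) :
    zeroTileColor Xw (closure (connectedComponentIn Cᶜ x)) =
      zeroTileColor Xw (closure (connectedComponentIn Cᶜ y)) ↔ y ∈ connectedComponentIn Cᶜ x := by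
  obtain ⟨_, ⟨w, hw, rfl⟩, rfl⟩ := hXw
  constructor
  · intro h
    by_contra hyx
    have hq := hJ.mem 0
    by_cases hxw : w ∈ connectedComponentIn Cᶜ x
    · have hne : ¬ closure (connectedComponentIn Cᶜ y) = closure (connectedComponentIn Cᶜ w) := by
        rw [closure_component_eq_iff hy hw]
        intro hyw
        rw [connectedComponentIn_eq hxw, ← connectedComponentIn_eq hyw] at hyx
        exact hyx (mem_connectedComponentIn hy)
      simp [zeroTileColor, (closure_component_eq_iff hx hw).2 hxw, hne] at h
    · have hyw := hJ.mem_component_of_notMem hq hx hy hw hyx hxw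
      have hne : ¬ closure (connectedComponentIn Cᶜ x) = closure (connectedComponentIn Cᶜ w) := by
        rwa [closure_component_eq_iff hx hw]
      simp [zeroTileColor, (closure_component_eq_iff hy hw).2 hyw, hne] at h
  · intro h
    rw [connectedComponentIn_eq h]

theorem mainTheorem10 (f : RSphere → RSphere) (d : ℕ) (hd : 2 ≤ d)
    (hf : IsRationalMapOfDegree f d) (hpcf : (postcriticalSet f).Finite)
    (C : Set RSphere) (γ : UnitAddCircle → RSphere) (hC : IsOrientedJordanCurve C γ)
    (hpost : postcriticalSet f ⊆ C)
    (Xw : Set RSphere) (hXw : IsTile C Xw)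
    (H : RSphere × unitInterval → RSphere) (hH : IsElementaryDeformation f C H) :
    Xor (IsOrientationPreservingDeformation f C γ H)
      (IsOrientationReversingDeformation f C γ H) ∧
    (∀ x y : RSphere, endMap H x ∉ f ⁻¹' C → endMap H y ∉ f ⁻¹' C →
      ∀ X₀ Y₀ X₁ Y₁ : Set RSphere,
        IsTile C X₀ → x ∈ X₀ → IsTile C Y₀ → y ∈ Y₀ →
        IsTile (f ⁻¹' C) X₁ → endMap H x ∈ X₁ → IsTile (f ⁻¹' C) Y₁ → endMap H y ∈ Y₁ →
        (zeroTileColor Xw X₀ = zeroTileColor Xw Y₀ ↔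
          oneTileColor f Xw X₁ = oneTileColor f Xw Y₁)) ∧
    (∀ x : RSphere, endMap H x ∉ f ⁻¹' C →
      ∀ X₀ X₁ : Set RSphere,
        IsTile C X₀ → x ∈ X₀ → IsTile (f ⁻¹' C) X₁ → endMap H x ∈ X₁ →
        (zeroTileColor Xw X₀ = oneTileColor f Xw X₁ ↔
          IsOrientationPreservingDeformation f C γ H)) := by
  have S : IsDeformationSetting f d C γ H := ⟨hf.hasRatPair (by omega), hd, hpcf, hC, hpost, hH⟩
  have hnot := S.not_preserving_and_reversing
  have htile : ∀ x X₀, endMap H x ∉ f ⁻¹' C → IsTile C X₀ → x ∈ X₀ →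
      X₀ = closure (connectedComponentIn Cᶜ x) := fun x X₀ hx hX hxX =>
    hX.eq_closure hxX (S.notMem_of_endMap_notMem hx)
  have htile₁ : ∀ x X₁, endMap H x ∉ f ⁻¹' C → IsTile (f ⁻¹' C) X₁ → endMap H x ∈ X₁ →
      f '' X₁ = closure (connectedComponentIn Cᶜ (f (endMap H x))) := fun x X₁ hx hX hxX =>
    hX.image_eq_closure S.continuous_map S.isOpenMap_map hC.isClosed hxX hx
  rcases S.dichotomy with ⟨hside, hm⟩ | ⟨hside, hm⟩
  · have hp := S.isOrientationPreserving hm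
    refine ⟨Or.inl ⟨hp, fun hr => hnot ⟨hp, hr⟩⟩, ?_, ?_⟩
    · intro x y hx hy X₀ Y₀ X₁ Y₁ hX₀ hxX₀ hY₀ hyY₀ hX₁ hxX₁ hY₁ hyY₁
      rw [oneTileColor, oneTileColor, htile x X₀ hx hX₀ hxX₀, htile y Y₀ hy hY₀ hyY₀,
        htile₁ x X₁ hx hX₁ hxX₁, htile₁ y Y₁ hy hY₁ hyY₁, connectedComponentIn_eq (hside x hx),
        connectedComponentIn_eq (hside y hy)]
    · intro x hx X₀ X₁ hX₀ hxX₀ hX₁ hxX₁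
      rw [oneTileColor, htile x X₀ hx hX₀ hxX₀, htile₁ x X₁ hx hX₁ hxX₁,
        connectedComponentIn_eq (hside x hx)]
      simp [hp]
  · have hr := S.isOrientationReversing hm
    have hp : ¬ IsOrientationPreservingDeformation f C γ H := fun hp => hnot ⟨hp, hr⟩
    refine ⟨Or.inr ⟨hr, hp⟩, ?_, ?_⟩
    · intro x y hx hy X₀ Y₀ X₁ Y₁ hX₀ hxX₀ hY₀ hyY₀ hX₁ hxX₁ hY₁ hyY₁
      have hxC := S.notMem_of_endMap_notMem hx
      have hyC := S.notMem_of_endMap_notMem hy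
      rw [oneTileColor, oneTileColor, htile x X₀ hx hX₀ hxX₀, htile y Y₀ hy hY₀ hyY₀,
        htile₁ x X₁ hx hX₁ hxX₁, htile₁ y Y₁ hy hY₁ hyY₁, zeroTileColor_eq_iff hC hXw hxC hyC,
        zeroTileColor_eq_iff hC hXw hx hy]
      -- With two sides, exchanging the side of both points preserves whether they lie on the same
      -- one.
      constructor
      · intro hxy
        refine hC.mem_component_of_notMem (hC.mem 0) hxC hx hy (hside x hx) ?_
        rw [connectedComponentIn_eq hxy]
        exact hside y hy
      · intro hxy
        by_contra hne
        have h1 := hC.mem_component_of_notMem (hC.mem 0) hxC hx hyC (hside x hx) hne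
        rw [connectedComponentIn_eq hxy] at h1
        refine hside y hy ?_
        rw [← connectedComponentIn_eq h1]
        exact mem_connectedComponentIn hy
    · intro x hx X₀ X₁ hX₀ hxX₀ hX₁ hxX₁
      rw [oneTileColor, htile x X₀ hx hX₀ hxX₀, htile₁ x X₁ hx hX₁ hxX₁,
        zeroTileColor_eq_iff hC hXw (S.notMem_of_endMap_notMem hx) hx]
      exact iff_of_false (hside x hx) hp
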